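/- **Preservation for the region semantics of Reggio.** *Syntax.* Fix countable sets of region identifiers $r$, object identifiers $\iota$, class names $C$ and names $x,y,w,f,g$ (variables and fields, one of them being $\mathtt{val}$). Capabilities are $k\in\{\mathtt{iso},\mathtt{var},\mathtt{mut},\mathtt{tmp},\mathtt{paused},\mathtt{imm}\}$. Types are $t ::= k\,CL \mid t|t$ with $CL ::= C\mid \mathtt{Cell}[t]$; tags are $\#CL ::= \#C\mid\#\mathtt{Cell}$, and $\#C<\#:C$, $\#\mathtt{Cell}<\#:\mathtt{Cell}[t]$. A fixed class table gives each class $C$ a finite list $\mathrm{ftypes}(C)$ of typed fields with distinct names, no field having capability $\mathtt{var}$; $\mathrm{ftypes}(\mathtt{Cell}[t])=(\mathtt{val}:t)$, and $\mathrm{ftype}(CL,f)$ is the type of field $f$. Values are $v=(k,\iota)$; bindings $F$ map names to values or to $\mathbf{undef}$; objects are $o=(\#CL,F)$; stores $S$ map object identifiers to objects; a heap $H$ is a set of regions $(r,S)$ with distinct $r$; a frame is $(r,S,F)$, $S$ being its temporary store. A configuration $\langle RS;H_{op};H_{cl};H_{fr}\rangle$ consists of a stack of frames, newest first, and the heaps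 of open, closed and frozen regions. A context $\Gamma$ maps names to types or $\mathbf{undef}$; $\overline\Gamma=\Gamma_1\underset{y_1.f_1}{::}\Gamma_2\underset{y_2.f_2}{::}\cdots::\Gamma_n$ is a stack of contexts, newest first, marked with the paths through which regions were entered. $\Gamma_1|\Gamma_2$ (defined for equal domains) maps $x$ to $t_1|t_2$ if $x:t_i$ in $\Gamma_i$, and to $\mathbf{undef}$ if $x$ is $\mathbf{undef}$ in one of them; stacks of equal length and marks are joined pointwise. *Types.* $\mathrm{cap}(K,t)$ says that all top-level capabilities of $t$ lie in $K$; $K^c$ is the complement. $\mathrm{make\_iso}$, $\mathrm{make\_mut}$, $\mathrm{make\_imm}$ replace top-level $\mathtt{mut}$ by $\mathtt{iso}$, $\mathtt{iso}$ by $\mathtt{mut}$, $\mathtt{iso}$ by $\mathtt{imm}$. Subtyping is generated by $t<:t$; $t<:t_1|t_2$ if $t<:t_1$ or $t<:t_2$; $t_1|t_2<:t$ if $t_1<:t$ and $t_2<:t$; and $k\,\mathtt{Cell}[t]<:k\,\mathtt{Cell}[t']$ if $t<:t'$ and $t'<:t$. Viewpoint adaptation $k\odot k'$ is defined exactly as follows: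 $\mathtt{mut}\odot k'=k'$ for $k'\in\{\mathtt{mut},\mathtt{imm}\}$; $k\odot k'=k'$ for $k\in\{\mathtt{tmp},\mathtt{var}\}$, $k'\in\{\mathtt{mut},\mathtt{tmp},\mathtt{imm},\mathtt{paused}\}$; $\mathtt{imm}\odot k'=\mathtt{imm}$ for $k'\neq\mathtt{var}$; $\mathtt{paused}\odot k'=\mathtt{paused}$ for $k'\in\{\mathtt{mut},\mathtt{tmp},\mathtt{paused},\mathtt{var}\}$; $\mathtt{paused}\odot\mathtt{imm}=\mathtt{imm}$. It extends to types at top level, being defined if it is defined on all parts of a union. Well-formedness: $\vdash k\,C$ iff for $k\in\{\mathtt{mut},\mathtt{iso}\}$ all fields of $C$ satisfy $\mathrm{cap}(\{\mathtt{mut},\mathtt{iso},\mathtt{imm}\},\cdot)$; $\vdash k\,\mathtt{Cell}[t]$ iff $\vdash t$, $\mathrm{cap}(\{\mathtt{var}\}^c,t)$ and, for $k\in\{\mathtt{mut},\mathtt{iso}\}$, $\mathrm{cap}(\{\mathtt{mut},\mathtt{iso},\mathtt{imm}\},t)$; $\vdash t_1|t_2$ iff $\vdash t_1$ and $\vdash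 t_2$; $\vdash\Gamma$ iff all types in $\Gamma$ are well formed. *Uses.* A use $u$ is $x$ or $\mathtt{drop}\,x$. $\mathrm{get}(F,x)=(F(x),F)$ if $F(x)=(k,\iota)$ with $k\notin\{\mathtt{iso},\mathtt{var}\}$; $\mathrm{get}(F,\mathtt{drop}\,x)=(F(x),F[x\mapsto\mathbf{undef}])$ if $F(x)$ is a value; otherwise undefined. $\Gamma\vdash u:t\dashv\Gamma'$ is generated by: $\Gamma\vdash x:t\dashv\Gamma$ if $\vdash\Gamma$, $\Gamma(x)=t$, $\mathrm{cap}(\{\mathtt{iso},\mathtt{var}\}^c,t)$; $\Gamma\vdash\mathtt{drop}\,x:t\dashv\Gamma[x:\mathbf{undef}]$ if $\vdash\Gamma$, $\Gamma(x)=t$; subsumption in $t$; and, if $\Gamma(y)=t_1|t_2$ and $\Gamma[y:t_i]\vdash u:t_i'\dashv\Gamma_i$ for $i=1,2$, then $\Gamma\vdash u:t_1'|t_2'\dashv\Gamma_1|\Gamma_2$. Lists of uses $\overline u$ are evaluated and typed from left to right ($\Gamma\vdash\overline u:\overline t\dashv\Gamma'$). *Effects and steps.* Effects $\mathit{Eff}$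 and the steps $\mathit{rcfg}\xrightarrow{\mathit{Eff}}\mathit{rcfg}'$ are the following. The top frame is $(r,S,F)$, the bindings after the uses are $F'$, and parts not mentioned do not change. The bound names $x$ must not be in the domain of the frame they are added to, names bound together are distinct, and allocated objects and regions get unused identifiers. An object $\iota$ is looked up first in the temporary stores, newest frame first, then in the heaps mentioned. - $\mathrm{load}(x,y.f)$: for $F(y)=(k_y,\iota_y)$ and the object $\iota_y$ (stack, $H_{op}$, $H_{fr}$) with $f\mapsto(k_f,\iota_f)$, bind $x\mapsto(k_y\odot k_f,\iota_f)$. - $\mathrm{swap}(x,y.f,u)$: for $v$ the value of $u$ and $F'(y)=(k_y,\iota_y)$ with $\iota_y$ in $S$ or in $H_{op}$, replace the content $v'$ of field $f$ of $\iota_y$ by $v$, and bind $x\mapsto v'$. - $\mathrm{halloc}(x,k,\#C,\overline u)$: allocate an object of class $C$ whose fields are the values of $\overline u$; if $k=\mathtt{mut}$, in the region $r$ of $H_{op}$; if $k=\mathtt{iso}$, in a new closed region that contains nothing else. Bind $x$ to it with capability $k$. $\mathrm{salloc}(x,k,\#CL,\overline u)$, $k\in\{\mathtt{tmp},\mathtt{var}\}$: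 the same in the temporary store $S$. - $\mathrm{freeze}(x,u)$: for $u$ of value $(k,\iota)$ with $\iota$ in a closed region $R$, all regions of $H_{op}*H_{cl}$ reachable from $R$ through references being closed, move $R$ and these regions to $H_{fr}$, and bind $x\mapsto(\mathtt{imm},\iota)$. $\mathrm{merge}(x,u)$: for such $\iota$ and $R$, move the objects of $R$ into the region $r$ of $H_{op}$ (whose store must be disjoint from that of $R$), remove $R$, and bind $x\mapsto(\mathtt{mut},\iota)$. - $\mathrm{cast}(x,u,k\,C)$: for $u$ of value $(k,\iota)$, $\iota$ being an object anywhere with tag $\#C$, bind $x\mapsto(k,\iota)$. $\mathrm{nocast}(x,u,k\,C)$: for $u$ of value $v$ that refers to an object anywhere, bind $x\mapsto v$. - $\mathrm{enter}(w,k,y.f,x_1=u_1,\dots,x_n=u_n)$: let $(k_i,\iota_i)$ be the values of the $u_i$, and $F'(y)=(k_y,\iota_y)$, where the object $\iota_y$ (stack, $H_{op}$) has $f\mapsto(k_f,\iota')$ with $\iota'$ in a closed region $(r',S')$. Move $(r',S')$ to $H_{op}$, and push the frame $(r',[\iota''\mapsto(\#\mathtt{Cell},[\mathtt{val}\mapsto(\mathtt{mut},\iota')])],F'')$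 with $\iota''$ unused, $F''=[x_i\mapsto(k_i',\iota_i)]_i,\,w\mapsto(k,\iota'')$, where $k_i'=\mathtt{iso}$ if $k_i=\mathtt{iso}$ and $k_i'=\mathtt{paused}\odot k_i$ otherwise. $\mathrm{badenter}(y.f)$: if $\iota'$, found in the same way, is in no closed region, nothing changes. - $\mathrm{exit}(x,u,y.f,w.g)$: from top frames $(r',S',F_1)::(r,S,F)$, let $u$ evaluate in $F_1$ to $v$, leaving $F_1'$; let $F_1'(w)$ refer to an object of $S'$ with $g\mapsto(k_g,\iota'')$. Pop the top frame, move region $r'$ from $H_{op}$ to $H_{cl}$, replace the content $(k_f,\iota_f)$ of field $f$ of the object to which $F(y)$ refers (in a remaining temporary store or in a region of $H_{op}$ other than $r'$) by $(k_f,\iota'')$, and bind $x\mapsto v$ in the frame of $r$. - $\mathrm{bind}(x_1=u_1,\dots,x_n=u_n)$ binds the $x_i$ to the values of the $u_i$; $\epsilon$ does nothing. *Well-formed effects.* $\overline\Gamma\vdash\mathit{Eff}\dashv\overline\Gamma'$ is generated by the following rules, which (but for exit, split and $\epsilon$) are for $\overline\Gamma=\Gamma::\overline\Gamma_0$ with $\Gamma'$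 the context after the uses; bound names are new and distinct as above, and $\mathrm{open}(k)$ means $k\in\{\mathtt{mut},\mathtt{tmp},\mathtt{var},\mathtt{paused}\}$. - load: $\Gamma(y)=k\,CL$, $\mathrm{ftype}(CL,f)=t$, $k\neq\mathtt{iso}$, $\vdash k\odot t$; result $\Gamma,x:k\odot t::\overline\Gamma_0$. - swap: $\Gamma\vdash u:t\dashv\Gamma'$, $\mathrm{cap}(\{\mathtt{var}\}^c,t)$, and either $\Gamma'(y)=k\,CL$ with $k\in\{\mathtt{mut},\mathtt{tmp}\}$, $\mathrm{ftype}(CL,f)=t$, result $\Gamma',x:t::\overline\Gamma_0$; or $f=\mathtt{val}$, $\Gamma'(y)=\mathtt{var}\,\mathtt{Cell}[t']$, result $\Gamma'[y:\mathtt{var}\,\mathtt{Cell}[t]],x:t'::\overline\Gamma_0$. - halloc: $\vdash k\,C$, result $\Gamma',x:k\,C::\overline\Gamma_0$, where for $k=\mathtt{mut}$ the uses have the field types of $C$, and for $k=\mathtt{iso}$ they have types $t_i'$ with $\mathrm{cap}(\{\mathtt{iso},\mathtt{imm}\},t_i')$ that are subtypes of the field types. salloc: $k\in\{\mathtt{tmp},\mathtt{var}\}$,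 $\#CL'<\#:CL$ for the given tag $\#CL'$, $\vdash k\,CL$, the uses have the field types of $CL$; result $\Gamma',x:k\,CL::\overline\Gamma_0$. - freeze, merge: $\Gamma\vdash u:t\dashv\Gamma'$, $\mathrm{cap}(\{\mathtt{iso}\},t)$; result $\Gamma',x:\mathrm{make\_imm}(t)::\overline\Gamma_0$, respectively $\Gamma',x:\mathrm{make\_mut}(t)::\overline\Gamma_0$. - cast to $k\,C$: $\Gamma\vdash u:t\dashv\Gamma'$, $k\,C<:t'$; result $\Gamma',x:t'::\overline\Gamma_0$. nocast: $\Gamma\vdash u:t\dashv\Gamma'$; result $\Gamma',x:t::\overline\Gamma_0$. bind: $\Gamma\vdash\overline u:\overline t\dashv\Gamma'$; result $\Gamma',x_1:t_1,\dots,x_n:t_n::\overline\Gamma_0$. - enter: $\Gamma\vdash\overline u:\overline t\dashv\Gamma'$, $\Gamma'(y)=k'\,CL$, $\mathrm{open}(k')$, $\mathrm{ftype}(CL,f)=t$, $\mathrm{cap}(\{\mathtt{iso}\},t)$, $k\in\{\mathtt{tmp},\mathtt{var}\}$, $k=\mathtt{var}\Rightarrow k'=\mathtt{var}$; $t_i'=t_i$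 if $\mathrm{cap}(\{\mathtt{iso}\},t_i)$ and $t_i'=\mathtt{paused}\odot t_i$ (which must be defined) otherwise; result $(x_1:t_1',\dots,x_n:t_n',w:k\,\mathtt{Cell}[\mathrm{make\_mut}(t)])\underset{y.f}{::}\Gamma'::\overline\Gamma_0$. badenter: $\Gamma(y)=k\,CL$, $\mathrm{open}(k)$, $\mathrm{cap}(\{\mathtt{iso}\},\mathrm{ftype}(CL,f))$; result $\overline\Gamma$. - exit: $\overline\Gamma=\Gamma_1\underset{y.f}{::}\Gamma::\overline\Gamma_0$, $\Gamma(y)=k\,CL$, $\mathrm{open}(k)$, $\mathrm{cap}(\{\mathtt{iso}\},\mathrm{ftype}(CL,f))$, $\Gamma_1\vdash u:t\dashv\Gamma_1'$, $\mathrm{cap}(\{\mathtt{iso},\mathtt{imm}\},t)$, $\Gamma_1'(w)=k'\,CL'$, $\mathrm{ftype}(CL',g)=t'$, $\mathrm{cap}(\{\mathtt{mut}\},t')$. If $k\,CL$ is $\mathtt{var}\,\mathtt{Cell}[\cdot]$, the result is $\Gamma[y:\mathtt{var}\,\mathtt{Cell}[\mathrm{make\_iso}(t')]],x:t::\overline\Gamma_0$;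 otherwise $\mathrm{make\_iso}(t')<:\mathrm{ftype}(CL,f)$ is required and the result is $\Gamma,x:t::\overline\Gamma_0$. - split: if some context of $\overline\Gamma$ has $x:t_1|t_2$ and $\overline\Gamma[x:t_i]\vdash\mathit{Eff}\dashv\overline\Gamma_i$ for $i=1,2$, then $\overline\Gamma\vdash\mathit{Eff}\dashv\overline\Gamma_1|\overline\Gamma_2$. And $\overline\Gamma\vdash\epsilon\dashv\overline\Gamma$. *Well-typed configurations.* For $\Delta$ a partial map from object identifiers to static types, $\Delta;\Gamma\vdash F$ means that $\Gamma$ and $F$ have the same domain, are $\mathbf{undef}$ at the same names, and that $F(x)=(k,\iota)$, $\Gamma(x)=t$ imply $k\,\Delta(\iota)<:t$. $\overline\Gamma;\Delta;\Psi\vdash\mathit{rcfg}$ means: $\overline\Gamma$ and $RS$ have the same length and corresponding $\Gamma$, $F$ satisfy $\Delta;\Gamma\vdash F$; the domain of $\Delta$ is the set of stored objects, each of which is stored at exactly one place; each stored object $\iota\mapsto(\#CL,F)$ satisfies $\#CL<\#:\Delta(\iota)$ and $\Delta;\mathrm{ftypes}(\Delta(\iota))\vdash F$; the frames have distinct region identifiers,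 which are exactly those of $H_{op}$; and $\Psi$ is the disjoint union of the sets of region identifiers of $H_{op},H_{cl},H_{fr}$. *Invariants.* The object graph of $\mathit{rcfg}$ has the vertices $\mathrm{Heap}(r,\iota)$ for objects in regions, $\mathrm{Temp}(r,\iota)$ for objects in temporary stores and $\mathrm{Root}(r)$ for frames, $r$ being the region of the vertex. For each binding $f\mapsto(k,\iota)$ of an object or frame it has an edge (reference) $\ell\xrightarrow{f,k}\ell'$ from the vertex of that object or frame to the vertex of $\iota$. $Cl$ and $Fr$ are the sets of closed and frozen region identifiers. Write $r<r'$ if both are open and the frame of $r'$ is above that of $r$, and $r\le r'$ if $r<r'$ or $r=r'$. $\mathsf{capability\_ok}(\overline\Gamma,\mathit{rcfg})$ says that, for all references $\ell\xrightarrow{f,k}\ell'$ with regions $r$ of $\ell$ and $r'$ of $\ell'$: 1. (var uniqueness) if $k=\mathtt{var}$, no other reference ends in $\ell'$; 2. (region order) $k\in\{\mathtt{mut},\mathtt{tmp},\mathtt{var}\}\Rightarrow r=r'$; $k=\mathtt{paused}\Rightarrow r'<r$; $k=\mathtt{iso}\Rightarrow r\ne r'$ and ($r'\in Cl$, or $r<r'$,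 or $r,r'\in Fr$); $k=\mathtt{imm}\Rightarrow r'\in Fr$; 3. (location constraints) $k\in\{\mathtt{mut},\mathtt{iso},\mathtt{imm}\}\Rightarrow\ell'$ is a Heap vertex; $k=\mathtt{tmp}\Rightarrow\ell$ is Root or Temp and $\ell'$ is Temp; $k=\mathtt{var}\Rightarrow\ell$ is Root and $\ell'$ is Temp; $k=\mathtt{paused}\Rightarrow\ell$ is Root or Temp and $\ell'$ is not Root; 4. (deep freeze) $r\in Fr\Rightarrow r'\in Fr$. $\mathsf{topology\_ok}(\overline\Gamma,\mathit{rcfg})$ says: 5. (pairwise topology) two distinct references, from regions $r_1,r_2$ into regions $r_1',r_2'$, satisfy $r_1'\neq r_2'$, or $r_1'\in Fr$, or $r_2'\in Fr$, or $r_1'\le r_1$, or $r_2'\le r_2$; 6. (entrypoints) whenever $\overline\Gamma$ has the mark $x.f$ between two adjacent contexts whose frames have regions $r'$ (newer) and $r$ (older), there are references $\mathrm{Root}(r)\xrightarrow{x,k}\ell$ and $\ell\xrightarrow{f,\mathtt{iso}}\mathrm{Heap}(r',\iota)$ for some $k,\ell,\iota$. **Theorem.** If $\overline\Gamma;\Delta;\Psi\vdash\mathit{rcfg}$,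 $\mathsf{capability\_ok}(\overline\Gamma,\mathit{rcfg})$, $\mathsf{topology\_ok}(\overline\Gamma,\mathit{rcfg})$, $\mathit{rcfg}\xrightarrow{\mathit{Eff}}\mathit{rcfg}'$ and $\overline\Gamma\vdash\mathit{Eff}\dashv\overline\Gamma'$, then there are $\Delta'$ and $\Psi'$ with $\overline\Gamma';\Delta';\Psi'\vdash\mathit{rcfg}'$, $\mathsf{capability\_ok}(\overline\Gamma',\mathit{rcfg}')$ and $\mathsf{topology\_ok}(\overline\Gamma',\mathit{rcfg}')$. -/

import Mathlib

namespace Reggio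

/-! Syntax -/

/-- Region identifiers. -/
abbrev Reg := ℕ

/-- Object identifiers. -/
abbrev Oid := ℕ

/-- Class names. -/
abbrev ClsId := ℕ

/-- Names of fields and variables (one syntactic category). `val` is the field of a cell. -/
inductive Name where
  | val : Name
  | ident : ℕ → Name
  deriving DecidableEq

/-- Reference capabilities; `mutable` is the capability written `mut`. -/
inductive Cap where
  | iso | var | mutable | tmp | paused | imm
  deriving DecidableEq

/-- Types `k C`, `k Cell[t]` and `t | t'`. -/
inductive Ty where
  | cls : Cap → ClsId → Ty
  | cell : Cap → Ty → Ty
  | union : Ty → Ty → Ty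

/-- Static types `C` and `Cell[t]`: types without a capability. -/
inductive STy where
  | cls : ClsId → STy
  | cell : Ty → STy

/-- The type `k CL`. -/
def STy.ty (k : Cap) : STy → Ty
  | .cls C => .cls k C
  | .cell t => .cell k t

/-- Dynamic type tags `#C` and `#Cell`. -/
inductive Tag where
  | cls : ClsId → Tag
  | cell : Tag
  deriving DecidableEq

/-- Subtagging `#CL <#: CL`. -/
inductive SubTag : Tag → STy → Prop
  | cls (C : ClsId) : SubTag (.cls C) (.cls C)
  | cell (t : Ty) : SubTag .cell (.cell t)

/-! Types -/

/-- `cap(K, t)`: all capabilities at the top level of `t` are in `K`. -/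
def Ty.capIn (K : Set Cap) : Ty → Prop
  | .cls k _ => k ∈ K
  | .cell k _ => k ∈ K
  | .union t₁ t₂ => t₁.capIn K ∧ t₂.capIn K

/-- Apply a function to all capabilities at the top level of a type. -/
def Ty.mapCap (h : Cap → Cap) : Ty → Ty
  | .cls k C => .cls (h k) C
  | .cell k t => .cell (h k) t
  | .union t₁ t₂ => .union (t₁.mapCap h) (t₂.mapCap h)

def Ty.makeIso : Ty → Ty := Ty.mapCap fun k => if k = .mutable then .iso else k

def Ty.makeMut : Ty → Ty := Ty.mapCap fun k => if k = .iso then .mutable else k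

def Ty.makeImm : Ty → Ty := Ty.mapCap fun k => if k = .iso then .imm else k

/-- Viewpoint adaptation `k ⊙ k'`; `none` means undefined. No field has capability `var`, so the
column `var` is only used when a variable is captured by a newly entered region. -/
def Cap.vpa : Cap → Cap → Option Cap
  | .mutable, .mutable => some .mutable
  | .mutable, .imm => some .imm
  | .tmp, .mutable => some .mutable
  | .tmp, .tmp => some .tmp
  | .tmp, .imm => some .imm
  | .tmp, .paused => some .paused
  | .var, .mutable => some .mutable
  | .var, .tmp => some .tmp
  | .var, .imm => some .imm
  | .var, .paused => some .paused
  | .imm, .mutable => some .imm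
  | .imm, .tmp => some .imm
  | .imm, .imm => some .imm
  | .imm, .iso => some .imm
  | .imm, .paused => some .imm
  | .paused, .mutable => some .paused
  | .paused, .tmp => some .paused
  | .paused, .imm => some .imm
  | .paused, .paused => some .paused
  | .paused, .var => some .paused
  | _, _ => none

/-- Viewpoint adaptation `k ⊙ t` of a type. -/
def Ty.vpa (k : Cap) : Ty → Option Ty
  | .cls k' C => (k.vpa k').map fun k'' => .cls k'' C
  | .cell k' t => (k.vpa k').map fun k'' => .cell k'' t
  | .union t₁ t₂ => (t₁.vpa k).bind fun t₁' => (t₂.vpa k).map fun t₂' => .union t₁' t₂'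

/-- Subtyping. Cells are invariant in their content type (up to equivalence). -/
inductive Sub : Ty → Ty → Prop
  | refl (t : Ty) : Sub t t
  | unionRight₁ {t t₁ : Ty} (t₂ : Ty) : Sub t t₁ → Sub t (.union t₁ t₂)
  | unionRight₂ {t t₂ : Ty} (t₁ : Ty) : Sub t t₂ → Sub t (.union t₁ t₂)
  | unionLeft {t₁ t₂ t : Ty} : Sub t₁ t → Sub t₂ t → Sub (.union t₁ t₂) t
  | cell (k : Cap) {t t' : Ty} : Sub t t' → Sub t' t → Sub (.cell k t) (.cell k t')

/-- A table of classes and their fields. Field names are distinct and no field has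
capability `var`. -/
structure ClassTable where
  fields : ClsId → List (Name × Ty)
  nodup : ∀ C, ((fields C).map Prod.fst).Nodup
  no_var : ∀ C, ∀ p ∈ fields C, p.2.capIn {Cap.var}ᶜ

/-- `ftypes(CL)`. -/
def ClassTable.ftypes (CT : ClassTable) : STy → List (Name × Ty)
  | .cls C => CT.fields C
  | .cell t => [(.val, t)]

/-- `ftype(CL, f)`. -/
def ClassTable.ftype (CT : ClassTable) (CL : STy) (f : Name) : Option Ty :=
  (CT.ftypes CL).lookup f

/-- The names of the fields of an object with the given tag. -/
def ClassTable.fieldNames (CT : ClassTable) : Tag → List Name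
  | .cls C => (CT.fields C).map Prod.fst
  | .cell => [.val]

/-- Admissible field types of objects referred to with capability `k`: objects that are
allocated on the heap have no `tmp`, `paused` or `var` fields. -/
def FieldOK (k : Cap) (t : Ty) : Prop :=
  k = .mutable ∨ k = .iso → t.capIn {.mutable, .iso, .imm}

/-- Well-formed types `⊢ t`. -/
def TyWF (CT : ClassTable) : Ty → Prop
  | .cls k C => ∀ p ∈ CT.fields C, FieldOK k p.2
  | .cell k t => TyWF CT t ∧ t.capIn {Cap.var}ᶜ ∧ FieldOK k t
  | .union t₁ t₂ => TyWF CT t₁ ∧ TyWF CT t₂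

/-! Typing contexts -/

/-- Typing contexts: `Γ x = none` if `x` is not in the domain, `some none` if `x : undef`, and
`some (some t)` if `x : t`. -/
abbrev Ctx := Name → Option (Option Ty)

def Ctx.empty : Ctx := fun _ => none

/-- The context `Γ, x : t`, respectively `Γ[x : t]`. -/
def Ctx.set (Γ : Ctx) (x : Name) (t : Ty) : Ctx := Function.update Γ x (some (some t))

/-- The context `Γ[x : undef]`. -/
def Ctx.undef (Γ : Ctx) (x : Name) : Ctx := Function.update Γ x (some none)

/-- The context `Γ, x₁ : t₁, …, xₙ : tₙ`. -/
def Ctx.setAll (Γ : Ctx) : List Name → List Ty → Ctx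
  | x :: xs, t :: ts => (Γ.set x t).setAll xs ts
  | _, _ => Γ

/-- `x : t` is in `Γ`. -/
def Ctx.Has (Γ : Ctx) (x : Name) (t : Ty) : Prop := Γ x = some (some t)

/-- Well-formed contexts `⊢ Γ`. -/
def CtxWF (CT : ClassTable) (Γ : Ctx) : Prop := ∀ x t, Γ.Has x t → TyWF CT t

/-- The context `f₁ : t₁, …, fₙ : tₙ` of the fields of `CL`. -/
def ClassTable.ctxOf (CT : ClassTable) (CL : STy) : Ctx := fun f => (CT.ftype CL f).map some

/-- `Γ₁ | Γ₂` is defined: both contexts have the same domain. -/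
def Ctx.SameDom (Γ₁ Γ₂ : Ctx) : Prop := ∀ x, (Γ₁ x).isSome ↔ (Γ₂ x).isSome

/-- `Γ₁ | Γ₂`. -/
def Ctx.join (Γ₁ Γ₂ : Ctx) : Ctx := fun x =>
  match Γ₁ x, Γ₂ x with
  | some (some t₁), some (some t₂) => some (some (.union t₁ t₂))
  | some _, some _ => some none
  | _, _ => none

/-- A context in a stack of contexts together with the mark `var.field` on the separator
between it and the next (older) context: the path through which its region was entered.
The mark of the oldest context has no meaning and is never used. -/
structure Layer where
  ctx : Ctx
  var : Name
  field : Name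

/-- Stacks of contexts, the context of the most recently entered region first. -/
abbrev DynCtx := List Layer

/-- `DynCtx.Join Γs₁ Γs₂ Γs` means `Γs = Γs₁ | Γs₂`. -/
inductive DynCtx.Join : DynCtx → DynCtx → DynCtx → Prop
  | nil : DynCtx.Join [] [] []
  | cons {Γ₁ Γ₂ : Ctx} (y f : Name) {Γs₁ Γs₂ Γs : DynCtx} :
      Γ₁.SameDom Γ₂ → DynCtx.Join Γs₁ Γs₂ Γs →
      DynCtx.Join (⟨Γ₁, y, f⟩ :: Γs₁) (⟨Γ₂, y, f⟩ :: Γs₂) (⟨Γ₁.join Γ₂, y, f⟩ :: Γs)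

/-! Configurations -/

/-- Values: references tagged with a capability. -/
structure Val where
  cap : Cap
  oid : Oid

/-- Variable and field bindings: `F x = none` if `x` is not in the domain, `some none` if
`x ↦ undef`, and `some (some v)` if `x ↦ v`. -/
abbrev Vars := Name → Option (Option Val)

def Vars.empty : Vars := fun _ => none

/-- The bindings `F, x ↦ v`, respectively `F[x ↦ v]`. -/
def Vars.set (F : Vars) (x : Name) (v : Val) : Vars := Function.update F x (some (some v))

/-- The bindings `F, x₁ ↦ v₁, …, xₙ ↦ vₙ`. -/
def Vars.setAll (F : Vars) : List Name → List Val → Vars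
  | x :: xs, v :: vs => (F.set x v).setAll xs vs
  | _, _ => F

/-- `F x = v`. -/
def Vars.Has (F : Vars) (x : Name) (v : Val) : Prop := F x = some (some v)

/-- Objects. -/
structure Obj where
  tag : Tag
  fields : Vars

/-- The object `o[f ↦ v]`. -/
def Obj.set (o : Obj) (f : Name) (v : Val) : Obj := ⟨o.tag, o.fields.set f v⟩

/-- Stores. -/
abbrev Store := Oid → Option Obj

def Store.empty : Store := fun _ => none

def Store.set (S : Store) (ι : Oid) (o : Obj) : Store := Function.update S ι (some o)

/-- Heaps: collections of regions, each with a region identifier and a store. -/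
abbrev Heap := Reg → Option Store

def Heap.set (H : Heap) (r : Reg) (S : Store) : Heap := Function.update H r (some S)

/-- The heap without the region `r`. -/
def Heap.remove (H : Heap) (r : Reg) : Heap := Function.update H r none

/-- The region identifiers of a heap. -/
def Heap.dom (H : Heap) : Set Reg := {r | (H r).isSome}

/-- `heap_load(H, ι) = o`. -/
def Heap.Load (H : Heap) (ι : Oid) (o : Obj) : Prop := ∃ r S, H r = some S ∧ S ι = some o

/-- Region frames: a region identifier, a temporary store and variable bindings. -/
structure Frame where
  rid : Reg
  tmp : Store
  vars : Vars

/-- Region configurations: a stack of frames (top frame first) and the heaps of the open,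
closed and frozen regions. -/
structure RCfg where
  stack : List Frame
  hop : Heap
  hcl : Heap
  hfr : Heap

/-- `stack_load(RS, ι)`. -/
def stackLoad (RS : List Frame) (ι : Oid) : Option Obj := RS.findSome? fun fr => fr.tmp ι

/-- `stack_store(RS, ι, o)`: replace the object `ι` in the topmost frame that has it. -/
def stackStore (ι : Oid) (o : Obj) : List Frame → List Frame
  | [] => []
  | fr :: RS =>
    match fr.tmp ι with
    | some _ => ⟨fr.rid, fr.tmp.set ι o, fr.vars⟩ :: RS
    | none => fr :: stackStore ι o RS

/-- `cfg_load(RS, H, ι) = o`, where `H` is the product of the heaps in `Hs`. -/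
def CfgLoad (RS : List Frame) (Hs : List Heap) (ι : Oid) (o : Obj) : Prop :=
  stackLoad RS ι = some o ∨ (stackLoad RS ι = none ∧ ∃ H ∈ Hs, H.Load ι o)

/-- `ι` is the identifier of an object stored in the configuration. -/
def RCfg.Stored (c : RCfg) (ι : Oid) : Prop :=
  (∃ fr ∈ c.stack, (fr.tmp ι).isSome) ∨
    ∃ H ∈ [c.hop, c.hcl, c.hfr], ∃ o, H.Load ι o

/-- `r` is the identifier of a region of the configuration. -/
def RCfg.HasRegion (c : RCfg) (r : Reg) : Prop :=
  (∃ fr ∈ c.stack, fr.rid = r) ∨ r ∈ c.hop.dom ∨ r ∈ c.hcl.dom ∨ r ∈ c.hfr.dom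

/-! Effects -/

/-- Uses of variables: `x` and `drop x`. -/
inductive Use where
  | keep : Name → Use
  | drop : Name → Use

/-- `get(F, use)`. -/
def Use.get : Use → Vars → Option (Val × Vars)
  | .keep x, F =>
    match F x with
    | some (some v) => if v.cap = .var ∨ v.cap = .iso then none else some (v, F)
    | _ => none
  | .drop x, F =>
    match F x with
    | some (some v) => some (v, Function.update F x (some none))
    | _ => none

/-- Evaluate several uses from left to right. -/
def getAll : List Use → Vars → Option (List Val × Vars)
  | [], F => some ([], F)
  | u :: us, F => (u.get F).bind fun p => (getAll us p.2).map fun q => (p.1 :: q.1, q.2)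

/-- Effects. -/
inductive Eff where
  /-- `load x, y.f` -/
  | load (x y f : Name)
  /-- `swap x, y.f, use` -/
  | swap (x y f : Name) (u : Use)
  /-- `bind x₁ = use₁, …, xₙ = useₙ` -/
  | bind (bs : List (Name × Use))
  /-- `halloc x, k, #C, uses` -/
  | halloc (x : Name) (k : Cap) (C : ClsId) (us : List Use)
  /-- `salloc x, k, #CL, uses` -/
  | salloc (x : Name) (k : Cap) (tag : Tag) (us : List Use)
  /-- `enter w, k, y.f, x₁ = use₁, …, xₙ = useₙ` -/
  | enter (w : Name) (k : Cap) (y f : Name) (bs : List (Name × Use))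
  /-- `badenter y.f` -/
  | badenter (y f : Name)
  /-- `exit x, use, y.f, w.g` -/
  | exit (x : Name) (u : Use) (y f w g : Name)
  /-- `freeze x, use` -/
  | freeze (x : Name) (u : Use)
  /-- `merge x, use` -/
  | merge (x : Name) (u : Use)
  /-- `cast x, use, k C` -/
  | cast (x : Name) (u : Use) (k : Cap) (C : ClsId)
  /-- `nocast x, use, k C` -/
  | nocast (x : Name) (u : Use) (k : Cap) (C : ClsId)
  | eps

/-! Region semantics -/

/-- `reachable_step`, for regions of the heaps in `Hs`: an object of region `r` has a reference
to an object of region `r'`. -/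
def ReachStep (Hs : List Heap) (r r' : Reg) : Prop :=
  ∃ H ∈ Hs, ∃ H' ∈ Hs, ∃ S S' : Store, H r = some S ∧ H' r' = some S' ∧
    ∃ ι o f v, S ι = some o ∧ o.fields.Has f v ∧ (S' v.oid).isSome

/-- The region `r` and all regions reachable from it. -/
def reachable (Hs : List Heap) (r : Reg) : Set Reg :=
  {r} ∪ {r' | Relation.TransGen (ReachStep Hs) r r'}

open Classical in
/-- The regions of `H` that are not in `M`. -/
noncomputable def Heap.without (H : Heap) (M : Set Reg) : Heap :=
  fun r => if r ∈ M then none else H r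

open Classical in
/-- The regions of `H'`, together with the regions of `H` that are in `M`. -/
noncomputable def Heap.withFrom (H' H : Heap) (M : Set Reg) : Heap :=
  fun r => if r ∈ M then H r else H' r

/-- Union of (disjoint) stores. -/
def Store.append (S S' : Store) : Store := fun ι => (S ι).or (S' ι)

/-- The value that a newly entered region captures for the value `v`. -/
def captureVal (v : Val) : Option Val :=
  if v.cap = .iso then some v else (Cap.paused.vpa v.cap).map fun k => ⟨k, v.oid⟩

/-- The step relation `rcfg –Eff→ rcfg'` of region configurations. -/
inductive RStep (CT : ClassTable) : RCfg → Eff → RCfg → Prop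
  | load {r S F RS hop hcl hfr} {x y f : Name} {ky kf k : Cap} {ιy ιf : Oid} {o : Obj} :
      F x = none → F.Has y ⟨ky, ιy⟩ → CfgLoad (⟨r, S, F⟩ :: RS) [hop, hfr] ιy o →
      o.fields.Has f ⟨kf, ιf⟩ → ky.vpa kf = some k →
      RStep CT ⟨⟨r, S, F⟩ :: RS, hop, hcl, hfr⟩ (.load x y f)
        ⟨⟨r, S, F.set x ⟨k, ιf⟩⟩ :: RS, hop, hcl, hfr⟩
  | swapTemp {r S F RS hop hcl hfr} {x y f : Name} {u : Use} {v v' : Val} {F' : Vars}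
      {ky : Cap} {ιy : Oid} {o : Obj} :
      F x = none → u.get F = some (v, F') → F'.Has y ⟨ky, ιy⟩ → S ιy = some o →
      o.fields.Has f v' →
      RStep CT ⟨⟨r, S, F⟩ :: RS, hop, hcl, hfr⟩ (.swap x y f u)
        ⟨⟨r, S.set ιy (o.set f v), F'.set x v'⟩ :: RS, hop, hcl, hfr⟩
  | swapHeap {r S F RS hop hcl hfr} {x y f : Name} {u : Use} {v v' : Val} {F' : Vars}
      {ky : Cap} {ιy : Oid} {o : Obj} {r₁ : Reg} {S₁ : Store} :
      F x = none → u.get F = some (v, F') → F'.Has y ⟨ky, ιy⟩ →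
      hop r₁ = some S₁ → S₁ ιy = some o → o.fields.Has f v' →
      RStep CT ⟨⟨r, S, F⟩ :: RS, hop, hcl, hfr⟩ (.swap x y f u)
        ⟨⟨r, S, F'.set x v'⟩ :: RS, hop.set r₁ (S₁.set ιy (o.set f v)), hcl, hfr⟩
  | allocMut {r S F RS hop hcl hfr} {x : Name} {C : ClsId} {us : List Use} {vs : List Val}
      {F' : Vars} {ι : Oid} {S₁ : Store} :
      F x = none → getAll us F = some (vs, F') → vs.length = (CT.fieldNames (.cls C)).length →
      ¬ RCfg.Stored ⟨⟨r, S, F⟩ :: RS, hop, hcl, hfr⟩ ι → hop r = some S₁ →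
      RStep CT ⟨⟨r, S, F⟩ :: RS, hop, hcl, hfr⟩ (.halloc x .mutable C us)
        ⟨⟨r, S, F'.set x ⟨.mutable, ι⟩⟩ :: RS,
          hop.set r (S₁.set ι ⟨.cls C, Vars.empty.setAll (CT.fieldNames (.cls C)) vs⟩), hcl, hfr⟩
  | allocIso {r S F RS hop hcl hfr} {x : Name} {C : ClsId} {us : List Use} {vs : List Val}
      {F' : Vars} {ι : Oid} {r' : Reg} :
      F x = none → getAll us F = some (vs, F') → vs.length = (CT.fieldNames (.cls C)).length →
      ¬ RCfg.Stored ⟨⟨r, S, F⟩ :: RS, hop, hcl, hfr⟩ ι →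
      ¬ RCfg.HasRegion ⟨⟨r, S, F⟩ :: RS, hop, hcl, hfr⟩ r' →
      RStep CT ⟨⟨r, S, F⟩ :: RS, hop, hcl, hfr⟩ (.halloc x .iso C us)
        ⟨⟨r, S, F'.set x ⟨.iso, ι⟩⟩ :: RS, hop,
          hcl.set r' (Store.empty.set ι
            ⟨.cls C, Vars.empty.setAll (CT.fieldNames (.cls C)) vs⟩), hfr⟩
  | allocTemp {r S F RS hop hcl hfr} {x : Name} {k : Cap} {tag : Tag} {us : List Use}
      {vs : List Val} {F' : Vars} {ι : Oid} :
      k = .tmp ∨ k = .var →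
      F x = none → getAll us F = some (vs, F') → vs.length = (CT.fieldNames tag).length →
      ¬ RCfg.Stored ⟨⟨r, S, F⟩ :: RS, hop, hcl, hfr⟩ ι →
      RStep CT ⟨⟨r, S, F⟩ :: RS, hop, hcl, hfr⟩ (.salloc x k tag us)
        ⟨⟨r, S.set ι ⟨tag, Vars.empty.setAll (CT.fieldNames tag) vs⟩, F'.set x ⟨k, ι⟩⟩ :: RS,
          hop, hcl, hfr⟩
  | freeze {r S F RS hop hcl hfr} {x : Name} {u : Use} {k : Cap} {ι : Oid} {F' : Vars}
      {r₁ : Reg} {S₁ : Store} :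
      F x = none → u.get F = some (⟨k, ι⟩, F') → hcl r₁ = some S₁ → (S₁ ι).isSome →
      reachable [hop, hcl] r₁ ⊆ hcl.dom →
      RStep CT ⟨⟨r, S, F⟩ :: RS, hop, hcl, hfr⟩ (.freeze x u)
        ⟨⟨r, S, F'.set x ⟨.imm, ι⟩⟩ :: RS, hop,
          hcl.without (reachable [hop, hcl] r₁), hfr.withFrom hcl (reachable [hop, hcl] r₁)⟩
  | merge {r S F RS hop hcl hfr} {x : Name} {u : Use} {k : Cap} {ι : Oid} {F' : Vars}
      {r₁ : Reg} {S₁ S₂ : Store} :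
      F x = none → u.get F = some (⟨k, ι⟩, F') → hcl r₁ = some S₁ → (S₁ ι).isSome →
      hop r = some S₂ → (∀ ι', S₁ ι' = none ∨ S₂ ι' = none) →
      RStep CT ⟨⟨r, S, F⟩ :: RS, hop, hcl, hfr⟩ (.merge x u)
        ⟨⟨r, S, F'.set x ⟨.mutable, ι⟩⟩ :: RS, hop.set r (S₂.append S₁), hcl.remove r₁, hfr⟩
  | cast {r S F RS hop hcl hfr} {x : Name} {u : Use} {k : Cap} {C : ClsId} {ι : Oid}
      {F' : Vars} {o : Obj} :
      F x = none → u.get F = some (⟨k, ι⟩, F') →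
      CfgLoad (⟨r, S, F⟩ :: RS) [hop, hcl, hfr] ι o → o.tag = .cls C →
      RStep CT ⟨⟨r, S, F⟩ :: RS, hop, hcl, hfr⟩ (.cast x u k C)
        ⟨⟨r, S, F'.set x ⟨k, ι⟩⟩ :: RS, hop, hcl, hfr⟩
  /-- Which of `cast` and `nocast` happens is chosen by the command semantics. -/
  | nocast {r S F RS hop hcl hfr} {x : Name} {u : Use} {k k' : Cap} {C : ClsId} {ι : Oid}
      {F' : Vars} {o : Obj} :
      F x = none → u.get F = some (⟨k', ι⟩, F') →
      CfgLoad (⟨r, S, F⟩ :: RS) [hop, hcl, hfr] ι o →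
      RStep CT ⟨⟨r, S, F⟩ :: RS, hop, hcl, hfr⟩ (.nocast x u k C)
        ⟨⟨r, S, F'.set x ⟨k', ι⟩⟩ :: RS, hop, hcl, hfr⟩
  | enterOk {r S F RS hop hcl hfr} {w : Name} {k : Cap} {y f : Name} {bs : List (Name × Use)}
      {vs vs' : List Val} {F' : Vars} {ky kf : Cap} {ιy ι' ι'' : Oid} {o : Obj}
      {r' : Reg} {S' : Store} :
      (w :: bs.map Prod.fst).Nodup →
      getAll (bs.map Prod.snd) F = some (vs, F') →
      vs.map captureVal = vs'.map some →
      F'.Has y ⟨ky, ιy⟩ → CfgLoad (⟨r, S, F'⟩ :: RS) [hop] ιy o → o.fields.Has f ⟨kf, ι'⟩ →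
      hcl r' = some S' → (S' ι').isSome →
      ¬ RCfg.Stored ⟨⟨r, S, F⟩ :: RS, hop, hcl, hfr⟩ ι'' →
      RStep CT ⟨⟨r, S, F⟩ :: RS, hop, hcl, hfr⟩ (.enter w k y f bs)
        ⟨⟨r', Store.empty.set ι'' ⟨.cell, Vars.empty.set .val ⟨.mutable, ι'⟩⟩,
            (Vars.empty.setAll (bs.map Prod.fst) vs').set w ⟨k, ι''⟩⟩ :: ⟨r, S, F'⟩ :: RS,
          hop.set r' S', hcl.remove r', hfr⟩
  | enterFail {r S F RS hop hcl hfr} {y f : Name} {ky kf : Cap} {ιy ι' : Oid} {o : Obj} :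
      F.Has y ⟨ky, ιy⟩ → CfgLoad (⟨r, S, F⟩ :: RS) [hop] ιy o → o.fields.Has f ⟨kf, ι'⟩ →
      (∀ r' S', hcl r' = some S' → S' ι' = none) →
      RStep CT ⟨⟨r, S, F⟩ :: RS, hop, hcl, hfr⟩ (.badenter y f)
        ⟨⟨r, S, F⟩ :: RS, hop, hcl, hfr⟩
  | exitTemp {r' S' F' r S F RS hop hcl hfr} {x : Name} {u : Use} {y f w g : Name}
      {vz : Val} {F'' : Vars} {kw kg ky kf : Cap} {ι' ι'' ι ιf : Oid} {o' o : Obj} {Sop : Store} :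
      hop r' = some Sop → F x = none → u.get F' = some (vz, F'') →
      F''.Has w ⟨kw, ι'⟩ → S' ι' = some o' → o'.fields.Has g ⟨kg, ι''⟩ →
      F.Has y ⟨ky, ι⟩ → stackLoad (⟨r, S, F⟩ :: RS) ι = some o → o.fields.Has f ⟨kf, ιf⟩ →
      RStep CT ⟨⟨r', S', F'⟩ :: ⟨r, S, F⟩ :: RS, hop, hcl, hfr⟩ (.exit x u y f w g)
        ⟨stackStore ι (o.set f ⟨kf, ι''⟩) (⟨r, S, F.set x vz⟩ :: RS),
          hop.remove r', hcl.set r' Sop, hfr⟩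
  | exitHeap {r' S' F' r S F RS hop hcl hfr} {x : Name} {u : Use} {y f w g : Name}
      {vz : Val} {F'' : Vars} {kw kg ky kf : Cap} {ι' ι'' ι ιf : Oid} {o' o : Obj} {Sop : Store}
      {r₁ : Reg} {S₁ : Store} :
      hop r' = some Sop → F x = none → u.get F' = some (vz, F'') →
      F''.Has w ⟨kw, ι'⟩ → S' ι' = some o' → o'.fields.Has g ⟨kg, ι''⟩ →
      F.Has y ⟨ky, ι⟩ → (hop.remove r') r₁ = some S₁ → S₁ ι = some o →
      o.fields.Has f ⟨kf, ιf⟩ →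
      RStep CT ⟨⟨r', S', F'⟩ :: ⟨r, S, F⟩ :: RS, hop, hcl, hfr⟩ (.exit x u y f w g)
        ⟨⟨r, S, F.set x vz⟩ :: RS,
          (hop.remove r').set r₁ (S₁.set ι (o.set f ⟨kf, ι''⟩)), hcl.set r' Sop, hfr⟩
  | bind {r S F RS hop hcl hfr} {bs : List (Name × Use)} {vs : List Val} {F' : Vars} :
      (bs.map Prod.fst).Nodup → (∀ x ∈ bs.map Prod.fst, F x = none) →
      getAll (bs.map Prod.snd) F = some (vs, F') →
      RStep CT ⟨⟨r, S, F⟩ :: RS, hop, hcl, hfr⟩ (.bind bs)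
        ⟨⟨r, S, F'.setAll (bs.map Prod.fst) vs⟩ :: RS, hop, hcl, hfr⟩
  | eps (c : RCfg) : RStep CT c .eps c

/-! Well-formed effects -/

/-- `UseTy CT Γ u t Γ'` is `Γ ⊢ use : t ⊣ Γ'`. -/
inductive UseTy (CT : ClassTable) : Ctx → Use → Ty → Ctx → Prop
  | keep {Γ : Ctx} {x : Name} {t : Ty} :
      CtxWF CT Γ → Γ.Has x t → t.capIn {Cap.iso, Cap.var}ᶜ → UseTy CT Γ (.keep x) t Γ
  | drop {Γ : Ctx} {x : Name} {t : Ty} :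
      CtxWF CT Γ → Γ.Has x t → UseTy CT Γ (.drop x) t (Γ.undef x)
  | sub {Γ Γ' : Ctx} {u : Use} {t t' : Ty} :
      UseTy CT Γ u t Γ' → Sub t t' → UseTy CT Γ u t' Γ'
  | split {Γ Γ₁ Γ₂ : Ctx} {u : Use} {x : Name} {t₁ t₂ t₁' t₂' : Ty} :
      Γ.Has x (.union t₁ t₂) →
      UseTy CT (Γ.set x t₁) u t₁' Γ₁ → UseTy CT (Γ.set x t₂) u t₂' Γ₂ → Γ₁.SameDom Γ₂ →
      UseTy CT Γ u (.union t₁' t₂') (Γ₁.join Γ₂)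

/-- Typing of several uses from left to right. -/
inductive UsesTy (CT : ClassTable) : Ctx → List Use → List Ty → Ctx → Prop
  | nil (Γ : Ctx) : UsesTy CT Γ [] [] Γ
  | cons {Γ Γ' Γ'' : Ctx} {u : Use} {us : List Use} {t : Ty} {ts : List Ty} :
      UseTy CT Γ u t Γ' → UsesTy CT Γ' us ts Γ'' → UsesTy CT Γ (u :: us) (t :: ts) Γ''

/-- `open(k)`: the capability points into an open region. -/
def Cap.isOpen (k : Cap) : Prop := k = .mutable ∨ k = .tmp ∨ k = .var ∨ k = .paused

/-- A variable of type `t` is captured by a newly entered region at type `t'`. -/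
def CapturedTy (t t' : Ty) : Prop :=
  (t.capIn {Cap.iso} ∧ t' = t) ∨ (¬ t.capIn {Cap.iso} ∧ t.vpa .paused = some t')

/-- Well-formed effects, `Γs ⊢ Eff ⊣ Γs'`. -/
inductive EffTy (CT : ClassTable) : DynCtx → Eff → DynCtx → Prop
  | load {Γ : Ctx} {a b : Name} {Γs : DynCtx} {x y f : Name} {k : Cap} {CL : STy} {t t' : Ty} :
      Γ x = none → Γ.Has y (CL.ty k) → CT.ftype CL f = some t → k ≠ .iso →
      t.vpa k = some t' → TyWF CT t' →
      EffTy CT (⟨Γ, a, b⟩ :: Γs) (.load x y f) (⟨Γ.set x t', a, b⟩ :: Γs)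
  | swapClass {Γ Γ' : Ctx} {a b : Name} {Γs : DynCtx} {x y f : Name} {u : Use} {k : Cap}
      {CL : STy} {t : Ty} :
      Γ x = none → UseTy CT Γ u t Γ' → t.capIn {Cap.var}ᶜ → Γ'.Has y (CL.ty k) →
      k = .mutable ∨ k = .tmp → CT.ftype CL f = some t →
      EffTy CT (⟨Γ, a, b⟩ :: Γs) (.swap x y f u) (⟨Γ'.set x t, a, b⟩ :: Γs)
  | swapVar {Γ Γ' : Ctx} {a b : Name} {Γs : DynCtx} {x y : Name} {u : Use} {t t' : Ty} :
      Γ x = none → UseTy CT Γ u t Γ' → t.capIn {Cap.var}ᶜ → Γ'.Has y (.cell .var t') →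
      EffTy CT (⟨Γ, a, b⟩ :: Γs) (.swap x y .val u)
        (⟨(Γ'.set y (.cell .var t)).set x t', a, b⟩ :: Γs)
  | hallocMut {Γ Γ' : Ctx} {a b : Name} {Γs : DynCtx} {x : Name} {C : ClsId} {us : List Use} :
      Γ x = none → TyWF CT (.cls .mutable C) →
      UsesTy CT Γ us ((CT.fields C).map Prod.snd) Γ' →
      EffTy CT (⟨Γ, a, b⟩ :: Γs) (.halloc x .mutable C us)
        (⟨Γ'.set x (.cls .mutable C), a, b⟩ :: Γs)
  | hallocIso {Γ Γ' : Ctx} {a b : Name} {Γs : DynCtx} {x : Name} {C : ClsId} {us : List Use}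
      {ts : List Ty} :
      Γ x = none → TyWF CT (.cls .iso C) → UsesTy CT Γ us ts Γ' →
      List.Forall₂ (fun t t' => t.capIn {Cap.iso, Cap.imm} ∧ Sub t t') ts
        ((CT.fields C).map Prod.snd) →
      EffTy CT (⟨Γ, a, b⟩ :: Γs) (.halloc x .iso C us)
        (⟨Γ'.set x (.cls .iso C), a, b⟩ :: Γs)
  | salloc {Γ Γ' : Ctx} {a b : Name} {Γs : DynCtx} {x : Name} {k : Cap} {tag : Tag} {CL : STy}
      {us : List Use} :
      Γ x = none → k = .tmp ∨ k = .var → SubTag tag CL → TyWF CT (CL.ty k) →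
      UsesTy CT Γ us ((CT.ftypes CL).map Prod.snd) Γ' →
      EffTy CT (⟨Γ, a, b⟩ :: Γs) (.salloc x k tag us) (⟨Γ'.set x (CL.ty k), a, b⟩ :: Γs)
  | freeze {Γ Γ' : Ctx} {a b : Name} {Γs : DynCtx} {x : Name} {u : Use} {t : Ty} :
      Γ x = none → UseTy CT Γ u t Γ' → t.capIn {Cap.iso} →
      EffTy CT (⟨Γ, a, b⟩ :: Γs) (.freeze x u) (⟨Γ'.set x t.makeImm, a, b⟩ :: Γs)
  | merge {Γ Γ' : Ctx} {a b : Name} {Γs : DynCtx} {x : Name} {u : Use} {t : Ty} :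
      Γ x = none → UseTy CT Γ u t Γ' → t.capIn {Cap.iso} →
      EffTy CT (⟨Γ, a, b⟩ :: Γs) (.merge x u) (⟨Γ'.set x t.makeMut, a, b⟩ :: Γs)
  | cast {Γ Γ' : Ctx} {a b : Name} {Γs : DynCtx} {x : Name} {u : Use} {k : Cap} {C : ClsId}
      {t t' : Ty} :
      Γ x = none → UseTy CT Γ u t Γ' → Sub (.cls k C) t' →
      EffTy CT (⟨Γ, a, b⟩ :: Γs) (.cast x u k C) (⟨Γ'.set x t', a, b⟩ :: Γs)
  | nocast {Γ Γ' : Ctx} {a b : Name} {Γs : DynCtx} {x : Name} {u : Use} {k : Cap} {C : ClsId}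
      {t : Ty} :
      Γ x = none → UseTy CT Γ u t Γ' →
      EffTy CT (⟨Γ, a, b⟩ :: Γs) (.nocast x u k C) (⟨Γ'.set x t, a, b⟩ :: Γs)
  | bind {Γ Γ' : Ctx} {a b : Name} {Γs : DynCtx} {bs : List (Name × Use)} {ts : List Ty} :
      (bs.map Prod.fst).Nodup → (∀ x ∈ bs.map Prod.fst, Γ x = none) →
      UsesTy CT Γ (bs.map Prod.snd) ts Γ' →
      EffTy CT (⟨Γ, a, b⟩ :: Γs) (.bind bs) (⟨Γ'.setAll (bs.map Prod.fst) ts, a, b⟩ :: Γs)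
  | enter {Γ Γ' : Ctx} {a b : Name} {Γs : DynCtx} {w : Name} {k : Cap} {y f : Name}
      {bs : List (Name × Use)} {ts ts' : List Ty} {k' : Cap} {CL : STy} {t : Ty} :
      (w :: bs.map Prod.fst).Nodup →
      UsesTy CT Γ (bs.map Prod.snd) ts Γ' → Γ'.Has y (CL.ty k') → k'.isOpen →
      CT.ftype CL f = some t → t.capIn {Cap.iso} → k = .tmp ∨ k = .var →
      (k = .var → k' = .var) → List.Forall₂ CapturedTy ts ts' →
      EffTy CT (⟨Γ, a, b⟩ :: Γs) (.enter w k y f bs)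
        (⟨(Ctx.empty.setAll (bs.map Prod.fst) ts').set w (.cell k t.makeMut), y, f⟩ ::
          ⟨Γ', a, b⟩ :: Γs)
  | badenter {Γ : Ctx} {a b : Name} {Γs : DynCtx} {y f : Name} {k : Cap} {CL : STy} {t : Ty} :
      Γ.Has y (CL.ty k) → k.isOpen → CT.ftype CL f = some t → t.capIn {Cap.iso} →
      EffTy CT (⟨Γ, a, b⟩ :: Γs) (.badenter y f) (⟨Γ, a, b⟩ :: Γs)
  /-- Exit through a variable cell, whose content type may change. -/
  | exitVar {Γ Γ' Γ'' : Ctx} {a b : Name} {Γs : DynCtx} {x : Name} {u : Use} {y f w g : Name}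
      {t₀ t t' tf : Ty} {k' : Cap} {CL' : STy} :
      Γ x = none → Γ.Has y (.cell .var t₀) → CT.ftype (.cell t₀) f = some tf →
      tf.capIn {Cap.iso} →
      UseTy CT Γ' u t Γ'' → t.capIn {Cap.iso, Cap.imm} →
      Γ''.Has w (CL'.ty k') →
      CT.ftype CL' g = some t' → t'.capIn {Cap.mutable} →
      EffTy CT (⟨Γ', y, f⟩ :: ⟨Γ, a, b⟩ :: Γs) (.exit x u y f w g)
        (⟨(Γ.set y (.cell .var t'.makeIso)).set x t, a, b⟩ :: Γs)
  /-- Exit through any other field, whose type is fixed. -/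
  | exitField {Γ Γ' Γ'' : Ctx} {a b : Name} {Γs : DynCtx} {x : Name} {u : Use} {y f w g : Name}
      {k : Cap} {CL : STy} {t t' tf : Ty} {k' : Cap} {CL' : STy} :
      Γ x = none → Γ.Has y (CL.ty k) → k.isOpen → ¬ (k = .var ∧ ∃ t₀, CL = .cell t₀) →
      CT.ftype CL f = some tf → tf.capIn {Cap.iso} →
      UseTy CT Γ' u t Γ'' → t.capIn {Cap.iso, Cap.imm} →
      Γ''.Has w (CL'.ty k') →
      CT.ftype CL' g = some t' → t'.capIn {Cap.mutable} → Sub t'.makeIso tf →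
      EffTy CT (⟨Γ', y, f⟩ :: ⟨Γ, a, b⟩ :: Γs) (.exit x u y f w g) (⟨Γ.set x t, a, b⟩ :: Γs)
  /-- Case distinction on a union type of some variable in some context of the stack. -/
  | split {pre post : DynCtx} {Γ : Ctx} {a b x : Name} {t₁ t₂ : Ty} {e : Eff}
      {Γs₁ Γs₂ Γs' : DynCtx} :
      Γ.Has x (.union t₁ t₂) →
      EffTy CT (pre ++ ⟨Γ.set x t₁, a, b⟩ :: post) e Γs₁ →
      EffTy CT (pre ++ ⟨Γ.set x t₂, a, b⟩ :: post) e Γs₂ →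
      DynCtx.Join Γs₁ Γs₂ Γs' →
      EffTy CT (pre ++ ⟨Γ, a, b⟩ :: post) e Γs'
  | eps (Γs : DynCtx) : EffTy CT Γs .eps Γs

/-! Well-typed configurations -/

/-- Types of objects. -/
abbrev OidCtx := Oid → Option STy

/-- `Δ; Γ ⊢ F`. -/
def VarsTy (Δ : OidCtx) (Γ : Ctx) (F : Vars) : Prop :=
  ∀ x, match Γ x, F x with
    | none, none => True
    | some none, some none => True
    | some (some t), some (some v) => ∃ CL, Δ v.oid = some CL ∧ Sub (CL.ty v.cap) t
    | _, _ => False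

/-- Well-typed object `ι ↦ o`. -/
def ObjTy (CT : ClassTable) (Δ : OidCtx) (ι : Oid) (o : Obj) : Prop :=
  ∃ CL, Δ ι = some CL ∧ SubTag o.tag CL ∧ VarsTy Δ (CT.ctxOf CL) o.fields

/-- Vertices of the object graph. -/
inductive Loc where
  | heap : Reg → Oid → Loc
  | temp : Reg → Oid → Loc
  | root : Reg → Loc

def Loc.rid : Loc → Reg
  | .heap r _ => r
  | .temp r _ => r
  | .root r => r

def Loc.oid : Loc → Option Oid
  | .heap _ ι => some ι
  | .temp _ ι => some ι
  | .root _ => none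

/-- The object `o` is stored at the location. -/
def RCfg.ObjAt (c : RCfg) (o : Obj) : Loc → Prop
  | .heap r ι => ∃ H ∈ [c.hop, c.hcl, c.hfr], ∃ S, H r = some S ∧ S ι = some o
  | .temp r ι => ∃ fr ∈ c.stack, fr.rid = r ∧ fr.tmp ι = some o
  | .root _ => False

/-- `Γs; Δ; Ψ ⊢ rcfg`: the configuration is well typed. Frames are typed by the contexts of
the stack and objects by `Δ`; `Δ` and `Ψ` are the disjoint unions of the types of the objects and
of the region identifiers in the different parts of the configuration; and the regions on the
stack are exactly the open regions. -/
structure RCfgTy (CT : ClassTable) (Γs : DynCtx) (Δ : OidCtx) (Ψ : Set Reg) (c : RCfg) :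
    Prop where
  frames : List.Forall₂ (fun (L : Layer) (fr : Frame) => VarsTy Δ L.ctx fr.vars) Γs c.stack
  objs : ∀ l o ι, l.oid = some ι → c.ObjAt o l → ObjTy CT Δ ι o
  dom : ∀ ι, (Δ ι).isSome → c.Stored ι
  unique : ∀ l l' o o', l.oid = l'.oid → c.ObjAt o l → c.ObjAt o' l' → l = l'
  rids : (c.stack.map Frame.rid).Nodup
  opened : {r | r ∈ c.stack.map Frame.rid} = c.hop.dom
  disjoint₁ : Disjoint c.hop.dom c.hcl.dom
  disjoint₂ : Disjoint c.hop.dom c.hfr.dom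
  disjoint₃ : Disjoint c.hcl.dom c.hfr.dom
  regions : Ψ = c.hop.dom ∪ c.hcl.dom ∪ c.hfr.dom

/-! Object graphs -/

/-- Edges of the object graph, marked with a field (or variable) and a capability. -/
structure Ref where
  src : Loc
  field : Name
  cap : Cap
  dst : Loc

structure Graph where
  locs : Set Loc
  refs : Set Ref

/-- The location is in the configuration. -/
def RCfg.HasLoc (c : RCfg) : Loc → Prop
  | .root r => ∃ fr ∈ c.stack, fr.rid = r
  | l => ∃ o, c.ObjAt o l

/-- The bindings `F` of the frame or the object at the location. -/
def RCfg.FieldsAt (c : RCfg) (F : Vars) : Loc → Prop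
  | .root r => ∃ fr ∈ c.stack, fr.rid = r ∧ fr.vars = F
  | l => ∃ o, c.ObjAt o l ∧ o.fields = F

/-- The object graph of a configuration. -/
def RCfg.graph (c : RCfg) : Graph where
  locs := {l | c.HasLoc l}
  refs := {R | ∃ F ι, c.FieldsAt F R.src ∧ F.Has R.field ⟨R.cap, ι⟩ ∧
    c.HasLoc R.dst ∧ R.dst.oid = some ι}

/-- An open region, with the path (from the next older region) through which it was entered. -/
structure Entry where
  rid : Reg
  var : Name
  field : Name

/-- Region orders: the open regions, most recently entered first. -/
abbrev Order := List Entry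

/-- The region order of a configuration under a stack of contexts. -/
def order (Γs : DynCtx) (c : RCfg) : Order :=
  List.zipWith (fun L fr => ⟨fr.rid, L.var, L.field⟩) Γs c.stack

/-- `ρ ⊢ r < r'`: both regions are open and `r'` was entered after `r`. -/
def Order.Lt (ρ : Order) (r r' : Reg) : Prop :=
  ∃ ρ₁ ρ₂ ρ₃ : Order, ∃ a a' : Entry, ρ = ρ₁ ++ a' :: ρ₂ ++ a :: ρ₃ ∧ a.rid = r ∧ a'.rid = r'

/-- `ρ ⊢ r ≤ r'`. -/
def Order.Le (ρ : Order) (r r' : Reg) : Prop := ρ.Lt r r' ∨ r = r'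

/-! Invariants -/

/-- An object that is the target of a `var` reference is the target of no other reference. -/
def VarUnique (G : Graph) : Prop :=
  ∀ R₁ ∈ G.refs, ∀ R₂ ∈ G.refs, R₁.cap = .var → R₁.dst = R₂.dst → R₁ = R₂

def RegionOrder (ρ : Order) (Cl Fr : Set Reg) (G : Graph) : Prop :=
  ∀ R ∈ G.refs,
    (R.cap = .mutable → R.src.rid = R.dst.rid) ∧
    (R.cap = .tmp → R.src.rid = R.dst.rid) ∧
    (R.cap = .var → R.src.rid = R.dst.rid) ∧
    (R.cap = .paused → ρ.Lt R.dst.rid R.src.rid) ∧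
    (R.cap = .iso → R.src.rid ≠ R.dst.rid ∧
      (R.dst.rid ∈ Cl ∨ ρ.Lt R.src.rid R.dst.rid ∨ (R.dst.rid ∈ Fr ∧ R.src.rid ∈ Fr))) ∧
    (R.cap = .imm → R.dst.rid ∈ Fr)

def Loc.IsHeap (l : Loc) : Prop := ∃ r ι, l = .heap r ι

def Loc.IsTemp (l : Loc) : Prop := ∃ r ι, l = .temp r ι

def Loc.IsRoot (l : Loc) : Prop := ∃ r, l = .root r

def LocationOK (G : Graph) : Prop :=
  ∀ R ∈ G.refs,
    (R.cap = .mutable → R.dst.IsHeap) ∧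
    (R.cap = .tmp → (R.src.IsRoot ∨ R.src.IsTemp) ∧ R.dst.IsTemp) ∧
    (R.cap = .var → R.src.IsRoot ∧ R.dst.IsTemp) ∧
    (R.cap = .paused → (R.src.IsRoot ∨ R.src.IsTemp) ∧ ¬ R.dst.IsRoot) ∧
    (R.cap = .iso → R.dst.IsHeap) ∧
    (R.cap = .imm → R.dst.IsHeap)

def DeepFreeze (Fr : Set Reg) (G : Graph) : Prop :=
  ∀ R ∈ G.refs, R.src.rid ∈ Fr → R.dst.rid ∈ Fr

/-- `capability_ok`. -/
def CapOK (Γs : DynCtx) (c : RCfg) : Prop :=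
  VarUnique c.graph ∧ RegionOrder (order Γs c) c.hcl.dom c.hfr.dom c.graph ∧
    LocationOK c.graph ∧ DeepFreeze c.hfr.dom c.graph

/-- The pairwise topology invariant. -/
def TopologyGraphOK (ρ : Order) (Fr : Set Reg) (G : Graph) : Prop :=
  ∀ R₁ ∈ G.refs, ∀ R₂ ∈ G.refs,
    R₁ = R₂ ∨ R₁.dst.rid ≠ R₂.dst.rid ∨ (R₁.dst.rid ∈ Fr ∨ R₂.dst.rid ∈ Fr) ∨
      (ρ.Le R₁.dst.rid R₁.src.rid ∨ ρ.Le R₂.dst.rid R₂.src.rid)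

/-- `entrypoints_ok`: for every open region except the oldest one, the path through which it was
entered still exists, and ends in an `iso` reference to an object of the region. -/
def EntrypointsOK (G : Graph) : Order → Prop
  | a :: b :: ρ =>
    (∃ (k : Cap) (l : Loc) (ι : Oid),
      (⟨.root b.rid, a.var, k, l⟩ : Ref) ∈ G.refs ∧
      (⟨l, a.field, .iso, .heap a.rid ι⟩ : Ref) ∈ G.refs) ∧
    EntrypointsOK G (b :: ρ)
  | _ => True

/-- `topology_ok`. -/
def TopOK (Γs : DynCtx) (c : RCfg) : Prop :=
  TopologyGraphOK (order Γs c) c.hfr.dom c.graph ∧ EntrypointsOK c.graph (order Γs c)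

end Reggio

namespace Reggio

/-! Subtyping -/

/-! The global graph invariants are first reduced to local ones. A reference whose capability is not
`iso` stays in its region, goes to an older one, or leads to a frozen one. An `iso` reference into a
region that is not frozen never goes to an older or equal region. So pairwise topology says exactly
that a region that is not frozen is the target of at most one `iso` reference. Together with `var`
uniqueness this becomes one statement about the symmetric relation `World.Conf`: values that
conflict occupy the same slot, a slot being a variable of a frame or a field of an object. All other
conditions except the entry points concern a single reference (`World.Ok`). `WT.ok` and
`OK.invariants` translate in the two directions, using that well-typed configurations have no
dangling references and that a slot has one value.

Effects are then cut into small moves. The predicate `OK` carries a list of values that the newest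
frame holds outside of any slot, under the same conditions as if they were its variables. Evaluating
uses moves values from slots into this list (`OK.get`, `OK.getAll`), binding moves them back into
slots (`OK.bindAll`), and the effect proper acts in between. A copy is harmless because it is
neither `iso` nor `var`; an exchange or a move creates no new pair of references.

Whole regions change their status only through an `iso` reference, and the uniqueness of that
reference gives control over everything that leads into the region. For `OK.freeze` and `OK.merge`
the reference is held, so no other reference from outside leads into the region; for freezing this
propagates to all regions reachable from it. For `OK.push` it is the entry path itself, which then
points from an older to a newer open region. On exit, the entry point invariant shows that the
overwritten field is this path, so the new reference leads into the same region (`OK.exit_target`);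
after that, `OK.pop` discards a frame to whose temporaries nothing else refers.

On the typing side, a value has one capability and its object one static type, so that subtyping can
be inverted (`Sub.sty_union`, `Sub.sty_sty`). The typing `Δ` of objects changes only at new objects,
at discarded temporaries, and at a `var` cell, whose only reference is retyped simultaneously. In a
case distinction the value selects a branch, and the resulting contexts are weakened to the join. A
join is undefined where either side is, so this needs that both branches undefine the same names;
they do, because the shape of the result depends only on the effect and the initial shape
(`EffTy.shape`). -/

theorem Sub.of_union {t₁ t₂ t : Ty} (h : Sub (.union t₁ t₂) t) : Sub t₁ t ∧ Sub t₂ t := by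
  generalize hs : Ty.union t₁ t₂ = s at h
  induction h with
  | refl t => subst hs; exact ⟨.unionRight₁ _ (.refl _), .unionRight₂ _ (.refl _)⟩
  | unionRight₁ t₂ _ ih => exact ⟨.unionRight₁ _ (ih hs).1, .unionRight₁ _ (ih hs).2⟩
  | unionRight₂ t₁ _ ih => exact ⟨.unionRight₂ _ (ih hs).1, .unionRight₂ _ (ih hs).2⟩
  | unionLeft h₁ h₂ _ _ => cases hs; exact ⟨h₁, h₂⟩
  | cell => cases hs

/-- Transitivity is not among the rules. The induction is on the middle type, with inner inductions
on the derivations. Cells are invariant, so the induction hypothesis for the middle content type is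
needed in both directions, which is why it is general in the outer types. -/
theorem Sub.trans {a b c : Ty} (h : Sub a b) (h' : Sub b c) : Sub a c := by
  induction b generalizing a c with
  | union b₁ b₂ ih₁ ih₂ =>
    generalize hs : Ty.union b₁ b₂ = s at h
    induction h with
    | refl => subst hs; exact h'
    | unionRight₁ _ h _ => cases hs; exact ih₁ h h'.of_union.1
    | unionRight₂ _ h _ => cases hs; exact ih₂ h h'.of_union.2
    | unionLeft _ _ i₁ i₂ => exact .unionLeft (i₁ hs) (i₂ hs)
    | cell => cases hs
  | cls k C =>
    generalize hs : Ty.cls k C = s at h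
    induction h with
    | refl => subst hs; exact h'
    | unionRight₁ => cases hs
    | unionRight₂ => cases hs
    | unionLeft _ _ i₁ i₂ => exact .unionLeft (i₁ hs) (i₂ hs)
    | cell => cases hs
  | cell k t ih =>
    generalize hs : Ty.cell k t = s at h
    induction h with
    | refl => subst hs; exact h'
    | unionRight₁ => cases hs
    | unionRight₂ => cases hs
    | unionLeft _ _ i₁ i₂ => exact .unionLeft (i₁ hs) (i₂ hs)
    | @cell k u _ h₁ h₂ _ _ =>
      cases hs
      generalize hs' : Ty.cell k t = s' at h'
      clear * - ih h₁ h₂ h' hs'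
      induction h' with
      | refl => subst hs'; exact .cell k h₁ h₂
      | unionRight₁ _ _ i => exact .unionRight₁ _ (i hs')
      | unionRight₂ _ _ i => exact .unionRight₂ _ (i hs')
      | unionLeft => cases hs'
      | cell _ h₃ h₄ _ _ => cases hs'; exact .cell k (ih h₁ h₃) (ih h₄ h₂)

/-- Equivalence of static types: the content types of cells are mutual subtypes. -/
inductive STy.Eqv : STy → STy → Prop
  | cls (C : ClsId) : STy.Eqv (.cls C) (.cls C)
  | cell {t t' : Ty} : Sub t t' → Sub t' t → STy.Eqv (.cell t) (.cell t')

theorem STy.Eqv.refl (CL : STy) : CL.Eqv CL := by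
  cases CL
  · exact .cls _
  · exact .cell (.refl _) (.refl _)

/-- No rule other than the two right rules can apply, as the left side is not a union. This makes a
union type at run time a genuine alternative. -/
theorem Sub.sty_union {CL : STy} {k : Cap} {t₁ t₂ : Ty} (h : Sub (CL.ty k) (.union t₁ t₂)) :
    Sub (CL.ty k) t₁ ∨ Sub (CL.ty k) t₂ := by
  generalize hs : CL.ty k = s at h ⊢
  cases h with
  | refl => cases CL <;> cases hs
  | unionRight₁ _ h => exact .inl h
  | unionRight₂ _ h => exact .inr h
  | unionLeft => cases CL <;> cases hs

theorem Sub.sty_cls {CL : STy} {k k' : Cap} {C : ClsId} (h : Sub (CL.ty k) (.cls k' C)) :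
    k = k' ∧ CL = .cls C := by
  generalize hs : CL.ty k = s at h
  cases h with
  | refl => cases CL <;> cases hs; exact ⟨rfl, rfl⟩
  | unionLeft => cases CL <;> cases hs

theorem Sub.sty_cell {CL : STy} {k k' : Cap} {t : Ty} (h : Sub (CL.ty k) (.cell k' t)) :
    k = k' ∧ CL.Eqv (.cell t) := by
  generalize hs : CL.ty k = s at h
  cases h with
  | refl => cases CL <;> cases hs; exact ⟨rfl, .refl _⟩
  | unionLeft => cases CL <;> cases hs
  | cell _ h₁ h₂ => cases CL <;> cases hs; exact ⟨rfl, .cell h₁ h₂⟩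

theorem Sub.sty_sty {CL CL' : STy} {k k' : Cap} (h : Sub (CL.ty k) (CL'.ty k')) :
    k = k' ∧ CL.Eqv CL' := by
  cases CL' with
  | cls C => obtain ⟨rfl, rfl⟩ := h.sty_cls; exact ⟨rfl, .refl _⟩
  | cell t => exact h.sty_cell

theorem STy.Eqv.sub {CL CL' : STy} (h : CL.Eqv CL') (k : Cap) : Sub (CL.ty k) (CL'.ty k) := by
  cases h with
  | cls => exact .refl _
  | cell h₁ h₂ => exact .cell k h₁ h₂

/-- A variable determines the static type of its object only up to equivalence. Fields read through
the variable may therefore have another type than in `Δ`, but an equivalent one, which suffices both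
for reading and for writing. -/
theorem STy.Eqv.ftype {CT : ClassTable} {CL CL' : STy} (h : CL.Eqv CL') {f : Name} {t : Ty}
    (ht : CT.ftype CL' f = some t) :
    ∃ t', CT.ftype CL f = some t' ∧ Sub t t' ∧ Sub t' t := by
  cases h with
  | cls => exact ⟨t, ht, .refl _, .refl _⟩
  | cell h₁ h₂ =>
    simp only [ClassTable.ftype, ClassTable.ftypes, List.lookup] at ht ⊢
    split at ht
    · cases ht; exact ⟨_, rfl, h₂, h₁⟩
    · cases ht

/-- Converts a static restriction on the capabilities of a type into a restriction on the capability
that a value actually carries. -/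
theorem Ty.capIn.of_sub {K : Set Cap} {CL : STy} {k : Cap} {t : Ty} (ht : t.capIn K)
    (h : Sub (CL.ty k) t) : k ∈ K := by
  induction t with
  | cls k' C => obtain ⟨rfl, -⟩ := h.sty_cls; exact ht
  | cell k' t => obtain ⟨rfl, -⟩ := h.sty_cell; exact ht
  | union t₁ t₂ ih₁ ih₂ =>
    rcases h.sty_union with h | h
    · exact ih₁ ht.1 h
    · exact ih₂ ht.2 h

theorem Sub.mapCap {CL : STy} {k : Cap} {t : Ty} (g : Cap → Cap) (h : Sub (CL.ty k) t) :
    Sub (CL.ty (g k)) (t.mapCap g) := by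
  induction t with
  | cls k' C => obtain ⟨rfl, rfl⟩ := h.sty_cls; exact .refl _
  | cell k' t => obtain ⟨rfl, h₁⟩ := h.sty_cell; exact h₁.sub _
  | union t₁ t₂ ih₁ ih₂ =>
    rcases h.sty_union with h | h
    · exact .unionRight₁ _ (ih₁ h)
    · exact .unionRight₂ _ (ih₂ h)

/-- Adaptation of a union is defined only if it is defined on all members, in particular on the
member to which the actual value belongs. -/
theorem Sub.vpa {CL : STy} {k k' : Cap} {t t' : Ty} (h : Sub (CL.ty k') t)
    (ht : t.vpa k = some t') : ∃ k'', k.vpa k' = some k'' ∧ Sub (CL.ty k'') t' := by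
  induction t generalizing t' with
  | cls k₁ C =>
    obtain ⟨rfl, rfl⟩ := h.sty_cls
    simp only [Ty.vpa, Option.map_eq_some_iff] at ht
    obtain ⟨a, ha, rfl⟩ := ht
    exact ⟨a, ha, .refl _⟩
  | cell k₁ t =>
    obtain ⟨rfl, h₁⟩ := h.sty_cell
    simp only [Ty.vpa, Option.map_eq_some_iff] at ht
    obtain ⟨a, ha, rfl⟩ := ht
    exact ⟨a, ha, h₁.sub _⟩
  | union t₁ t₂ ih₁ ih₂ =>
    simp only [Ty.vpa, Option.map_eq_some_iff, Option.bind_eq_some_iff] at ht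
    obtain ⟨a, ha, b, hb, rfl⟩ := ht
    rcases h.sty_union with h | h
    · obtain ⟨k'', h₁, h₂⟩ := ih₁ h ha
      exact ⟨k'', h₁, .unionRight₁ _ h₂⟩
    · obtain ⟨k'', h₁, h₂⟩ := ih₂ h hb
      exact ⟨k'', h₁, .unionRight₂ _ h₂⟩

theorem ClassTable.ftype_mem {CT : ClassTable} {CL : STy} {f : Name} {t : Ty}
    (h : CT.ftype CL f = some t) : (f, t) ∈ CT.ftypes CL := by
  simp only [ClassTable.ftype, List.lookup_eq_some_iff] at h
  obtain ⟨l₁, l₂, h, -⟩ := h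
  simp [h]

theorem TyWF.ftypes {CT : ClassTable} {CL : STy} {k : Cap} (h : TyWF CT (CL.ty k)) :
    ∀ p ∈ CT.ftypes CL, FieldOK k p.2 ∧ p.2.capIn {Cap.var}ᶜ := by
  cases CL with
  | cls C => exact fun p hp => ⟨h p hp, CT.no_var C p hp⟩
  | cell t => simpa [ClassTable.ftypes] using ⟨h.2.2, h.2.1⟩

theorem ClassTable.nodup_ftypes (CT : ClassTable) (CL : STy) :
    ((CT.ftypes CL).map Prod.fst).Nodup := by
  cases CL with
  | cls C => exact CT.nodup C
  | cell t => simp [ClassTable.ftypes]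

theorem SubTag.fieldNames {CT : ClassTable} {tag : Tag} {CL : STy} (h : SubTag tag CL) :
    CT.fieldNames tag = (CT.ftypes CL).map Prod.fst := by
  cases h <;> rfl

/-! Typing of values and bindings -/

/-- The value `v` has type `t`. -/
def HasTy (Δ : OidCtx) (v : Val) (t : Ty) : Prop :=
  ∃ CL, Δ v.oid = some CL ∧ Sub (CL.ty v.cap) t

theorem HasTy.sub {Δ : OidCtx} {v : Val} {t t' : Ty} (h : HasTy Δ v t) (hs : Sub t t') :
    HasTy Δ v t' := by
  obtain ⟨CL, h₁, h₂⟩ := h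
  exact ⟨CL, h₁, h₂.trans hs⟩

theorem HasTy.cap_mem {Δ : OidCtx} {v : Val} {t : Ty} {K : Set Cap} (h : HasTy Δ v t)
    (ht : t.capIn K) : v.cap ∈ K := by
  obtain ⟨CL, -, h₂⟩ := h
  exact ht.of_sub h₂

theorem HasTy.union {Δ : OidCtx} {v : Val} {t₁ t₂ : Ty} (h : HasTy Δ v (.union t₁ t₂)) :
    HasTy Δ v t₁ ∨ HasTy Δ v t₂ := by
  obtain ⟨CL, h₁, h₂⟩ := h
  exact h₂.sty_union.imp (⟨CL, h₁, ·⟩) (⟨CL, h₁, ·⟩)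

theorem HasTy.congr {Δ Δ' : OidCtx} {v : Val} {t : Ty} (h : HasTy Δ v t)
    (hΔ : Δ' v.oid = Δ v.oid) : HasTy Δ' v t := by
  obtain ⟨CL, h₁, h₂⟩ := h
  exact ⟨CL, hΔ.trans h₁, h₂⟩

theorem HasTy.mapCap {Δ : OidCtx} {k : Cap} {ι : Oid} {t : Ty} (g : Cap → Cap)
    (h : HasTy Δ ⟨k, ι⟩ t) : HasTy Δ ⟨g k, ι⟩ (t.mapCap g) := by
  obtain ⟨CL, h₁, h₂⟩ := h
  exact ⟨CL, h₁, h₂.mapCap g⟩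

/-- The entry of a context agrees with the entry of the bindings of a frame or an object. -/
def EntryTy (Δ : OidCtx) : Option (Option Ty) → Option (Option Val) → Prop
  | none, none => True
  | some none, some none => True
  | some (some t), some (some v) => HasTy Δ v t
  | _, _ => False

theorem varsTy_iff {Δ : OidCtx} {Γ : Ctx} {F : Vars} :
    VarsTy Δ Γ F ↔ ∀ x, EntryTy Δ (Γ x) (F x) := by
  unfold VarsTy
  refine forall_congr' fun x => ?_
  rcases Γ x with _ | _ | t <;> rcases F x with _ | _ | v <;> rfl

theorem VarsTy.hasTy {Δ : OidCtx} {Γ : Ctx} {F : Vars} (h : VarsTy Δ Γ F) {x : Name} {t : Ty}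
    {v : Val} (hx : Γ.Has x t) (hv : F.Has x v) : HasTy Δ v t := by
  have := varsTy_iff.1 h x
  rw [hx, hv] at this
  exact this

theorem VarsTy.exists_ty {Δ : OidCtx} {Γ : Ctx} {F : Vars} (h : VarsTy Δ Γ F) {x : Name}
    {v : Val} (hv : F.Has x v) : ∃ t, Γ.Has x t ∧ HasTy Δ v t := by
  have := varsTy_iff.1 h x
  rw [hv] at this
  rcases hx : Γ x with _ | _ | t <;> rw [hx] at this
  · exact this.elim
  · exact this.elim
  · exact ⟨t, hx, this⟩

theorem VarsTy.eq_none_iff {Δ : OidCtx} {Γ : Ctx} {F : Vars} (h : VarsTy Δ Γ F) {x : Name} :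
    F x = none ↔ Γ x = none := by
  have := varsTy_iff.1 h x
  rcases hx : Γ x with _ | _ | t <;> rcases hf : F x with _ | _ | v <;> simp_all [EntryTy]

theorem VarsTy.set {Δ : OidCtx} {Γ : Ctx} {F : Vars} (h : VarsTy Δ Γ F) (x : Name) {t : Ty}
    {v : Val} (hv : HasTy Δ v t) : VarsTy Δ (Γ.set x t) (F.set x v) := by
  rw [varsTy_iff] at h ⊢
  intro y
  rcases eq_or_ne y x with rfl | hy
  · simpa [Ctx.set, Vars.set, EntryTy] using hv
  · simpa [Ctx.set, Vars.set, hy] using h y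

theorem VarsTy.ctx_set {Δ : OidCtx} {Γ : Ctx} {F : Vars} (h : VarsTy Δ Γ F) {x : Name} {t : Ty}
    {v : Val} (hx : F.Has x v) (hv : HasTy Δ v t) : VarsTy Δ (Γ.set x t) F := by
  have := h.set x hv
  rwa [Vars.set, Function.update_eq_self_iff.2 hx.symm] at this

theorem VarsTy.vars_set {Δ : OidCtx} {Γ : Ctx} {F : Vars} (h : VarsTy Δ Γ F) {x : Name} {t : Ty}
    {v : Val} (hx : Γ.Has x t) (hv : HasTy Δ v t) : VarsTy Δ Γ (F.set x v) := by
  have := h.set x hv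
  rwa [Ctx.set, Function.update_eq_self_iff.2 hx.symm] at this

theorem VarsTy.undef {Δ : OidCtx} {Γ : Ctx} {F : Vars} (h : VarsTy Δ Γ F) (x : Name) :
    VarsTy Δ (Γ.undef x) (Function.update F x (some none)) := by
  rw [varsTy_iff] at h ⊢
  intro y
  rcases eq_or_ne y x with rfl | hy
  · simp [Ctx.undef, EntryTy]
  · simpa [Ctx.undef, hy] using h y

theorem VarsTy.congr {Δ Δ' : OidCtx} {Γ : Ctx} {F : Vars} (h : VarsTy Δ Γ F)
    (hΔ : ∀ x v, F.Has x v → Δ' v.oid = Δ v.oid) : VarsTy Δ' Γ F := by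
  rw [varsTy_iff] at h ⊢
  intro x
  have hx := h x
  rcases hΓ : Γ x with _ | _ | t <;> rcases hf : F x with _ | _ | v <;> rw [hΓ, hf] at hx
  all_goals first | exact hx | exact HasTy.congr hx (hΔ x v hf)

theorem VarsTy.empty (Δ : OidCtx) : VarsTy Δ Ctx.empty Vars.empty := fun _ => trivial

theorem VarsTy.setAll {Δ : OidCtx} {Γ : Ctx} {F : Vars} (h : VarsTy Δ Γ F) {xs : List Name}
    {ts : List Ty} {vs : List Val} (hv : List.Forall₂ (HasTy Δ) vs ts) :
    VarsTy Δ (Γ.setAll xs ts) (F.setAll xs vs) := by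
  induction xs generalizing Γ F ts vs with
  | nil => cases hv <;> exact h
  | cons x xs ih =>
    cases hv with
    | nil => exact h
    | cons h₁ h₂ => exact ih (h.set x h₁) h₂

theorem Vars.has_set {F : Vars} {x y : Name} {v w : Val} :
    (F.set x v).Has y w ↔ (y = x ∧ w = v) ∨ (y ≠ x ∧ F.Has y w) := by
  rcases eq_or_ne y x with rfl | hy
  · simp [Vars.set, Vars.Has, eq_comm]
  · simp [Vars.set, Vars.Has, hy]

theorem Vars.has_setAll {F : Vars} {xs : List Name} {vs : List Val} {y : Name} {w : Val}
    (h : (F.setAll xs vs).Has y w) : F.Has y w ∨ (y, w) ∈ xs.zip vs := by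
  induction xs generalizing F vs with
  | nil => exact .inl h
  | cons x xs ih =>
    cases vs with
    | nil => exact .inl h
    | cons v vs =>
      rcases ih h with h | h
      · rcases Vars.has_set.1 h with ⟨rfl, rfl⟩ | ⟨-, h⟩
        · exact .inr (by simp)
        · exact .inl h
      · exact .inr (by simp [h])

theorem Vars.Has.eq {F : Vars} {x : Name} {v w : Val} (h : F.Has x v) (h' : F.Has x w) :
    v = w := by
  have := h.symm.trans h'
  simpa using this

/-- The context of the fields `l`, built by successive extension. -/
theorem Ctx.setAll_eq_lookup {l : List (Name × Ty)} (hl : (l.map Prod.fst).Nodup) (Γ : Ctx) :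
    Γ.setAll (l.map Prod.fst) (l.map Prod.snd) =
      fun f => ((l.lookup f).map some).or (Γ f) := by
  induction l generalizing Γ with
  | nil => rfl
  | cons p l ih =>
    obtain ⟨x, t⟩ := p
    simp only [List.map_cons, List.nodup_cons] at hl
    simp only [List.map_cons, Ctx.setAll, ih hl.2]
    funext f
    rcases eq_or_ne f x with rfl | hf
    -- Successive extension keeps the last binding of a name while `lookup` finds the first;
    -- distinctness of the names makes the two agree.
    · have : l.lookup f = none := by
        rw [List.lookup_eq_none_iff]
        intro q hq
        simp only [ne_eq, bne_iff_ne]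
        rintro rfl
        exact hl.1 (List.mem_map_of_mem hq)
      simp [this, Ctx.set]
    · have hf' : (f == x) = false := by simpa using hf
      simp [List.lookup, hf', Ctx.set, hf]

/-- In this form the fields of a new object are typed by the same lemma, `VarsTy.setAll`, as
variables that are bound together. -/
theorem ClassTable.ctxOf_eq (CT : ClassTable) (CL : STy) :
    CT.ctxOf CL =
      Ctx.empty.setAll ((CT.ftypes CL).map Prod.fst) ((CT.ftypes CL).map Prod.snd) := by
  rw [Ctx.setAll_eq_lookup (CT.nodup_ftypes CL)]
  funext f
  simp [ClassTable.ctxOf, ClassTable.ftype, Ctx.empty]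

/-! Shapes of contexts -/

/-- The domain of a context, together with the information which names are undefined. -/
def Ctx.shape (Γ : Ctx) : Name → Option Bool := fun x => (Γ x).map Option.isSome

/-- The effect of a use on shapes. -/
def Use.shape : Use → (Name → Option Bool) → (Name → Option Bool)
  | .keep _, s => s
  | .drop x, s => Function.update s x (some false)

theorem Ctx.shape_set (Γ : Ctx) (x : Name) (t : Ty) :
    (Γ.set x t).shape = Function.update Γ.shape x (some true) := by
  funext y
  rcases eq_or_ne y x with rfl | hy
  · simp [Ctx.shape, Ctx.set]
  · simp [Ctx.shape, Ctx.set, hy]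

theorem Ctx.shape_undef (Γ : Ctx) (x : Name) :
    (Γ.undef x).shape = Function.update Γ.shape x (some false) := by
  funext y
  rcases eq_or_ne y x with rfl | hy
  · simp [Ctx.shape, Ctx.undef]
  · simp [Ctx.shape, Ctx.undef, hy]

theorem Ctx.Has.shape_set {Γ : Ctx} {x : Name} {t : Ty} (h : Γ.Has x t) (t' : Ty) :
    (Γ.set x t').shape = Γ.shape := by
  rw [Ctx.shape_set, Function.update_eq_self_iff]
  simp [Ctx.shape, show Γ x = _ from h]

theorem Ctx.shape_join {Γ₁ Γ₂ : Ctx} (h : Γ₁.shape = Γ₂.shape) :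
    (Γ₁.join Γ₂).shape = Γ₁.shape := by
  funext x
  have := congrFun h x
  simp only [Ctx.shape] at this ⊢
  rcases h₁ : Γ₁ x with _ | _ | t₁ <;> rcases h₂ : Γ₂ x with _ | _ | t₂ <;>
    simp_all [Ctx.join]

/-- Equal domains would not be enough: where only one context is `undef`, the join is `undef`
although the frame may have a value. With equal shapes this does not happen, and the types are
weakened to unions. -/
theorem VarsTy.join_left {Δ : OidCtx} {Γ₁ Γ₂ : Ctx} {F : Vars} (h : VarsTy Δ Γ₁ F)
    (hs : Γ₁.shape = Γ₂.shape) : VarsTy Δ (Γ₁.join Γ₂) F := by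
  rw [varsTy_iff] at h ⊢
  intro x
  have h₀ := congrFun hs x
  have hx := h x
  simp only [Ctx.shape] at h₀
  rcases h₁ : Γ₁ x with _ | _ | t₁ <;> rcases h₂ : Γ₂ x with _ | _ | t₂ <;>
    rw [h₁] at hx <;> simp only [h₁, h₂, Ctx.join] at h₀ ⊢ <;> try first | exact hx | simp at h₀
  rcases hF : F x with _ | _ | v <;> rw [hF] at hx
  · exact hx
  · exact hx
  · exact hx.sub (.unionRight₁ _ (.refl _))

theorem VarsTy.join_right {Δ : OidCtx} {Γ₁ Γ₂ : Ctx} {F : Vars} (h : VarsTy Δ Γ₂ F)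
    (hs : Γ₁.shape = Γ₂.shape) : VarsTy Δ (Γ₁.join Γ₂) F := by
  rw [varsTy_iff] at h ⊢
  intro x
  have h₀ := congrFun hs x
  have hx := h x
  simp only [Ctx.shape] at h₀
  rcases h₁ : Γ₁ x with _ | _ | t₁ <;> rcases h₂ : Γ₂ x with _ | _ | t₂ <;>
    rw [h₂] at hx <;> simp only [h₁, h₂, Ctx.join] at h₀ ⊢ <;> try first | exact hx | simp at h₀
  rcases hF : F x with _ | _ | v <;> rw [hF] at hx
  · exact hx
  · exact hx
  · exact hx.sub (.unionRight₂ _ (.refl _))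

/-- Which names become undefined can be read off the use itself, so the two branches of a case
distinction always agree on them. -/
theorem UseTy.shape {CT : ClassTable} {Γ Γ' : Ctx} {u : Use} {t : Ty} (h : UseTy CT Γ u t Γ') :
    Γ'.shape = u.shape Γ.shape := by
  induction h with
  | keep => rfl
  | drop => exact Ctx.shape_undef _ _
  | sub _ _ ih => exact ih
  | split hx _ _ _ ih₁ ih₂ =>
    rw [hx.shape_set] at ih₁ ih₂
    rw [Ctx.shape_join (ih₁.trans ih₂.symm), ih₁]

/-- The value of the variable belongs to a member of the union, so the context may be narrowed to
that member. -/
theorem VarsTy.split {Δ : OidCtx} {Γ : Ctx} {F : Vars} (h : VarsTy Δ Γ F) {x : Name}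
    {t₁ t₂ : Ty} (hx : Γ.Has x (.union t₁ t₂)) :
    VarsTy Δ (Γ.set x t₁) F ∨ VarsTy Δ (Γ.set x t₂) F := by
  have hF := varsTy_iff.1 h x
  rw [hx] at hF
  rcases hv : F x with _ | _ | v <;> rw [hv] at hF
  · exact hF.elim
  · exact hF.elim
  · exact hF.union.imp (h.ctx_set hv) (h.ctx_set hv)

/-! Typing of uses -/

theorem UseTy.ctxWF {CT : ClassTable} {Γ Γ' : Ctx} {u : Use} {t : Ty} (h : UseTy CT Γ u t Γ') :
    CtxWF CT Γ' := by
  induction h with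
  | keep h => exact h
  | @drop Γ x t h hx =>
    intro y t' hy
    rcases eq_or_ne y x with rfl | hyx
    · simp [Ctx.Has, Ctx.undef] at hy
    · exact h y t' (by simpa [Ctx.Has, Ctx.undef, hyx] using hy)
  | sub _ _ ih => exact ih
  | @split _ Γ₁ Γ₂ _ _ _ _ _ _ _ _ _ _ ih₁ ih₂ =>
    intro y t hy
    rcases h₁ : Γ₁ y with _ | _ | t₁ <;> rcases h₂ : Γ₂ y with _ | _ | t₂ <;>
      simp only [Ctx.Has, Ctx.join, h₁, h₂] at hy <;> cases hy
    exact ⟨ih₁ y t₁ h₁, ih₂ y t₂ h₂⟩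

theorem UseTy.get {CT : ClassTable} {Δ : OidCtx} {Γ Γ' : Ctx} {u : Use} {t : Ty}
    (h : UseTy CT Γ u t Γ') {F F' : Vars} {v : Val} (hF : VarsTy Δ Γ F)
    (hg : u.get F = some (v, F')) : HasTy Δ v t ∧ VarsTy Δ Γ' F' := by
  induction h generalizing F' v with
  | @keep _ x _ _ hx =>
    rcases hv : F x with _ | _ | w <;> simp only [Use.get, hv] at hg
    · cases hg
    · cases hg
    · split at hg
      · cases hg
      · cases hg; exact ⟨hF.hasTy hx hv, hF⟩
  | @drop _ x _ _ hx =>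
    rcases hv : F x with _ | _ | w <;> simp only [Use.get, hv] at hg
    · cases hg
    · cases hg
    · cases hg; exact ⟨hF.hasTy hx hv, hF.undef x⟩
  | sub _ hs ih =>
    obtain ⟨h₁, h₂⟩ := ih hF hg
    exact ⟨h₁.sub hs, h₂⟩
  | split hx h₁ h₂ _ ih₁ ih₂ =>
    have hs := h₁.shape.trans ((congrArg _ ((hx.shape_set _).trans (hx.shape_set _).symm)).trans
      h₂.shape.symm)
    rcases hF.split hx with hF | hF
    · obtain ⟨h₁, h₂⟩ := ih₁ hF hg
      exact ⟨h₁.sub (.unionRight₁ _ (.refl _)), h₂.join_left hs⟩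
    · obtain ⟨h₁, h₂⟩ := ih₂ hF hg
      exact ⟨h₁.sub (.unionRight₂ _ (.refl _)), h₂.join_right hs⟩

/-- A use either drops a variable or copies a variable that is neither `iso` nor `var`. -/
theorem Use.get_cases {u : Use} {F F' : Vars} {v : Val} (h : u.get F = some (v, F')) :
    ∃ z, F.Has z v ∧ ((F' = F ∧ v.cap ≠ .iso ∧ v.cap ≠ .var) ∨
      F' = Function.update F z (some none)) := by
  cases u with
  | keep x =>
    rcases hv : F x with _ | _ | w <;> simp only [Use.get, hv] at h
    · cases h
    · cases h
    · split at h
      · cases h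
      · rename_i hc
        cases h
        exact ⟨x, hv, .inl ⟨rfl, fun h => hc (.inr h), fun h => hc (.inl h)⟩⟩
  | drop x =>
    rcases hv : F x with _ | _ | w <;> simp only [Use.get, hv] at h
    · cases h
    · cases h
    · cases h; exact ⟨x, hv, .inr rfl⟩

theorem Use.get_none {u : Use} {F F' : Vars} {v : Val} (h : u.get F = some (v, F')) {x : Name} :
    F' x = none ↔ F x = none := by
  obtain ⟨z, hz, ⟨rfl, -⟩ | rfl⟩ := Use.get_cases h
  · rfl
  · rcases eq_or_ne x z with rfl | hx
    · simp [show F x = _ from hz]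
    · simp [hx]

theorem getAll_none {us : List Use} {F F' : Vars} {vs : List Val}
    (h : getAll us F = some (vs, F')) {x : Name} : F' x = none ↔ F x = none := by
  induction us generalizing F vs with
  | nil => cases h; rfl
  | cons u us ih =>
    simp only [getAll, Option.bind_eq_some_iff, Option.map_eq_some_iff] at h
    obtain ⟨⟨v, F₁⟩, h₁, ⟨ws, F₂⟩, h₂, h₃⟩ := h
    cases h₃
    exact (ih h₂).trans (Use.get_none h₁)

/-! Reference invariants -/

@[simp] theorem Loc.isHeap_heap (r : Reg) (ι : Oid) : (Loc.heap r ι).IsHeap := ⟨r, ι, rfl⟩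
@[simp] theorem Loc.not_isHeap_temp (r : Reg) (ι : Oid) : ¬ (Loc.temp r ι).IsHeap := by
  rintro ⟨_, _, h⟩; cases h
@[simp] theorem Loc.not_isHeap_root (r : Reg) : ¬ (Loc.root r).IsHeap := by
  rintro ⟨_, _, h⟩; cases h
@[simp] theorem Loc.not_isTemp_heap (r : Reg) (ι : Oid) : ¬ (Loc.heap r ι).IsTemp := by
  rintro ⟨_, _, h⟩; cases h
@[simp] theorem Loc.isTemp_temp (r : Reg) (ι : Oid) : (Loc.temp r ι).IsTemp := ⟨r, ι, rfl⟩
@[simp] theorem Loc.not_isTemp_root (r : Reg) : ¬ (Loc.root r).IsTemp := by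
  rintro ⟨_, _, h⟩; cases h
@[simp] theorem Loc.not_isRoot_heap (r : Reg) (ι : Oid) : ¬ (Loc.heap r ι).IsRoot := by
  rintro ⟨_, h⟩; cases h
@[simp] theorem Loc.not_isRoot_temp (r : Reg) (ι : Oid) : ¬ (Loc.temp r ι).IsRoot := by
  rintro ⟨_, h⟩; cases h
@[simp] theorem Loc.isRoot_root (r : Reg) : (Loc.root r).IsRoot := ⟨r, rfl⟩
@[simp] theorem Loc.rid_heap (r : Reg) (ι : Oid) : (Loc.heap r ι).rid = r := rfl
@[simp] theorem Loc.rid_temp (r : Reg) (ι : Oid) : (Loc.temp r ι).rid = r := rfl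
@[simp] theorem Loc.rid_root (r : Reg) : (Loc.root r).rid = r := rfl
@[simp] theorem Loc.oid_heap (r : Reg) (ι : Oid) : (Loc.heap r ι).oid = some ι := rfl
@[simp] theorem Loc.oid_temp (r : Reg) (ι : Oid) : (Loc.temp r ι).oid = some ι := rfl
@[simp] theorem Loc.oid_root (r : Reg) : (Loc.root r).oid = none := rfl

theorem Loc.IsHeap.not_isTemp {l : Loc} (h : l.IsHeap) : ¬ l.IsTemp := by
  obtain ⟨r, ι, rfl⟩ := h; simp

theorem Loc.IsTemp.not_isHeap {l : Loc} (h : l.IsTemp) : ¬ l.IsHeap := fun h' => h'.not_isTemp h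

theorem Loc.IsTemp.not_isRoot {l : Loc} (h : l.IsTemp) : ¬ l.IsRoot := by
  obtain ⟨r, ι, rfl⟩ := h; simp

theorem Loc.IsHeap.not_isRoot {l : Loc} (h : l.IsHeap) : ¬ l.IsRoot := by
  obtain ⟨r, ι, rfl⟩ := h; simp

theorem Loc.isRoot_or_isTemp {l : Loc} : l.IsRoot ∨ l.IsTemp ↔ ¬ l.IsHeap := by
  cases l <;> simp

/-- The open regions (newest first), closed regions and frozen regions of a configuration, and
the locations of its objects. -/
structure World where
  rids : List Reg
  cl : Set Reg
  fr : Set Reg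
  loc : Oid → Loc

/-- `r` and `r'` are open, and `r'` is newer. -/
def World.Lt (W : World) (r r' : Reg) : Prop := [r', r].Sublist W.rids

/-- The root of the newest frame. -/
def World.top (W : World) : Loc := .root (W.rids.headD 0)

/-- Open, closed and frozen regions are distinct, and open regions are listed once. -/
structure World.WF (W : World) : Prop where
  nodup : W.rids.Nodup
  not_cl : ∀ r ∈ W.rids, r ∉ W.cl
  not_fr : ∀ r ∈ W.rids, r ∉ W.fr
  cl_fr : ∀ r ∈ W.cl, r ∉ W.fr

theorem World.Lt.left {W : World} {r r' : Reg} (h : W.Lt r r') : r ∈ W.rids :=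
  h.subset (by simp)

theorem World.Lt.right {W : World} {r r' : Reg} (h : W.Lt r r') : r' ∈ W.rids :=
  h.subset (by simp)

/-- Peeling off the newest region is what relates the orders before and after a frame is pushed or
popped. -/
theorem World.lt_iff {W : World} {q : Reg} {L : List Reg} (hW : W.rids = q :: L) {r r' : Reg} :
    W.Lt r r' ↔ (r' = q ∧ r ∈ L) ∨ [r', r].Sublist L := by
  rw [World.Lt, hW, List.sublist_cons_iff]
  constructor
  · rintro (h | ⟨_, h₁, h⟩)
    · exact .inr h
    · cases h₁; exact .inl ⟨rfl, by simpa using h⟩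
  · rintro (⟨rfl, h⟩ | h)
    · exact .inr ⟨_, rfl, by simpa using h⟩
    · exact .inl h

theorem World.Lt.asymm {W : World} (hW : W.rids.Nodup) {r r' : Reg} (h : W.Lt r r') :
    ¬ W.Lt r' r := by
  unfold World.Lt at *
  generalize W.rids = L at *
  induction L with
  | nil => simp at h
  | cons q L ih =>
    intro h'
    rw [List.nodup_cons] at hW
    rw [List.sublist_cons_iff] at h h'
    rcases h with h | ⟨_, h₁, h⟩
    · rcases h' with h' | ⟨_, h₂, h'⟩
      · exact ih hW.2 h h'
      · cases h₂; exact hW.1 (h.subset (by simp))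
    · cases h₁
      rcases h' with h' | ⟨_, h₂, h'⟩
      · exact hW.1 (h'.subset (by simp))
      · cases h₂; exact hW.1 (by simpa using h)

theorem World.Lt.trans {W : World} (hW : W.rids.Nodup) {r₁ r₂ r₃ : Reg} (h : W.Lt r₁ r₂)
    (h' : W.Lt r₂ r₃) : W.Lt r₁ r₃ := by
  unfold World.Lt at *
  generalize W.rids = L at *
  induction L with
  | nil => simp at h
  | cons q L ih =>
    rw [List.nodup_cons] at hW
    rw [List.sublist_cons_iff] at h h' ⊢
    rcases h with h | ⟨_, h₁, h⟩
    · rcases h' with h' | ⟨_, h₂, h'⟩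
      · exact .inl (ih hW.2 h h')
      · cases h₂; exact .inr ⟨_, rfl, by simpa using h.subset (by simp)⟩
    · cases h₁
      rcases h' with h' | ⟨_, h₂, h'⟩
      · exact (hW.1 (h'.subset (by simp))).elim
      · cases h₂; exact (hW.1 (by simpa using h')).elim

/-- Its main use: an `iso` reference held by the newest frame cannot go to a newer region, and its
own region is not frozen, so it leads into a closed region. -/
theorem World.not_top_lt {W : World} {q : Reg} {L : List Reg} (hr : W.rids = q :: L)
    (hW : W.rids.Nodup) (r : Reg) : ¬ W.Lt q r := by
  intro h
  rw [hr, List.nodup_cons] at hW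
  rcases (World.lt_iff hr).1 h with ⟨-, h⟩ | h
  · exact hW.1 h
  · exact hW.1 (h.subset (by simp))

/-- The conditions on a single reference from `l` to `l'` with capability `k`. -/
def World.CapOk (W : World) (l l' : Loc) : Cap → Prop
  | .mutable => l.rid = l'.rid ∧ l'.IsHeap
  | .tmp => l.rid = l'.rid ∧ ¬ l.IsHeap ∧ l'.IsTemp
  | .var => l.rid = l'.rid ∧ l.IsRoot ∧ l'.IsTemp
  | .paused => W.Lt l'.rid l.rid ∧ ¬ l.IsHeap ∧ ¬ l'.IsRoot
  | .iso => l.rid ≠ l'.rid ∧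
      (l'.rid ∈ W.cl ∨ W.Lt l.rid l'.rid ∨ (l'.rid ∈ W.fr ∧ l.rid ∈ W.fr)) ∧ l'.IsHeap
  | .imm => l'.rid ∈ W.fr ∧ l'.IsHeap

/-- The conditions on the reference `v` stored at `l`. -/
def World.Ok (W : World) (l : Loc) (v : Val) : Prop :=
  (l.rid ∈ W.fr → (W.loc v.oid).rid ∈ W.fr) ∧ W.CapOk l (W.loc v.oid) v.cap

/-- Two references must not coexist: they go to the same object and one of them is `var`, or they
are `iso` references into the same region that is not frozen. -/
def World.Conf (W : World) (v w : Val) : Prop :=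
  ((v.cap = .var ∨ w.cap = .var) ∧ v.oid = w.oid) ∨
    (v.cap = .iso ∧ w.cap = .iso ∧ (W.loc v.oid).rid = (W.loc w.oid).rid ∧
      (W.loc v.oid).rid ∉ W.fr)

theorem World.Conf.symm {W : World} {v w : Val} (h : W.Conf v w) : W.Conf w v := by
  rcases h with ⟨h₁, h₂⟩ | ⟨h₁, h₂, h₃, h₄⟩
  · exact .inl ⟨h₁.symm, h₂.symm⟩
  · exact .inr ⟨h₂, h₁, h₃.symm, h₃ ▸ h₄⟩

theorem World.Ok.isTemp_of_var {W : World} {l : Loc} {v : Val} (h : W.Ok l v)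
    (hv : v.cap = .var) : (W.loc v.oid).IsTemp := by
  have := h.2
  rw [hv] at this
  exact this.2.2

/-- The invariants on the references `E` and on the values `fl` that are held temporarily by the
newest frame. -/
structure Inv (W : World) (E : Loc → Name → Val → Prop) (fl : List Val) : Prop where
  ok : ∀ l f v, E l f v → W.Ok l v
  okFl : ∀ v ∈ fl, W.Ok W.top v
  sep : ∀ l₁ f₁ v₁ l₂ f₂ v₂, E l₁ f₁ v₁ → E l₂ f₂ v₂ → W.Conf v₁ v₂ → l₁ = l₂ ∧ f₁ = f₂
  sepFl : ∀ l f v, E l f v → ∀ w ∈ fl, ¬ W.Conf v w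
  sepFlFl : fl.Pairwise fun v w => ¬ W.Conf v w

/-! ### Moving references between slots and the newest frame's hand -/

namespace Inv

variable {W : World} {E E' : Loc → Name → Val → Prop} {fl fl' : List Val}

/-- Transfer of the invariants to another world along a correspondence of references. -/
theorem map {W' : World} (m : Loc → Loc) (T : Val → Val → Prop) (h : Inv W E fl)
    (hT : ∀ v₁ v₁' v₂ v₂', T v₁ v₁' → T v₂ v₂' → W'.Conf v₁' v₂' → W.Conf v₁ v₂)
    (hE : ∀ l' f v', E' l' f v' → W'.Ok l' v' ∧ ∃ l v, m l = l' ∧ E l f v ∧ T v v')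
    (hfl : List.Forall₂ (fun v v' => T v v' ∧ W'.Ok W'.top v') fl fl') : Inv W' E' fl' where
  ok l f v hv := (hE l f v hv).1
  okFl v hv := by
    obtain ⟨i, rfl⟩ := List.get_of_mem hv
    have hi : i.1 < fl.length := by rw [hfl.length_eq]; exact i.2
    exact ((List.forall₂_iff_get.1 hfl).2 i hi i.2).2
  sep l₁ f₁ v₁ l₂ f₂ v₂ h₁ h₂ hc := by
    obtain ⟨-, l₁, w₁, rfl, e₁, t₁⟩ := hE _ _ _ h₁
    obtain ⟨-, l₂, w₂, rfl, e₂, t₂⟩ := hE _ _ _ h₂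
    exact (h.sep _ _ _ _ _ _ e₁ e₂ (hT _ _ _ _ t₁ t₂ hc)).imp_left (congrArg m)
  sepFl l f v hv w hw hc := by
    obtain ⟨-, l, v₀, rfl, e₀, t₀⟩ := hE _ _ _ hv
    obtain ⟨i, rfl⟩ := List.get_of_mem hw
    have hi : i.1 < fl.length := by rw [hfl.length_eq]; exact i.2
    exact h.sepFl _ _ _ e₀ _ (List.get_mem fl ⟨i, hi⟩)
      (hT _ _ _ _ t₀ ((List.forall₂_iff_get.1 hfl).2 i hi i.2).1 hc)
  sepFlFl := by
    rw [List.pairwise_iff_getElem]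
    intro i j hi hj hij hc
    have hg := List.forall₂_iff_get.1 hfl
    have hi' : i < fl.length := by rwa [hfl.length_eq]
    have hj' : j < fl.length := by rwa [hfl.length_eq]
    exact List.pairwise_iff_getElem.1 h.sepFlFl i j hi' hj' hij
      (hT _ _ _ _ (hg.2 i hi' hi).1 (hg.2 j hj' hj).1 hc)

/-- All conditions are universal over references and pairs of references, so references and held
values may be discarded. As conflict is symmetric, the order of the held values does not matter
either. -/
theorem mono (h : Inv W E fl) (hE : ∀ l f v, E' l f v → E l f v) (hfl : fl'.Subperm fl) :
    Inv W E' fl' where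
  ok l f v hv := h.ok l f v (hE l f v hv)
  okFl v hv := h.okFl v (hfl.subset hv)
  sep _ _ _ _ _ _ h₁ h₂ := h.sep _ _ _ _ _ _ (hE _ _ _ h₁) (hE _ _ _ h₂)
  sepFl _ _ _ hv w hw := h.sepFl _ _ _ (hE _ _ _ hv) w (hfl.subset hw)
  sepFlFl := by
    obtain ⟨l, hl, hs⟩ := hfl
    exact ((h.sepFlFl.sublist hs).perm hl fun h₁ h₂ => h₁ h₂.symm)

/-- Remove a reference from the graph and hold it in the newest frame. -/
theorem take {l : Loc} {z : Name} {v : Val} (h : Inv W E fl) (hv : E l z v)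
    (ok : W.Ok W.top v) (hE : ∀ l' f w, E' l' f w → E l' f w ∧ ¬ (l' = l ∧ f = z)) :
    Inv W E' (v :: fl) where
  ok l f w hw := h.ok l f w (hE _ _ _ hw).1
  okFl w hw := by
    rcases List.mem_cons.1 hw with rfl | hw
    · exact ok
    · exact h.okFl w hw
  sep _ _ _ _ _ _ h₁ h₂ := h.sep _ _ _ _ _ _ (hE _ _ _ h₁).1 (hE _ _ _ h₂).1
  sepFl l' f w hw w' hw' hc := by
    rcases List.mem_cons.1 hw' with rfl | hw'
    · exact (hE _ _ _ hw).2 (h.sep _ _ _ _ _ _ (hE _ _ _ hw).1 hv hc)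
    · exact h.sepFl _ _ _ (hE _ _ _ hw).1 w' hw' hc
  sepFlFl := List.pairwise_cons.2 ⟨h.sepFl _ _ _ hv, h.sepFlFl⟩

/-- Hold an additional reference. -/
theorem add {v : Val} (h : Inv W E fl) (ok : W.Ok W.top v)
    (hE : ∀ l f w, E l f w → ¬ W.Conf w v) (hfl : ∀ w ∈ fl, ¬ W.Conf v w) :
    Inv W E (v :: fl) where
  ok := h.ok
  okFl w hw := by
    rcases List.mem_cons.1 hw with rfl | hw
    · exact ok
    · exact h.okFl w hw
  sep := h.sep
  sepFl l' f w hw w' hw' := by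
    rcases List.mem_cons.1 hw' with rfl | hw'
    · exact hE _ _ _ hw
    · exact h.sepFl _ _ _ hw w' hw'
  sepFlFl := List.pairwise_cons.2 ⟨hfl, h.sepFlFl⟩

/-- Store a reference that is held by the newest frame. -/
theorem put {l : Loc} {f : Name} {v : Val} (h : Inv W E (v :: fl)) (ok : W.Ok l v)
    (hE : ∀ l' g w, E' l' g w → (¬ (l' = l ∧ g = f) ∧ E l' g w) ∨ (l' = l ∧ g = f ∧ w = v)) :
    Inv W E' fl where
  ok l' g w hw := by
    rcases hE _ _ _ hw with ⟨-, h'⟩ | ⟨rfl, rfl, rfl⟩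
    · exact h.ok _ _ _ h'
    · exact ok
  okFl w hw := h.okFl w (List.mem_cons_of_mem _ hw)
  sep l₁ f₁ v₁ l₂ f₂ v₂ h₁ h₂ hc := by
    rcases hE _ _ _ h₁ with ⟨-, h₁⟩ | ⟨rfl, rfl, rfl⟩ <;>
      rcases hE _ _ _ h₂ with ⟨-, h₂⟩ | ⟨rfl, rfl, rfl⟩
    · exact h.sep _ _ _ _ _ _ h₁ h₂ hc
    · exact (h.sepFl _ _ _ h₁ _ (by simp) hc).elim
    · exact (h.sepFl _ _ _ h₂ _ (by simp) hc.symm).elim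
    · exact ⟨rfl, rfl⟩
  sepFl l' g w hw w' hw' hc := by
    rcases hE _ _ _ hw with ⟨-, h'⟩ | ⟨rfl, rfl, rfl⟩
    · exact h.sepFl _ _ _ h' w' (List.mem_cons_of_mem _ hw') hc
    · exact (List.pairwise_cons.1 h.sepFlFl).1 _ hw' hc
  sepFlFl := (List.pairwise_cons.1 h.sepFlFl).2

/-- Iterates `put` over distinct slots that are empty beforehand: the fields of a new object, or
newly bound variables. -/
theorem putAll {l : Loc} {ns : List Name} {vs : List Val} (h : Inv W E (vs ++ fl))
    (hns : ns.Nodup) (ok : ∀ v ∈ vs, W.Ok l v) (hl : ∀ f ∈ ns, ∀ w, ¬ E l f w)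
    (hE : ∀ l' g w, E' l' g w → E l' g w ∨ (l' = l ∧ (g, w) ∈ ns.zip vs)) :
    Inv W E' fl := by
  induction ns generalizing vs E with
  | nil =>
    refine h.mono (fun l' g w hw => ?_) (List.sublist_append_right vs fl).subperm
    simpa using hE _ _ _ hw
  | cons n ns ih =>
    cases vs with
    | nil => exact h.mono (fun l' g w hw => by simpa using hE _ _ _ hw) (List.Subperm.refl _)
    | cons v vs =>
      rw [List.nodup_cons] at hns
      refine ih (E := fun l' g w => E l' g w ∨ (l' = l ∧ g = n ∧ w = v)) (vs := vs) ?_ hns.2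
        (fun w hw => ok w (List.mem_cons_of_mem _ hw)) ?_ ?_
      · refine put (E := E) (f := n) h (ok v (by simp)) fun l' g w hw => ?_
        rcases hw with hw | hw
        · exact .inl ⟨fun ⟨h₁, h₂⟩ => hl n (by simp) w (h₁ ▸ h₂ ▸ hw), hw⟩
        · exact .inr hw
      · rintro f hf w (hw | ⟨-, rfl, -⟩)
        · exact hl f (List.mem_cons_of_mem _ hf) w hw
        · exact hns.1 hf
      · intro l' g w hw
        rcases hE _ _ _ hw with hw | ⟨hl', hw⟩
        · exact .inl (.inl hw)
        · simp only [List.zip_cons_cons, List.mem_cons, Prod.mk.injEq] at hw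
          rcases hw with hw | hw
          · exact .inl (.inr ⟨hl', hw⟩)
          · exact .inr ⟨hl', hw⟩

/-- Exchange a stored reference with one that is held by the newest frame. -/
theorem exchange {l : Loc} {f : Name} {v v' : Val} (h : Inv W E (v :: fl)) (hv' : E l f v')
    (ok : W.Ok l v) (ok' : W.Ok W.top v')
    (hE : ∀ l' g w, E' l' g w → (¬ (l' = l ∧ g = f) ∧ E l' g w) ∨ (l' = l ∧ g = f ∧ w = v)) :
    Inv W E' (v' :: fl) := by
  have h₁ : Inv W (fun l' g w => ¬ (l' = l ∧ g = f) ∧ E l' g w) (v' :: v :: fl) :=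
    h.take hv' ok' fun l' f w hw => ⟨hw.2, hw.1⟩
  refine (h₁.mono (fun _ _ _ => id) (List.Perm.swap v' v fl).subperm).put (l := l) (f := f) ok
    fun l' g w hw => ?_
  rcases hE _ _ _ hw with h₂ | h₂
  · exact .inl ⟨h₂.1, h₂⟩
  · exact .inr h₂

/-- Replace an `iso` reference by an `iso` reference into the same region. -/
theorem retarget {l : Loc} {f : Name} {v v' : Val} (h : Inv W E fl) (hv : E l f v)
    (hc : v.cap = .iso) (hc' : v'.cap = .iso) (hl : (W.loc v'.oid).rid = (W.loc v.oid).rid)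
    (hh : (W.loc v'.oid).IsHeap)
    (hE : ∀ l' g w, E' l' g w → (¬ (l' = l ∧ g = f) ∧ E l' g w) ∨ (l' = l ∧ g = f ∧ w = v')) :
    Inv W E' fl := by
  -- A conflict between `iso` references depends only on their target regions, so `v'` inherits
  -- exactly those of `v`. A conflict with a `var` reference would need a temporary target, which is
  -- excluded here.
  have hvar : ∀ {w : Val}, (w.cap = .var → (W.loc w.oid).IsTemp) → w.cap = .var →
      w.oid ≠ v'.oid := fun h₁ h₂ h₃ => hh.not_isTemp (h₃ ▸ h₁ h₂)
  refine h.map id (fun w w' => (w' = w ∧ (w.cap = .var → (W.loc w.oid).IsTemp)) ∨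
    (w = v ∧ w' = v')) ?_ ?_ ?_
  · rintro v₁ v₁' v₂ v₂' (⟨rfl, h₁⟩ | ⟨rfl, rfl⟩) (⟨rfl, h₂⟩ | ⟨rfl, rfl⟩) <;>
      simp only [World.Conf, hc, hc', hl] <;> grind
  · intro l' g w hw
    rcases hE _ _ _ hw with ⟨-, h'⟩ | ⟨rfl, rfl, rfl⟩
    · exact ⟨h.ok _ _ _ h', l', w, rfl, h', .inl ⟨rfl, (h.ok _ _ _ h').isTemp_of_var⟩⟩
    · refine ⟨?_, l', v, rfl, hv, .inr ⟨rfl, rfl⟩⟩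
      have := h.ok _ _ _ hv
      simp only [World.Ok, World.CapOk, hc, hc', hl] at this ⊢
      exact ⟨this.1, this.2.1, this.2.2.1, hh⟩
  · rw [List.forall₂_same]
    exact fun w hw => ⟨.inl ⟨rfl, (h.okFl w hw).isTemp_of_var⟩, h.okFl w hw⟩

end Inv

/-! Configurations -/

/-- The value `v` is stored in field or variable `f` of the object or frame at `l`. -/
def RCfg.Edge (c : RCfg) (l : Loc) (f : Name) (v : Val) : Prop :=
  ∃ F, c.FieldsAt F l ∧ F.Has f v

/-- The world of a configuration. -/
def RCfg.world (c : RCfg) (loc : Oid → Loc) : World :=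
  ⟨c.stack.map Frame.rid, c.hcl.dom, c.hfr.dom, loc⟩

/-- Well-typed configurations with a location function in place of uniqueness of locations. -/
structure WT (CT : ClassTable) (Γs : DynCtx) (Δ : OidCtx) (loc : Oid → Loc) (c : RCfg) :
    Prop where
  frames : List.Forall₂ (fun (L : Layer) (fr : Frame) => VarsTy Δ L.ctx fr.vars) Γs c.stack
  objs : ∀ l o ι, l.oid = some ι → c.ObjAt o l → ObjTy CT Δ ι o
  dom : ∀ ι, (Δ ι).isSome → ∃ l o, l.oid = some ι ∧ c.ObjAt o l
  locs : ∀ l o ι, l.oid = some ι → c.ObjAt o l → loc ι = l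
  rids : (c.stack.map Frame.rid).Nodup
  opened : ∀ r, r ∈ c.stack.map Frame.rid ↔ (c.hop r).isSome
  disjoint₁ : ∀ r, (c.hop r).isSome → c.hcl r = none
  disjoint₂ : ∀ r, (c.hop r).isSome → c.hfr r = none
  disjoint₃ : ∀ r, (c.hcl r).isSome → c.hfr r = none

theorem RCfg.stored_iff {c : RCfg} {ι : Oid} :
    c.Stored ι ↔ ∃ l o, l.oid = some ι ∧ c.ObjAt o l := by
  constructor
  · rintro (⟨fr, hfr, h⟩ | ⟨H, hH, o, r, S, h₁, h₂⟩)
    · obtain ⟨o, ho⟩ := Option.isSome_iff_exists.1 h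
      exact ⟨.temp fr.rid ι, o, rfl, fr, hfr, rfl, ho⟩
    · exact ⟨.heap r ι, o, rfl, H, hH, S, h₁, h₂⟩
  · rintro ⟨l, o, hl, ho⟩
    cases l with
    | root => cases hl
    | temp r ι' =>
      cases hl
      obtain ⟨fr, hfr, -, h⟩ := ho
      exact .inl ⟨fr, hfr, by simp [h]⟩
    | heap r ι' =>
      cases hl
      obtain ⟨H, hH, S, h₁, h₂⟩ := ho
      exact .inr ⟨H, hH, o, r, S, h₁, h₂⟩

theorem disjoint_dom_iff {H H' : Heap} :
    Disjoint H.dom H'.dom ↔ ∀ r, (H r).isSome → H' r = none := by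
  rw [Set.disjoint_left]
  simp [Heap.dom]

theorem RCfg.hasLoc_of_oid {c : RCfg} {l : Loc} {ι : Oid} (h : l.oid = some ι) :
    c.HasLoc l ↔ ∃ o, c.ObjAt o l := by
  cases l with
  | root => cases h
  | _ => rfl

theorem RCfgTy.wt {CT : ClassTable} {Γs : DynCtx} {Δ : OidCtx} {Ψ : Set Reg} {c : RCfg}
    (h : RCfgTy CT Γs Δ Ψ c) : ∃ loc, WT CT Γs Δ loc c := by
  classical
  -- The default `.root 0` plays no role: only the locations of stored objects are ever constrained.
  refine ⟨fun ι => if h : ∃ l o, l.oid = some ι ∧ c.ObjAt o l then h.choose else .root 0,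
    h.frames, h.objs, fun ι hι => RCfg.stored_iff.1 (h.dom ι hι), ?_, h.rids,
    fun r => Set.ext_iff.1 h.opened r, disjoint_dom_iff.1 h.disjoint₁,
    disjoint_dom_iff.1 h.disjoint₂, disjoint_dom_iff.1 h.disjoint₃⟩
  intro l o ι hl ho
  have hex : ∃ l o, l.oid = some ι ∧ c.ObjAt o l := ⟨l, o, hl, ho⟩
  obtain ⟨o', ho'⟩ := hex.choose_spec
  simp only [dif_pos hex]
  exact h.unique _ _ o' o (ho'.1.trans hl.symm) ho'.2 ho

theorem WT.rcfgTy {CT : ClassTable} {Γs : DynCtx} {Δ : OidCtx} {loc : Oid → Loc} {c : RCfg}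
    (h : WT CT Γs Δ loc c) : ∃ Ψ, RCfgTy CT Γs Δ Ψ c := by
  refine ⟨_, h.frames, h.objs, fun ι hι => RCfg.stored_iff.2 (h.dom ι hι), ?_, h.rids,
    Set.ext h.opened, disjoint_dom_iff.2 h.disjoint₁,
    disjoint_dom_iff.2 h.disjoint₂, disjoint_dom_iff.2 h.disjoint₃, rfl⟩
  intro l l' o o' hl ho ho'
  cases hι : l.oid with
  | none => cases l <;> first | exact ho.elim | cases hι
  | some ι => rw [← h.locs l o ι hι ho, ← h.locs l' o' ι (hl ▸ hι) ho']

/-! ### Slots, objects and references of well-typed configurations -/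

namespace WT

variable {CT : ClassTable} {Γs : DynCtx} {Δ : OidCtx} {loc : Oid → Loc} {c : RCfg}

theorem world_wf (h : WT CT Γs Δ loc c) : (c.world loc).WF where
  nodup := h.rids
  not_cl r hr := by
    have := h.disjoint₁ r ((h.opened r).1 hr)
    simp [RCfg.world, Heap.dom, this]
  not_fr r hr := by
    have := h.disjoint₂ r ((h.opened r).1 hr)
    simp [RCfg.world, Heap.dom, this]
  cl_fr r hr := by
    have := h.disjoint₃ r hr
    simp [RCfg.world, Heap.dom, this]

theorem frame_inj (h : WT CT Γs Δ loc c) {fr fr' : Frame} (h₁ : fr ∈ c.stack)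
    (h₂ : fr' ∈ c.stack) (hr : fr.rid = fr'.rid) : fr = fr' :=
  List.inj_on_of_nodup_map h.rids h₁ h₂ hr

theorem objAt_inj (h : WT CT Γs Δ loc c) {l : Loc} {o o' : Obj} (h₁ : c.ObjAt o l)
    (h₂ : c.ObjAt o' l) : o = o' := by
  cases l with
  | root => exact h₁.elim
  | temp r ι =>
    obtain ⟨fr, hfr, hr, ho⟩ := h₁
    obtain ⟨fr', hfr', hr', ho'⟩ := h₂
    obtain rfl := h.frame_inj hfr hfr' (hr.trans hr'.symm)
    simpa [ho] using ho'
  | heap r ι =>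
    obtain ⟨H, hH, S, hS, ho⟩ := h₁
    obtain ⟨H', hH', S', hS', ho'⟩ := h₂
    have d₁ := h.disjoint₁ r
    have d₂ := h.disjoint₂ r
    have d₃ := h.disjoint₃ r
    have : S = S' := by
      simp only [List.mem_cons, List.not_mem_nil, or_false] at hH hH'
      rcases hH with rfl | rfl | rfl <;> rcases hH' with rfl | rfl | rfl <;> simp_all
    subst this
    simpa [ho] using ho'

/-- Allows references to be identified with their slots, which is all that `Inv.sep` compares. -/
theorem edge_inj (h : WT CT Γs Δ loc c) {l : Loc} {f : Name} {v w : Val} (h₁ : c.Edge l f v)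
    (h₂ : c.Edge l f w) : v = w := by
  obtain ⟨F, hF, hv⟩ := h₁
  obtain ⟨F', hF', hw⟩ := h₂
  cases l with
  | root r =>
    obtain ⟨fr, hfr, hr, rfl⟩ := hF
    obtain ⟨fr', hfr', hr', rfl⟩ := hF'
    obtain rfl := h.frame_inj hfr hfr' (hr.trans hr'.symm)
    exact hv.eq hw
  | temp r ι =>
    obtain ⟨o, ho, rfl⟩ := hF
    obtain ⟨o', ho', rfl⟩ := hF'
    obtain rfl := h.objAt_inj ho ho'
    exact hv.eq hw
  | heap r ι =>
    obtain ⟨o, ho, rfl⟩ := hF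
    obtain ⟨o', ho', rfl⟩ := hF'
    obtain rfl := h.objAt_inj ho ho'
    exact hv.eq hw

theorem dom_iff (h : WT CT Γs Δ loc c) {ι : Oid} : (Δ ι).isSome ↔ c.Stored ι := by
  refine ⟨fun hι => RCfg.stored_iff.2 (h.dom ι hι), fun hι => ?_⟩
  obtain ⟨l, o, hl, ho⟩ := RCfg.stored_iff.1 hι
  obtain ⟨CL, hCL, -⟩ := h.objs l o ι hl ho
  simp [hCL]

theorem dom_loc (h : WT CT Γs Δ loc c) {ι : Oid} (hι : (Δ ι).isSome) :
    (loc ι).oid = some ι ∧ ∃ o, c.ObjAt o (loc ι) := by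
  obtain ⟨l, o, hl, ho⟩ := h.dom ι hι
  rw [h.locs l o ι hl ho]
  exact ⟨hl, o, ho⟩

/-- Every binding lies in a frame or an object, and both are typed under `Δ`; hence there are no
dangling references. -/
theorem edge_dom (h : WT CT Γs Δ loc c) {l : Loc} {f : Name} {v : Val} (he : c.Edge l f v) :
    (Δ v.oid).isSome := by
  obtain ⟨F, hF, hv⟩ := he
  have key : ∃ Γ, VarsTy Δ Γ F := by
    cases l with
    | root r =>
      obtain ⟨fr, hfr, -, rfl⟩ := hF
      obtain ⟨i, rfl⟩ := List.get_of_mem hfr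
      have hi : i.1 < Γs.length := by rw [h.frames.length_eq]; exact i.2
      exact ⟨_, (List.forall₂_iff_get.1 h.frames).2 i hi i.2⟩
    | temp r ι =>
      obtain ⟨o, ho, rfl⟩ := hF
      obtain ⟨CL, -, -, h⟩ := h.objs _ o ι rfl ho
      exact ⟨_, h⟩
    | heap r ι =>
      obtain ⟨o, ho, rfl⟩ := hF
      obtain ⟨CL, -, -, h⟩ := h.objs _ o ι rfl ho
      exact ⟨_, h⟩
  obtain ⟨Γ, hΓ⟩ := key
  obtain ⟨t, -, CL, hCL, -⟩ := hΓ.exists_ty hv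
  simp [hCL]

/-- The object graph contains only references with an existing target. As nothing dangles, no
binding is lost, and the target vertex is the one given by `loc`. -/
theorem mem_refs (h : WT CT Γs Δ loc c) {R : Ref} :
    R ∈ c.graph.refs ↔ ∃ ι, c.Edge R.src R.field ⟨R.cap, ι⟩ ∧ R.dst = loc ι := by
  constructor
  · rintro ⟨F, ι, hF, hv, hl, hι⟩
    obtain ⟨o, ho⟩ := (RCfg.hasLoc_of_oid hι).1 hl
    exact ⟨ι, ⟨F, hF, hv⟩, (h.locs _ o ι hι ho).symm⟩
  · rintro ⟨ι, he, hd⟩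
    obtain ⟨h₁, h₂⟩ := h.dom_loc (h.edge_dom he)
    obtain ⟨F, hF, hv⟩ := he
    rw [← hd] at h₁ h₂
    exact ⟨F, ι, hF, hv, (RCfg.hasLoc_of_oid h₁).2 h₂, h₁⟩

theorem order_rids (h : WT CT Γs Δ loc c) : (order Γs c).map Entry.rid = (c.world loc).rids := by
  simp only [order, RCfg.world]
  have := h.frames
  clear h
  generalize c.stack = RS at this ⊢
  induction this with
  | nil => rfl
  | cons _ _ ih => simpa using ih

end WT

/-! ### Region order, entry points and the translation of the invariants -/

theorem Order.lt_iff {ρ : Order} {r r' : Reg} :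
    ρ.Lt r r' ↔ [r', r].Sublist (ρ.map Entry.rid) := by
  constructor
  · rintro ⟨ρ₁, ρ₂, ρ₃, a, a', rfl, rfl, rfl⟩
    have : [a', a].Sublist (ρ₁ ++ a' :: ρ₂ ++ a :: ρ₃) := by
      simp only [List.append_assoc, List.cons_append]
      refine List.sublist_append_of_sublist_right (List.Sublist.cons_cons _ ?_)
      exact List.sublist_append_of_sublist_right (List.Sublist.cons_cons _ (List.nil_sublist _))
    exact this.map Entry.rid
  · intro h
    obtain ⟨s, hs, h⟩ := List.sublist_map_iff.1 h
    match s, h with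
    | [a', a], h =>
      simp only [List.map_cons, List.map_nil, List.cons.injEq, and_true] at h
      obtain ⟨h₁, h₂⟩ := h
      obtain ⟨ρ₁, ρ₂, rfl, h₃, h₄⟩ := List.cons_sublist_iff.1 hs
      obtain ⟨ρ₁, ρ₁', rfl⟩ := List.append_of_mem h₃
      obtain ⟨ρ₂, ρ₂', rfl⟩ := List.append_of_mem (List.singleton_sublist.1 h₄)
      exact ⟨ρ₁, ρ₁' ++ ρ₂, ρ₂', a, a', by simp, h₂.symm, h₁.symm⟩

/-- The path of the entry `a` leads from the frame of the next older entry `b` into the region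
of `a`. -/
def EntryOk (loc : Oid → Loc) (E : Loc → Name → Val → Prop) (a b : Entry) : Prop :=
  ∃ k ι₁ ι₂, E (.root b.rid) a.var ⟨k, ι₁⟩ ∧ E (loc ι₁) a.field ⟨.iso, ι₂⟩ ∧
    (loc ι₂).rid = a.rid

/-- The entries `a` and `b` are adjacent. -/
def Order.Adj (ρ : Order) (a b : Entry) : Prop := ∃ ρ₁ ρ₂, ρ = ρ₁ ++ a :: b :: ρ₂

theorem Order.adj_cons {ρ : Order} {a b e : Entry} :
    Order.Adj (e :: ρ) a b ↔ (e = a ∧ ∃ ρ₂, ρ = b :: ρ₂) ∨ Order.Adj ρ a b := by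
  constructor
  · rintro ⟨_ | ⟨e', ρ₁⟩, ρ₂, h⟩
    · simp only [List.nil_append, List.cons.injEq] at h
      exact .inl ⟨h.1, ρ₂, h.2⟩
    · simp only [List.cons_append, List.cons.injEq] at h
      exact .inr ⟨ρ₁, ρ₂, h.2⟩
  · rintro (⟨rfl, ρ₂, rfl⟩ | ⟨ρ₁, ρ₂, rfl⟩)
    · exact ⟨[], ρ₂, rfl⟩
    · exact ⟨e :: ρ₁, ρ₂, rfl⟩

theorem Order.Adj.lt {ρ : Order} {a b : Entry} (h : ρ.Adj a b) :
    [a.rid, b.rid].Sublist (ρ.map Entry.rid) := by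
  obtain ⟨ρ₁, ρ₂, rfl⟩ := h
  refine Order.lt_iff.1 ⟨ρ₁, [], ρ₂, b, a, by simp, rfl, rfl⟩

theorem entrypointsOK_iff {G : Graph} {ρ : Order} :
    EntrypointsOK G ρ ↔ ∀ a b, ρ.Adj a b → ∃ (k : Cap) (l : Loc) (ι : Oid),
      (⟨.root b.rid, a.var, k, l⟩ : Ref) ∈ G.refs ∧
      (⟨l, a.field, .iso, .heap a.rid ι⟩ : Ref) ∈ G.refs := by
  induction ρ with
  | nil => simp [EntrypointsOK, Order.Adj]
  | cons e ρ ih =>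
    cases ρ with
    | nil =>
      simp only [EntrypointsOK, true_iff]
      rintro a b h
      rcases Order.adj_cons.1 h with ⟨-, ρ₂, h⟩ | ⟨ρ₁, ρ₂, h⟩
      · cases h
      · simp at h
    | cons e' ρ =>
      simp only [EntrypointsOK, ih, Order.adj_cons (e := e)]
      constructor
      · rintro ⟨h₁, h₂⟩ a b (⟨rfl, ρ₂, h⟩ | h)
        · cases h; exact h₁
        · exact h₂ a b h
      · exact fun h => ⟨h e e' (.inl ⟨rfl, ρ, rfl⟩), fun a b hab => h a b (.inr hab)⟩

/-- Well-typed configurations that satisfy the invariants, where the newest frame temporarily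
holds the values in `fl`. -/
structure OK (CT : ClassTable) (Γs : DynCtx) (Δ : OidCtx) (loc : Oid → Loc) (c : RCfg)
    (fl : List (Val × Ty)) : Prop where
  wt : WT CT Γs Δ loc c
  flTy : ∀ p ∈ fl, HasTy Δ p.1 p.2
  inv : Inv (c.world loc) c.Edge (fl.map Prod.fst)
  entry : ∀ a b, (order Γs c).Adj a b → EntryOk loc c.Edge a b

/-- The conditions on single references are read off directly. For separation, the escape clauses of
pairwise topology fail for two `iso` references into the same region that is not frozen, so the
topology forces these references to be equal. -/
theorem WT.ok {CT : ClassTable} {Γs : DynCtx} {Δ : OidCtx} {loc : Oid → Loc} {c : RCfg}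
    (h : WT CT Γs Δ loc c) (hcap : CapOK Γs c) (htop : TopOK Γs c) : OK CT Γs Δ loc c [] := by
  obtain ⟨hvar, hord, hloc, hfrz⟩ := hcap
  have hlt : ∀ r r', (order Γs c).Lt r r' ↔ (c.world loc).Lt r r' := fun r r' => by
    rw [Order.lt_iff, h.order_rids, World.Lt]
  have mem : ∀ {l f v}, c.Edge l f v → (⟨l, f, v.cap, loc v.oid⟩ : Ref) ∈ c.graph.refs :=
    fun {l f v} he => h.mem_refs.2 ⟨v.oid, he, rfl⟩
  have ok : ∀ l f v, c.Edge l f v → (c.world loc).Ok l v := by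
    intro l f v he
    have o := hord _ (mem he)
    have p := hloc _ (mem he)
    refine ⟨hfrz _ (mem he), ?_⟩
    obtain ⟨k, ι⟩ := v
    simp only [hlt, Loc.isRoot_or_isTemp] at o p
    obtain ⟨o₁, o₂, o₃, o₄, o₅, o₆⟩ := o
    obtain ⟨p₁, p₂, p₃, p₄, p₅, p₆⟩ := p
    cases k
    · exact ⟨(o₅ rfl).1, (o₅ rfl).2, p₅ rfl⟩
    · exact ⟨o₃ rfl, p₃ rfl⟩
    · exact ⟨o₁ rfl, p₁ rfl⟩
    · exact ⟨o₂ rfl, p₂ rfl⟩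
    · exact ⟨o₄ rfl, p₄ rfl⟩
    · exact ⟨o₆ rfl, p₆ rfl⟩
  have wf := h.world_wf
  -- The target of an `iso` reference is closed, strictly newer, or frozen; none of these is
  -- compatible with being an older open region, and the regions differ by the region order
  -- condition.
  have iso_not_le : ∀ l f v, c.Edge l f v → v.cap = .iso →
      ¬ (order Γs c).Le (loc v.oid).rid l.rid := by
    intro l f v he hv hle
    have o := (ok _ _ _ he).2
    rw [hv] at o
    rcases hle with hle | hle
    · rw [hlt] at hle
      rcases o.2.1 with o' | o' | o'
      · exact wf.not_cl _ hle.left o'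
      · exact hle.asymm wf.nodup o'
      · exact wf.not_fr _ hle.left o'.1
    · exact o.1 hle.symm
  refine ⟨h, by simp, ⟨ok, by simp, ?_, by simp, by simp⟩, ?_⟩
  · intro l₁ f₁ v₁ l₂ f₂ v₂ h₁ h₂ hc
    rcases hc with ⟨hv | hv, hι⟩ | ⟨hv, hw, hr, hf⟩
    · have := hvar _ (mem h₁) _ (mem h₂) hv (congrArg loc hι)
      simp only [Ref.mk.injEq] at this
      exact ⟨this.1, this.2.1⟩
    · have := hvar _ (mem h₂) _ (mem h₁) hv (congrArg loc hι.symm)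
      simp only [Ref.mk.injEq] at this
      exact ⟨this.1.symm, this.2.1.symm⟩
    · rcases htop.1 _ (mem h₁) _ (mem h₂) with h' | h' | h' | h'
      · simp only [Ref.mk.injEq] at h'
        exact ⟨h'.1, h'.2.1⟩
      · exact (h' hr).elim
      · rcases h' with h' | h'
        · exact (hf h').elim
        · exact (hf (by rw [hr]; exact h')).elim
      · rcases h' with h' | h'
        · exact (iso_not_le _ _ _ h₁ hv h').elim
        · exact (iso_not_le _ _ _ h₂ hw h').elim
  · intro a b hab
    obtain ⟨k, l, ι, h₁, h₂⟩ := entrypointsOK_iff.1 htop.2 a b hab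
    obtain ⟨ι₁, e₁, d₁⟩ := h.mem_refs.1 h₁
    obtain ⟨ι₂, e₂, d₂⟩ := h.mem_refs.1 h₂
    simp only at e₁ d₁ e₂ d₂
    subst d₁
    exact ⟨k, ι₁, ι₂, e₁, e₂, by rw [← d₂]; rfl⟩

/-- Converse of `WT.ok` once no value is held any more. Only pairs of `iso` references can violate
pairwise topology, and those are separated by `Inv.sep`. -/
theorem OK.invariants {CT : ClassTable} {Γs : DynCtx} {Δ : OidCtx} {loc : Oid → Loc} {c : RCfg}
    (h : OK CT Γs Δ loc c []) : CapOK Γs c ∧ TopOK Γs c := by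
  have hlt : ∀ r r', (order Γs c).Lt r r' ↔ (c.world loc).Lt r r' := fun r r' => by
    rw [Order.lt_iff, h.wt.order_rids, World.Lt]
  have ref : ∀ R ∈ c.graph.refs, ∃ v, R = ⟨R.src, R.field, v.cap, loc v.oid⟩ ∧
      c.Edge R.src R.field v := by
    intro R hR
    obtain ⟨ι, he, hd⟩ := h.wt.mem_refs.1 hR
    exact ⟨⟨R.cap, ι⟩, by rw [← hd], he⟩
  have slot : ∀ {l f v v'}, c.Edge l f v → c.Edge l f v' → v = v' :=
    fun {l f v v'} h₁ h₂ => h.wt.edge_inj h₁ h₂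
  have ok := h.inv.ok
  refine ⟨⟨?_, ?_, ?_, ?_⟩, ?_, ?_⟩
  · intro R₁ h₁ R₂ h₂ hk hd
    obtain ⟨v₁, e₁, he₁⟩ := ref R₁ h₁
    obtain ⟨v₂, e₂, he₂⟩ := ref R₂ h₂
    rw [e₁] at hk hd
    rw [e₂] at hd
    have hd : loc v₁.oid = loc v₂.oid := hd
    -- In the graph, uniqueness compares target vertices, while `World.Conf` compares identifiers; a
    -- vertex determines the identifier.
    have hι : v₁.oid = v₂.oid := by
      have i₁ := (h.wt.dom_loc (h.wt.edge_dom he₁)).1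
      have i₂ := (h.wt.dom_loc (h.wt.edge_dom he₂)).1
      rw [hd, i₂] at i₁
      simpa using i₁.symm
    obtain ⟨s₁, s₂⟩ := h.inv.sep _ _ _ _ _ _ he₁ he₂ (.inl ⟨.inl hk, hι⟩)
    rw [s₁, s₂] at he₁
    rw [e₁, e₂, s₁, s₂, slot he₁ he₂]
  · intro R hR
    obtain ⟨v, e, he⟩ := ref R hR
    rw [e]
    have o := (ok _ _ _ he).2
    obtain ⟨k, ι⟩ := v
    simp only [hlt]
    refine ⟨?_, ?_, ?_, ?_, ?_, ?_⟩ <;> rintro rfl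
    · exact o.1
    · exact o.1
    · exact o.1
    · exact o.1
    · exact ⟨o.1, o.2.1⟩
    · exact o.1
  · intro R hR
    obtain ⟨v, e, he⟩ := ref R hR
    rw [e]
    have o := (ok _ _ _ he).2
    obtain ⟨k, ι⟩ := v
    simp only [Loc.isRoot_or_isTemp]
    refine ⟨?_, ?_, ?_, ?_, ?_, ?_⟩ <;> rintro rfl
    · exact o.2
    · exact o.2
    · exact o.2
    · exact o.2
    · exact o.2.2
    · exact o.2
  · intro R hR
    obtain ⟨v, e, he⟩ := ref R hR
    rw [e]
    exact (ok _ _ _ he).1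
  -- Every capability except `iso` satisfies one of the escape clauses of pairwise topology by
  -- itself.
  · have key : ∀ R ∈ c.graph.refs, R.dst.rid ∈ c.hfr.dom ∨
        (order Γs c).Le R.dst.rid R.src.rid ∨ R.cap = .iso := by
      intro R hR
      obtain ⟨v, e, he⟩ := ref R hR
      rw [e]
      have o := (ok _ _ _ he).2
      obtain ⟨k, ι⟩ := v
      simp only [Order.Le, hlt]
      cases k
      · exact .inr (.inr rfl)
      · exact .inr (.inl (.inr o.1.symm))
      · exact .inr (.inl (.inr o.1.symm))
      · exact .inr (.inl (.inr o.1.symm))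
      · exact .inr (.inl (.inl o.1))
      · exact .inl o.1
    intro R₁ h₁ R₂ h₂
    by_contra! hcon
    obtain ⟨hne, hr, ⟨hf₁, hf₂⟩, hl₁, hl₂⟩ := hcon
    have hk₁ := ((key R₁ h₁).resolve_left hf₁).resolve_left hl₁
    have hk₂ := ((key R₂ h₂).resolve_left hf₂).resolve_left hl₂
    obtain ⟨v₁, e₁, he₁⟩ := ref R₁ h₁
    obtain ⟨v₂, e₂, he₂⟩ := ref R₂ h₂
    rw [e₁] at hr hf₁ hk₁
    rw [e₂] at hr hk₂
    obtain ⟨s₁, s₂⟩ := h.inv.sep _ _ _ _ _ _ he₁ he₂ (.inr ⟨hk₁, hk₂, hr, hf₁⟩)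
    rw [s₁, s₂] at he₁
    exact hne (by rw [e₁, e₂, s₁, s₂, slot he₁ he₂])
  · rw [entrypointsOK_iff]
    intro a b hab
    obtain ⟨k, ι₁, ι₂, e₁, e₂, hr⟩ := h.entry a b hab
    have o := (ok _ _ _ e₂).2
    obtain ⟨r, ι, hl⟩ := o.2.2
    simp only [RCfg.world] at hl
    rw [hl] at hr
    obtain rfl : r = a.rid := hr
    exact ⟨k, loc ι₁, ι, h.wt.mem_refs.2 ⟨ι₁, e₁, rfl⟩, h.wt.mem_refs.2 ⟨ι₂, e₂, hl.symm⟩⟩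

/-! Changes of the newest frame -/

theorem RCfg.edge_root {c : RCfg} {q : Reg} {f : Name} {v : Val} :
    c.Edge (.root q) f v ↔ ∃ fr ∈ c.stack, fr.rid = q ∧ fr.vars.Has f v := by
  constructor
  · rintro ⟨_, ⟨fr, h₁, h₂, rfl⟩, h₃⟩; exact ⟨fr, h₁, h₂, h₃⟩
  · rintro ⟨fr, h₁, h₂, h₃⟩; exact ⟨_, ⟨fr, h₁, h₂, rfl⟩, h₃⟩

theorem RCfg.edge_of_oid {c : RCfg} {l : Loc} {ι : Oid} (hl : l.oid = some ι) {f : Name}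
    {v : Val} : c.Edge l f v ↔ ∃ o, c.ObjAt o l ∧ o.fields.Has f v := by
  cases l with
  | root => cases hl
  | _ =>
    constructor
    · rintro ⟨_, ⟨o, h₁, rfl⟩, h₂⟩; exact ⟨o, h₁, h₂⟩
    · rintro ⟨o, h₁, h₂⟩; exact ⟨_, ⟨o, h₁, rfl⟩, h₂⟩

theorem RCfg.edge_congr {c c' : RCfg} (h : ∀ o l, c'.ObjAt o l ↔ c.ObjAt o l) {l : Loc}
    (hl : ¬ l.IsRoot) {f : Name} {v : Val} : c'.Edge l f v ↔ c.Edge l f v := by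
  cases l with
  | root => simp at hl
  | temp r ι => simp only [RCfg.edge_of_oid (l := .temp r ι) rfl, h]
  | heap r ι => simp only [RCfg.edge_of_oid (l := .heap r ι) rfl, h]

variable {CT : ClassTable} {Γs Γs' : DynCtx} {Γ Γ' : Ctx} {a b : Name} {Δ Δ' : OidCtx}
  {loc loc' : Oid → Loc} {c c' : RCfg} {fl fl' : List (Val × Ty)} {r : Reg} {S : Store}
  {F F' : Vars} {RS : List Frame} {hop hcl hfr : Heap}

theorem OK.perm (h : OK CT Γs Δ loc c fl) (hfl : fl'.Subperm fl) : OK CT Γs Δ loc c fl' where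
  wt := h.wt
  flTy p hp := h.flTy p (hfl.subset hp)
  inv := by
    obtain ⟨l, hl, hs⟩ := hfl
    exact h.inv.mono (fun _ _ _ => id) ⟨_, hl.map _, hs.map _⟩
  entry := h.entry

theorem OK.fl_dom (h : OK CT Γs Δ loc c fl) {v : Val} (hv : v ∈ fl.map Prod.fst) :
    (Δ v.oid).isSome := by
  obtain ⟨p, hp, rfl⟩ := List.mem_map.1 hv
  obtain ⟨CL, hCL, -⟩ := h.flTy p hp
  simp [hCL]

/-- The paths of the entries do not start in the newest frame, nor lead through its region. -/
theorem OK.entry_mono (h : OK CT Γs Δ loc c fl) {E : Loc → Name → Val → Prop}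
    (hE : ∀ l f v, c.Edge l f v → l.rid ≠ (c.world loc).top.rid → E l f v) :
    ∀ a b, (order Γs c).Adj a b → EntryOk loc E a b := by
  intro a b hab
  obtain ⟨k, ι₁, ι₂, e₁, e₂, hr⟩ := h.entry a b hab
  have wf := h.wt.world_wf
  have lt : (c.world loc).Lt b.rid a.rid := by
    have := hab.lt
    rwa [h.wt.order_rids] at this
  obtain ⟨q, L, hq⟩ : ∃ q L, (c.world loc).rids = q :: L := by
    cases hL : (c.world loc).rids with
    | nil => simp [World.Lt, hL] at lt
    | cons q L => exact ⟨q, L, rfl⟩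
  have top : (c.world loc).top.rid = q := by simp [World.top, hq]
  have o := (h.inv.ok _ _ _ e₂).2
  simp only [World.CapOk] at o
  -- The path ends in an `iso` reference into an open region, hence into a strictly newer one. So
  -- the object through which it passes lies below the region of `a`, and thus not in the newest
  -- region.
  have lt' : (c.world loc).Lt (loc ι₁).rid a.rid := by
    rcases o.2.1 with o' | o' | o'
    · exact (wf.not_cl _ lt.right (hr ▸ o')).elim
    · exact hr ▸ o'
    · exact (wf.not_fr _ lt.right (hr ▸ o'.1)).elim
  refine ⟨k, ι₁, ι₂, hE _ _ _ e₁ ?_, hE _ _ _ e₂ ?_, hr⟩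
  · rintro h'
    rw [top] at h'
    exact World.not_top_lt hq wf.nodup a.rid (h' ▸ lt)
  · rintro h'
    rw [top] at h'
    exact World.not_top_lt hq wf.nodup a.rid (h' ▸ lt')

theorem WT.top_unique (h : WT CT Γs Δ loc ⟨⟨r, S, F⟩ :: RS, hop, hcl, hfr⟩) {fr : Frame}
    (hfr : fr ∈ RS) : fr.rid ≠ r := by
  have := h.rids
  simp only [List.map_cons, List.nodup_cons] at this
  exact fun h' => this.1 (h' ▸ List.mem_map_of_mem hfr)

theorem WT.edge_top (h : WT CT Γs Δ loc ⟨⟨r, S, F⟩ :: RS, hop, hcl, hfr⟩) {f : Name} {v : Val} :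
    RCfg.Edge ⟨⟨r, S, F⟩ :: RS, hop, hcl, hfr⟩ (.root r) f v ↔ F.Has f v := by
  rw [RCfg.edge_root]
  constructor
  · rintro ⟨fr, hm, hr, hv⟩
    rcases List.mem_cons.1 hm with rfl | hm
    · exact hv
    · exact (h.top_unique hm hr).elim
  · exact fun hv => ⟨_, List.mem_cons_self, rfl, hv⟩

theorem objAt_vars (F F' : Vars) (o : Obj) (l : Loc) :
    RCfg.ObjAt ⟨⟨r, S, F'⟩ :: RS, hop, hcl, hfr⟩ o l ↔
      RCfg.ObjAt ⟨⟨r, S, F⟩ :: RS, hop, hcl, hfr⟩ o l := by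
  cases l <;> simp [RCfg.ObjAt]

theorem WT.vars (h : WT CT (⟨Γ, a, b⟩ :: Γs) Δ loc ⟨⟨r, S, F⟩ :: RS, hop, hcl, hfr⟩)
    (hF : VarsTy Δ Γ' F') :
    WT CT (⟨Γ', a, b⟩ :: Γs) Δ loc ⟨⟨r, S, F'⟩ :: RS, hop, hcl, hfr⟩ where
  frames := .cons hF (List.forall₂_cons.1 h.frames).2
  objs l o ι hl ho := h.objs l o ι hl ((objAt_vars F F' o l).1 ho)
  dom ι hι := by simpa only [objAt_vars F F'] using h.dom ι hι
  locs l o ι hl ho := h.locs l o ι hl ((objAt_vars F F' o l).1 ho)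
  rids := h.rids
  opened := h.opened
  disjoint₁ := h.disjoint₁
  disjoint₂ := h.disjoint₂
  disjoint₃ := h.disjoint₃

/-- References after a change of the variables of the newest frame. -/
theorem WT.edge_vars (h : WT CT Γs Δ loc ⟨⟨r, S, F⟩ :: RS, hop, hcl, hfr⟩) {l : Loc} {f : Name}
    {v : Val} : RCfg.Edge ⟨⟨r, S, F'⟩ :: RS, hop, hcl, hfr⟩ l f v ↔
      (l = .root r ∧ F'.Has f v) ∨
        (l ≠ .root r ∧ RCfg.Edge ⟨⟨r, S, F⟩ :: RS, hop, hcl, hfr⟩ l f v) := by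
  cases l with
  | root q =>
    simp only [RCfg.edge_root, List.mem_cons, exists_eq_or_imp, Loc.root.injEq, ne_eq]
    constructor
    · rintro (⟨rfl, hv⟩ | ⟨fr, hm, rfl, hv⟩)
      · exact .inl ⟨rfl, hv⟩
      · exact .inr ⟨h.top_unique hm, .inr ⟨fr, hm, rfl, hv⟩⟩
    · rintro (⟨rfl, hv⟩ | ⟨hq, ⟨rfl, hv⟩ | hv⟩)
      · exact .inl ⟨rfl, hv⟩
      · exact (hq rfl).elim
      · exact .inr hv
  | temp q ι => simpa using RCfg.edge_congr (objAt_vars F F') (Loc.not_isRoot_temp q ι)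
  | heap q ι => simpa using RCfg.edge_congr (objAt_vars F F') (Loc.not_isRoot_heap q ι)

/-- Entry paths start in older frames and pass through older regions, so they do not notice the
variables of the newest frame. Only the typing and the reference invariants have to be supplied. -/
theorem OK.vars (h : OK CT (⟨Γ, a, b⟩ :: Γs) Δ loc ⟨⟨r, S, F⟩ :: RS, hop, hcl, hfr⟩ fl)
    (hF : VarsTy Δ Γ' F') (hfl : ∀ p ∈ fl', HasTy Δ p.1 p.2)
    (inv : Inv (RCfg.world ⟨⟨r, S, F⟩ :: RS, hop, hcl, hfr⟩ loc)
      (fun l f v => (l = .root r ∧ F'.Has f v) ∨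
        (l ≠ .root r ∧ RCfg.Edge ⟨⟨r, S, F⟩ :: RS, hop, hcl, hfr⟩ l f v)) (fl'.map Prod.fst)) :
    OK CT (⟨Γ', a, b⟩ :: Γs) Δ loc ⟨⟨r, S, F'⟩ :: RS, hop, hcl, hfr⟩ fl' where
  wt := h.wt.vars hF
  flTy := hfl
  inv := inv.mono (fun _ _ _ he => h.wt.edge_vars.1 he) (List.Subperm.refl _)
  entry := h.entry_mono fun l f v he hl =>
    h.wt.edge_vars.2 (.inr ⟨by rintro rfl; exact hl rfl, he⟩)

theorem OK.hasTy_top (h : OK CT (⟨Γ, a, b⟩ :: Γs) Δ loc ⟨⟨r, S, F⟩ :: RS, hop, hcl, hfr⟩ fl) :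
    VarsTy Δ Γ F := (List.forall₂_cons.1 h.wt.frames).1

/-- A dropped variable loses its slot, so its value merely moves into the hand. A kept variable is
copied: anything in conflict with the copy would be in conflict with the original, hence be the
original, and a value that is neither `iso` nor `var` is not in conflict with itself. -/
theorem OK.get (h : OK CT (⟨Γ, a, b⟩ :: Γs) Δ loc ⟨⟨r, S, F⟩ :: RS, hop, hcl, hfr⟩ fl)
    {u : Use} {t : Ty} {v : Val} (hu : UseTy CT Γ u t Γ') (hg : u.get F = some (v, F')) :
    OK CT (⟨Γ', a, b⟩ :: Γs) Δ loc ⟨⟨r, S, F'⟩ :: RS, hop, hcl, hfr⟩ ((v, t) :: fl) := by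
  obtain ⟨hv, hF'⟩ := hu.get h.hasTy_top hg
  refine h.vars hF' (List.forall_mem_cons.2 ⟨hv, h.flTy⟩) ?_
  obtain ⟨z, hz, hcase⟩ := Use.get_cases hg
  have he := (h.wt.edge_top (f := z) (v := v)).2 hz
  rcases hcase with ⟨rfl, h₁, h₂⟩ | rfl
  · refine Inv.mono (E := RCfg.Edge ⟨⟨r, S, F'⟩ :: RS, hop, hcl, hfr⟩)
      (fl := v :: fl.map Prod.fst) ?_ ?_ (List.Subperm.refl _)
    · refine h.inv.add (h.inv.ok _ _ _ he) (fun l f w hw hc => ?_)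
        (fun w hw => h.inv.sepFl _ _ _ he w hw)
      obtain ⟨rfl, rfl⟩ := h.inv.sep _ _ _ _ _ _ hw he hc
      obtain rfl := h.wt.edge_inj hw he
      simp [World.Conf, h₁, h₂] at hc
    · rintro l f w (⟨rfl, hw⟩ | ⟨-, hw⟩)
      · exact h.wt.edge_top.2 hw
      · exact hw
  · refine h.inv.take he (h.inv.ok _ _ _ he) ?_
    rintro l f w (⟨rfl, hw⟩ | ⟨hl, hw⟩)
    · have hf : f ≠ z := by
        rintro rfl
        simp [Vars.Has] at hw
      exact ⟨h.wt.edge_top.2 (by simpa [Vars.Has, hf] using hw), fun h' => hf h'.2⟩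
    · exact ⟨hw, fun h' => hl h'.1⟩

theorem getAll_length {us : List Use} {vs : List Val} (hg : getAll us F = some (vs, F')) :
    vs.length = us.length := by
  induction us generalizing F vs with
  | nil => cases hg; rfl
  | cons u us ih =>
    simp only [getAll, Option.bind_eq_some_iff, Option.map_eq_some_iff] at hg
    obtain ⟨⟨v, F₁⟩, h₁, ⟨ws, F₂⟩, h₂, h₃⟩ := hg
    cases h₃
    simp [ih h₂]

theorem UsesTy.length {us : List Use} {ts : List Ty} (h : UsesTy CT Γ us ts Γ') :
    us.length = ts.length := by
  induction h with
  | nil => rfl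
  | cons _ _ ih => simp [ih]

theorem OK.getAll (h : OK CT (⟨Γ, a, b⟩ :: Γs) Δ loc ⟨⟨r, S, F⟩ :: RS, hop, hcl, hfr⟩ fl)
    {us : List Use} {ts : List Ty} {vs : List Val} (hu : UsesTy CT Γ us ts Γ')
    (hg : getAll us F = some (vs, F')) :
    OK CT (⟨Γ', a, b⟩ :: Γs) Δ loc ⟨⟨r, S, F'⟩ :: RS, hop, hcl, hfr⟩ (vs.zip ts ++ fl) := by
  induction hu generalizing F vs fl with
  | nil => cases hg; exact h
  | cons h₁ _ ih =>
    simp only [Reggio.getAll, Option.bind_eq_some_iff, Option.map_eq_some_iff] at hg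
    obtain ⟨⟨v, F₁⟩, g₁, ⟨ws, F₂⟩, g₂, g₃⟩ := hg
    cases g₃
    -- The recursion leaves the first value behind the later ones; the order of held values is
    -- immaterial.
    exact (ih (h.get h₁ g₁) g₂).perm (by simpa using List.perm_middle.symm.subperm)

theorem map_fst_zip_append {vs : List Val} {ts : List Ty} (h : vs.length = ts.length) :
    (vs.zip ts ++ fl).map Prod.fst = vs ++ fl.map Prod.fst := by
  rw [List.map_append, List.map_fst_zip h.le]

theorem forall₂_of_zip {vs : List Val} {ts : List Ty} (h : vs.length = ts.length)
    (hty : ∀ p ∈ vs.zip ts, HasTy Δ p.1 p.2) : List.Forall₂ (HasTy Δ) vs ts :=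
  List.forall₂_iff_zip.2 ⟨h, fun hp => hty _ hp⟩

/-- Counterpart of `OK.getAll`. The names are unused in the frame, so no reference is overwritten,
and a held value already satisfies the conditions for a variable. -/
theorem OK.bindAll {vs : List Val} {ts : List Ty} {xs : List Name}
    (h : OK CT (⟨Γ, a, b⟩ :: Γs) Δ loc ⟨⟨r, S, F⟩ :: RS, hop, hcl, hfr⟩ (vs.zip ts ++ fl))
    (hlen : vs.length = ts.length) (hxs : xs.Nodup) (hF : ∀ x ∈ xs, F x = none) :
    OK CT (⟨Γ.setAll xs ts, a, b⟩ :: Γs) Δ loc ⟨⟨r, S, F.setAll xs vs⟩ :: RS, hop, hcl, hfr⟩ fl := by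
  have hinv := h.inv
  rw [map_fst_zip_append hlen] at hinv
  refine h.vars (h.hasTy_top.setAll
    (forall₂_of_zip hlen fun p hp => h.flTy p (List.mem_append_left _ hp)))
    (fun p hp => h.flTy p (List.mem_append_right _ hp)) ?_
  refine hinv.putAll (l := .root r) hxs (fun v hv => hinv.okFl v (List.mem_append_left _ hv)) ?_ ?_
  · intro f hf w hw
    rw [h.wt.edge_top, Vars.Has, hF f hf] at hw
    cases hw
  · rintro l g w (⟨rfl, hw⟩ | ⟨-, hw⟩)
    · exact (Vars.has_setAll hw).imp h.wt.edge_top.2 (⟨rfl, ·⟩)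
    · exact .inl hw

theorem OK.bind {v : Val} {t : Ty} {x : Name}
    (h : OK CT (⟨Γ, a, b⟩ :: Γs) Δ loc ⟨⟨r, S, F⟩ :: RS, hop, hcl, hfr⟩ ((v, t) :: fl))
    (hF : F x = none) :
    OK CT (⟨Γ.set x t, a, b⟩ :: Γs) Δ loc ⟨⟨r, S, F.set x v⟩ :: RS, hop, hcl, hfr⟩ fl :=
  OK.bindAll (vs := [v]) (ts := [t]) (xs := [x]) h rfl (by simp) (by simpa using hF)

/-- Forget how a held value is typed. -/
theorem OK.retype {v : Val} {t t' : Ty} (h : OK CT Γs Δ loc c ((v, t) :: fl))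
    (ht : HasTy Δ v t') : OK CT Γs Δ loc c ((v, t') :: fl) where
  wt := h.wt
  flTy := List.forall_mem_cons.2 ⟨ht, (List.forall_mem_cons.1 h.flTy).2⟩
  inv := h.inv
  entry := h.entry

/-- Hold a copy of a reference with a capability that is neither `iso` nor `var`. -/
theorem OK.add {v : Val} {t : Ty} (h : OK CT Γs Δ loc c fl) (ht : HasTy Δ v t)
    (ok : (c.world loc).Ok (c.world loc).top v) (h₁ : v.cap ≠ .iso) (h₂ : v.cap ≠ .var)
    (hE : ∀ l f w, c.Edge l f w → w.oid = v.oid → w.cap ≠ .var)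
    (hfl : ∀ w ∈ fl.map Prod.fst, w.oid = v.oid → w.cap ≠ .var) :
    OK CT Γs Δ loc c ((v, t) :: fl) where
  wt := h.wt
  flTy := List.forall_mem_cons.2 ⟨ht, h.flTy⟩
  inv := by
    refine h.inv.add ok (fun l f w hw hc => ?_) (fun w hw hc => ?_)
    · simp only [World.Conf, h₁, h₂, or_false, false_and, and_false] at hc
      exact hE l f w hw hc.2 hc.1
    · simp only [World.Conf, h₁, h₂, or_false, false_or, false_and] at hc
      exact hfl w hw hc.2.symm hc.1
  entry := h.entry

/-! ### Looking up objects, and loading -/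

theorem stackLoad_objAt {ι : Oid} {o : Obj} (h : stackLoad c.stack ι = some o) :
    ∃ q, c.ObjAt o (.temp q ι) := by
  obtain ⟨fr, hm, ho⟩ := List.exists_of_findSome?_eq_some h
  exact ⟨fr.rid, fr, hm, rfl, ho⟩

theorem CfgLoad.objAt {Hs : List Heap} {ι : Oid} {o : Obj} (h : CfgLoad c.stack Hs ι o)
    (hHs : ∀ H ∈ Hs, H ∈ [c.hop, c.hcl, c.hfr]) : ∃ l, l.oid = some ι ∧ c.ObjAt o l := by
  rcases h with h | ⟨-, H, hH, q, S, h₁, h₂⟩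
  · obtain ⟨q, h⟩ := stackLoad_objAt h
    exact ⟨_, rfl, h⟩
  · exact ⟨.heap q ι, rfl, H, hHs H hH, S, h₁, h₂⟩

/-- Viewpoint adaptation composes references. -/
theorem World.Ok.vpa {W : World} (hW : W.rids.Nodup) {l l' : Loc} {k k' k'' : Cap} {ι ι' : Oid}
    (hl : l.IsRoot) (hl' : W.loc ι = l') (hn : ¬ l'.IsRoot) (h : W.Ok l ⟨k, ι⟩)
    (h' : W.Ok l' ⟨k', ι'⟩) (hk : k.vpa k' = some k'') : W.Ok l ⟨k'', ι'⟩ := by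
  obtain ⟨hf, h⟩ := h
  obtain ⟨hf', h'⟩ := h'
  subst hl'
  refine ⟨fun hfr => hf' (hf hfr), ?_⟩
  have hlh : ¬ l.IsHeap := fun h => h.not_isRoot hl
  have e₁ := @Loc.IsTemp.not_isHeap
  have e₂ := @Loc.IsHeap.not_isRoot
  have e₃ := @Loc.IsTemp.not_isRoot
  have e₄ := @World.Lt.trans W hW
  -- Through `imm`, the field's object is frozen and deep freeze makes its target frozen; a `tmp` or
  -- `paused` field cannot occur there, since these do not start on the heap. Two `paused`
  -- references compose by transitivity of the order. The entry for `paused` and `var` cannot arise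
  -- from a field, as `var` references start at roots.
  cases k <;> cases k' <;> simp only [Cap.vpa, Option.some.injEq, reduceCtorEq] at hk <;>
    subst hk <;> simp only [World.CapOk] at h h' hf hf' ⊢ <;> grind

/-- An adapted capability is never `iso` or `var`. The copy could only conflict with a `var`
reference to the same target, but that would coincide with the field that is read, and `var`
references are not stored in objects. -/
theorem OK.load (h : OK CT (⟨Γ, a, b⟩ :: Γs) Δ loc ⟨⟨r, S, F⟩ :: RS, hop, hcl, hfr⟩ [])
    {y f : Name} {ky kf k : Cap} {ιy ιf : Oid} {o : Obj} {CL : STy} {t t' : Ty}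
    (hy : F.Has y ⟨ky, ιy⟩) (ho : CfgLoad (⟨r, S, F⟩ :: RS) [hop, hfr] ιy o)
    (hf : o.fields.Has f ⟨kf, ιf⟩) (hk : ky.vpa kf = some k) {k' : Cap}
    (hΓ : Γ.Has y (CL.ty k')) (ht : CT.ftype CL f = some t) (ht' : t.vpa k' = some t') :
    OK CT (⟨Γ, a, b⟩ :: Γs) Δ loc ⟨⟨r, S, F⟩ :: RS, hop, hcl, hfr⟩ [(⟨k, ιf⟩, t')] := by
  obtain ⟨l, hl, hol⟩ := CfgLoad.objAt (c := ⟨⟨r, S, F⟩ :: RS, hop, hcl, hfr⟩) ho (by simp)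
  obtain ⟨CL₀, hCL₀, hs⟩ := h.hasTy_top.hasTy hΓ hy
  obtain ⟨rfl, heq⟩ := hs.sty_sty
  obtain ⟨CL₁, hCL₁, -, hof⟩ := h.wt.objs l o ιy hl hol
  obtain rfl : CL₀ = CL₁ := by simpa using hCL₀.symm.trans hCL₁
  obtain ⟨t₀, ht₀, -, hsub⟩ := heq.ftype ht
  have hft : HasTy Δ ⟨kf, ιf⟩ t := (hof.hasTy (show CT.ctxOf CL₀ f = _ by
    simp [ClassTable.ctxOf, ht₀]) hf).sub hsub
  obtain ⟨CLf, hCLf, hsf⟩ := hft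
  obtain ⟨k'', hk'', hsf'⟩ := hsf.vpa ht'
  obtain rfl : k = k'' := by simpa using hk.symm.trans hk''
  have e₁ := h.wt.edge_top.2 hy
  have e₂ : RCfg.Edge ⟨⟨r, S, F⟩ :: RS, hop, hcl, hfr⟩ l f ⟨kf, ιf⟩ :=
    (RCfg.edge_of_oid hl).2 ⟨o, hol, hf⟩
  have hln : ¬ l.IsRoot := by rintro ⟨q, rfl⟩; cases hl
  refine h.add ⟨CLf, hCLf, hsf'⟩ ?_ ?_ ?_ ?_ (by simp)
  · exact World.Ok.vpa h.wt.world_wf.nodup ⟨r, rfl⟩ (h.wt.locs l o ιy hl hol) hln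
      (h.inv.ok _ _ _ e₁) (h.inv.ok _ _ _ e₂) hk
  · rintro rfl
    cases ky <;> cases kf <;> simp [Cap.vpa] at hk
  · rintro rfl
    cases ky <;> cases kf <;> simp [Cap.vpa] at hk
  · rintro l' g w hw hι hc
    obtain ⟨rfl, rfl⟩ := h.inv.sep _ _ _ _ _ _ hw e₂ (.inl ⟨.inl hc, hι⟩)
    have := (h.inv.ok _ _ _ hw).2
    rw [hc] at this
    exact hln this.2.1

/-! Changes of a single object -/

/-- The configuration `c'` arises from `c` by storing the object `o` at `l`, possibly in a new
closed region. -/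
structure RCfg.Put (c c' : RCfg) (l : Loc) (o : Obj) : Prop where
  objAt : ∀ o' l', c'.ObjAt o' l' ↔ (l' ≠ l ∧ c.ObjAt o' l') ∨ (l' = l ∧ o' = o)
  frames : c'.stack.map (fun fr => (fr.rid, fr.vars)) = c.stack.map fun fr => (fr.rid, fr.vars)
  hop : ∀ r, (c'.hop r).isSome = (c.hop r).isSome
  hcl : ∀ r, (c.hcl r).isSome → (c'.hcl r).isSome
  hcl_inv : ∀ r, (c'.hcl r).isSome → (c.hcl r).isSome ∨ (c.hop r = none ∧ c.hfr r = none)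
  hfr : c'.hfr = c.hfr

variable {l : Loc} {o : Obj} {ι : Oid}

namespace RCfg.Put

theorem rids (h : c.Put c' l o) : c'.stack.map Frame.rid = c.stack.map Frame.rid := by
  simpa [List.map_map, Function.comp_def] using congrArg (List.map Prod.fst) h.frames

theorem vars (h : c.Put c' l o) : c'.stack.map Frame.vars = c.stack.map Frame.vars := by
  simpa [List.map_map, Function.comp_def] using congrArg (List.map Prod.snd) h.frames

theorem edge_root (h : c.Put c' l o) {q : Reg} {f : Name} {v : Val} :
    c'.Edge (.root q) f v ↔ c.Edge (.root q) f v := by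
  have key : ∀ c : RCfg, c.Edge (.root q) f v ↔
      ∃ p ∈ c.stack.map (fun fr => (fr.rid, fr.vars)), p.1 = q ∧ p.2.Has f v := fun c => by
    rw [RCfg.edge_root]; simp
  rw [key, key, h.frames]

theorem edge_ne (h : c.Put c' l o) {l' : Loc} (hl : l' ≠ l) {f : Name} {v : Val} :
    c'.Edge l' f v ↔ c.Edge l' f v := by
  cases l' with
  | root q => exact h.edge_root
  | temp q ι => simp [RCfg.edge_of_oid (l := .temp q ι) rfl, h.objAt, hl]
  | heap q ι => simp [RCfg.edge_of_oid (l := .heap q ι) rfl, h.objAt, hl]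

theorem edge_self (h : c.Put c' l o) (hl : l.oid = some ι) {f : Name} {v : Val} :
    c'.Edge l f v ↔ o.fields.Has f v := by
  simp [RCfg.edge_of_oid hl, h.objAt]

/-- References after writing a field of an existing object. -/
theorem edge_set {f : Name} {v : Val} (h : c.Put c' l (o.set f v)) (hc : WT CT Γs Δ loc c)
    (hl : l.oid = some ι) (ho : c.ObjAt o l) {l' : Loc} {g : Name} {w : Val} :
    c'.Edge l' g w ↔ (¬ (l' = l ∧ g = f) ∧ c.Edge l' g w) ∨ (l' = l ∧ g = f ∧ w = v) := by
  rcases eq_or_ne l' l with rfl | hne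
  · have he : c.Edge l' g w ↔ o.fields.Has g w := by
      rw [RCfg.edge_of_oid hl]
      exact ⟨fun ⟨o', h₁, h₂⟩ => hc.objAt_inj h₁ ho ▸ h₂, fun h => ⟨o, ho, h⟩⟩
    rw [h.edge_self hl, he, Obj.set, Vars.has_set]
    simp [or_comm]
  · simp [h.edge_ne hne, hne]

theorem hcl_eq_none (h : c.Put c' l o) {q : Reg} (h₁ : (c.hop q).isSome) (h₂ : c.hcl q = none) :
    c'.hcl q = none := by
  by_contra hne
  rcases h.hcl_inv q (Option.isSome_iff_ne_none.2 hne) with h' | h'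
  · simp [h₂] at h'
  · simp [h'.1] at h₁

theorem order (h : c.Put c' l o) : order Γs c' = order Γs c := by
  have key : ∀ RS : List Frame,
      List.zipWith (fun (L : Layer) (fr : Frame) => (⟨fr.rid, L.var, L.field⟩ : Entry)) Γs RS =
      List.zipWith (fun (L : Layer) r => (⟨r, L.var, L.field⟩ : Entry)) Γs
        (RS.map Frame.rid) := fun RS => by
    rw [List.zipWith_map_right]
  rw [Reggio.order, Reggio.order, key, key, h.rids]

end RCfg.Put

/-- Common core of allocating and of writing. The typing and the location function may change at the
stored identifier, and the contexts may change with them, which covers the retyping of a `var` cell.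
-/
theorem WT.put (h : WT CT Γs Δ loc c) (hp : c.Put c' l o) (hl : l.oid = some ι)
    (hframes : List.Forall₂ (fun (L : Layer) (fr : Frame) => VarsTy Δ' L.ctx fr.vars) Γs' c.stack)
    (hobjs : ∀ l' o' ι', l' ≠ l → l'.oid = some ι' → c.ObjAt o' l' → ObjTy CT Δ' ι' o')
    (ho : ObjTy CT Δ' ι o) (hdom : ∀ ι', (Δ' ι').isSome → (Δ ι').isSome ∨ ι' = ι)
    (hloc : ∀ ι', ι' ≠ ι → loc' ι' = loc ι') (hι : loc' ι = l)
    (hne : ∀ l' o', l' ≠ l → c.ObjAt o' l' → l'.oid ≠ some ι) :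
    WT CT Γs' Δ' loc' c' where
  frames := by
    have key : ∀ RS : List Frame, List.Forall₂ (fun (L : Layer) (fr : Frame) =>
        VarsTy Δ' L.ctx fr.vars) Γs' RS ↔ List.Forall₂ (fun (L : Layer) (F : Vars) =>
        VarsTy Δ' L.ctx F) Γs' (RS.map Frame.vars) := fun RS => by
      rw [List.forall₂_map_right_iff]
    rw [key, hp.vars, ← key]
    exact hframes
  objs l' o' ι' hl' ho' := by
    rcases (hp.objAt _ _).1 ho' with ⟨h₁, h₂⟩ | ⟨rfl, rfl⟩
    · exact hobjs l' o' ι' h₁ hl' h₂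
    · obtain rfl : ι = ι' := by simpa using hl.symm.trans hl'
      exact ho
  dom ι' hι' := by
    by_cases heq : ι' = ι
    · exact ⟨l, o, heq ▸ hl, (hp.objAt _ _).2 (.inr ⟨rfl, rfl⟩)⟩
    · obtain ⟨l', o', h₁, h₂⟩ := h.dom ι' ((hdom ι' hι').resolve_right heq)
      refine ⟨l', o', h₁, (hp.objAt _ _).2 (.inl ⟨?_, h₂⟩)⟩
      rintro rfl
      exact heq (by simpa using h₁.symm.trans hl)
  locs l' o' ι' hl' ho' := by
    rcases (hp.objAt _ _).1 ho' with ⟨h₁, h₂⟩ | ⟨rfl, rfl⟩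
    · rw [hloc ι' fun heq => hne l' o' h₁ h₂ (heq ▸ hl')]
      exact h.locs l' o' ι' hl' h₂
    · obtain rfl : ι = ι' := by simpa using hl.symm.trans hl'
      exact hι
  rids := by rw [hp.rids]; exact h.rids
  opened q := by rw [hp.rids, hp.hop]; exact h.opened q
  disjoint₁ q hq := by
    rw [hp.hop] at hq
    exact hp.hcl_eq_none hq (h.disjoint₁ q hq)
  disjoint₂ q hq := by
    rw [hp.hop] at hq
    rw [hp.hfr]
    exact h.disjoint₂ q hq
  disjoint₃ q hq := by
    rw [hp.hfr]
    rcases hp.hcl_inv q hq with h' | h'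
    · exact h.disjoint₃ q h'
    · exact h'.2

/-- Writing a field does not change the world. -/
theorem RCfg.Put.world_eq (hp : c.Put c' l o) (hcl : c'.hcl = c.hcl) :
    c'.world loc = c.world loc := by
  simp [RCfg.world, hp.rids, hp.hfr, hcl]

/-- Exchange the content of a field of an object in the region of the newest frame with a held
value. -/
theorem OK.write {f : Name} {v v' : Val} {t t' : Ty} (h : OK CT Γs Δ loc c ((v, t) :: fl))
    (hp : c.Put c' l (o.set f v)) (hcl : c'.hcl = c.hcl) (hl : l.oid = some ι)
    (ho : c.ObjAt o l) (hf : o.fields.Has f v') (hrid : l.rid = (c.world loc).top.rid)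
    (ok : (c.world loc).Ok l v) (ok' : (c.world loc).Ok (c.world loc).top v')
    (hwt : WT CT Γs' Δ' loc c') (hord : Reggio.order Γs' c' = Reggio.order Γs c)
    (hv' : HasTy Δ' v' t') (hfl : ∀ p ∈ fl, HasTy Δ' p.1 p.2) :
    OK CT Γs' Δ' loc c' ((v', t') :: fl) where
  wt := hwt
  flTy := List.forall_mem_cons.2 ⟨hv', hfl⟩
  inv := by
    rw [hp.world_eq hcl]
    exact h.inv.exchange ((RCfg.edge_of_oid hl).2 ⟨o, ho, hf⟩) ok ok'
      fun l' g w hw => (hp.edge_set h.wt hl ho).1 hw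
  entry := by
    rw [hord]
    -- The written object lies in the newest region, through which no entry path leads.
    refine h.entry_mono fun l' g w hw hl' => (hp.edge_set h.wt hl ho).2 (.inl ⟨?_, hw⟩)
    rintro ⟨rfl, -⟩
    exact hl' hrid

/-- Replace an `iso` reference by an `iso` reference to another object of the same region. -/
theorem OK.retarget {f : Name} {v v' : Val} (h : OK CT Γs Δ loc c fl)
    (hp : c.Put c' l (o.set f v')) (hcl : c'.hcl = c.hcl) (hl : l.oid = some ι)
    (ho : c.ObjAt o l) (hf : o.fields.Has f v) (hc : v.cap = .iso) (hc' : v'.cap = .iso)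
    (hr : (loc v'.oid).rid = (loc v.oid).rid) (hh : (loc v'.oid).IsHeap)
    (hwt : WT CT Γs' Δ' loc c') (hord : Reggio.order Γs' c' = Reggio.order Γs c)
    (hfl : ∀ p ∈ fl, HasTy Δ' p.1 p.2) : OK CT Γs' Δ' loc c' fl where
  wt := hwt
  flTy := hfl
  inv := by
    rw [hp.world_eq hcl]
    exact h.inv.retarget ((RCfg.edge_of_oid hl).2 ⟨o, ho, hf⟩) hc hc' hr hh
      fun l' g w hw => (hp.edge_set h.wt hl ho).1 hw
  entry := by
    rw [hord]
    intro a b hab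
    obtain ⟨k, ι₁, ι₂, e₁, e₂, hr'⟩ := h.entry a b hab
    have e₁' := hp.edge_root.2 e₁
    -- If the overwritten field is the last step of an entry path, the new reference can take its
    -- place because it leads into the same region.
    by_cases hs : loc ι₁ = l ∧ a.field = f
    · refine ⟨k, ι₁, v'.oid, e₁', (hp.edge_set h.wt hl ho).2 (.inr ⟨hs.1, hs.2, ?_⟩), ?_⟩
      · rw [← hc']
      · obtain rfl : v = ⟨.iso, ι₂⟩ :=
          h.wt.edge_inj ((RCfg.edge_of_oid hl).2 ⟨o, ho, hf⟩) (hs.1 ▸ hs.2 ▸ e₂)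
        rw [hr, ← hr']
    · exact ⟨k, ι₁, ι₂, e₁', (hp.edge_set h.wt hl ho).2 (.inl ⟨hs, e₂⟩), hr'⟩

/-- The objects and regions that are already there are unaffected by the choice of an unused
object identifier. -/
theorem OK.alloc {vs : List Val} {ts : List Ty} {CL : STy} {tag : Tag} {k : Cap}
    (h : OK CT Γs Δ loc c (vs.zip ts ++ fl)) (hlen : vs.length = ts.length)
    (hp : c.Put c' l ⟨tag, Vars.empty.setAll (CT.fieldNames tag) vs⟩) (hl : l.oid = some ι)
    (hι : ¬ c.Stored ι) (htag : SubTag tag CL)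
    (hts : List.Forall₂ Sub ts ((CT.ftypes CL).map Prod.snd))
    (okv : ∀ v ∈ vs, (c'.world loc).Ok l v)
    (ok : (c'.world (Function.update loc ι l)).Ok (c'.world (Function.update loc ι l)).top ⟨k, ι⟩)
    (hk : k = .iso → ∀ l' o', c.ObjAt o' l' → l'.rid ≠ l.rid) :
    OK CT Γs (Function.update Δ ι (some CL)) (Function.update loc ι l) c'
      ((⟨k, ι⟩, CL.ty k) :: fl) := by
  have hne : ∀ {ι'}, (Δ ι').isSome → ι' ≠ ι := fun h' heq => hι (h.wt.dom_iff.1 (heq ▸ h'))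
  have hnone : ∀ l' o', c.ObjAt o' l' → l'.oid ≠ some ι := fun l' o' h₁ h₂ =>
    hι (RCfg.stored_iff.2 ⟨l', o', h₂, h₁⟩)
  have hΔ : ∀ {ι'}, (Δ ι').isSome → Function.update Δ ι (some CL) ι' = Δ ι' := fun h' =>
    Function.update_of_ne (hne h') _ _
  have hty : ∀ {v t}, HasTy Δ v t → HasTy (Function.update Δ ι (some CL)) v t := fun h' =>
    h'.congr (hΔ (by obtain ⟨CL, hCL, -⟩ := h'; simp [hCL]))
  have hvars : ∀ {Γ F}, VarsTy Δ Γ F → VarsTy (Function.update Δ ι (some CL)) Γ F := fun h' =>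
    h'.congr fun x v hv => hΔ (by obtain ⟨-, -, CL, hCL, -⟩ := h'.exists_ty hv; simp [hCL])
  have hloc : ∀ {ι'}, (Δ ι').isSome → Function.update loc ι l ι' = loc ι' := fun h' =>
    Function.update_of_ne (hne h') _ _
  have hinv := h.inv
  rw [map_fst_zip_append hlen] at hinv
  have flDom : ∀ v ∈ vs ++ fl.map Prod.fst, (Δ v.oid).isSome := fun v hv =>
    h.fl_dom (by rwa [map_fst_zip_append hlen])
  have wtop : (c'.world (Function.update loc ι l)).top = (c.world loc).top := by
    simp [World.top, RCfg.world, hp.rids]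
  have okOld : ∀ l' v, (Δ v.oid).isSome → (c.world loc).Ok l' v →
      (c'.world (Function.update loc ι l)).Ok l' v := by
    rintro l' ⟨k', ι'⟩ hd ⟨hfr, hok⟩
    have e : Function.update loc ι l ι' = loc ι' := hloc hd
    simp only [World.Ok, RCfg.world, hp.hfr, hp.rids, e, World.CapOk, World.Lt] at hfr hok ⊢
    refine ⟨hfr, ?_⟩
    cases k' <;> first | exact hok | skip
    exact ⟨hok.1, hok.2.1.imp_left (hp.hcl _), hok.2.2⟩
  -- The old references are first moved to the new world, with the arguments still held. Then the
  -- arguments fill the fields of the object, and only at the end the reference to it is added.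
  have inv₁ : Inv (c'.world (Function.update loc ι l)) c.Edge (vs ++ fl.map Prod.fst) := by
    refine hinv.map id (fun v v' => v' = v ∧ (Δ v.oid).isSome) ?_ ?_ ?_
    · rintro v₁ _ v₂ _ ⟨rfl, h₁⟩ ⟨rfl, h₂⟩ hc
      have e₁ := hloc h₁
      have e₂ := hloc h₂
      simpa only [World.Conf, RCfg.world, hp.hfr, e₁, e₂] using hc
    · exact fun l' f v hv => ⟨okOld _ _ (h.wt.edge_dom hv) (h.inv.ok _ _ _ hv), l', v, rfl, hv, rfl,
        h.wt.edge_dom hv⟩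
    · rw [List.forall₂_same]
      exact fun v hv => ⟨⟨rfl, flDom v hv⟩, wtop ▸ okOld _ _ (flDom v hv) (hinv.okFl v hv)⟩
  have inv₂ : Inv (c'.world (Function.update loc ι l)) c'.Edge (fl.map Prod.fst) := by
    refine inv₁.putAll (l := l) (ns := CT.fieldNames tag)
      (by rw [htag.fieldNames]; exact CT.nodup_ftypes CL) (fun v hv => ?_) ?_ ?_
    · have e := hloc (flDom v (List.mem_append_left _ hv))
      simpa only [World.Ok, RCfg.world, e, World.CapOk, World.Lt] using okv v hv
    · intro f _ w hw
      obtain ⟨o', ho', -⟩ := (RCfg.edge_of_oid hl).1 hw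
      exact hnone _ _ ho' hl
    · intro l' g w hw
      rcases eq_or_ne l' l with rfl | hne
      · rw [hp.edge_self hl] at hw
        rcases Vars.has_setAll hw with hw | hw
        · cases hw
        · exact .inr ⟨rfl, hw⟩
      · exact .inl ((hp.edge_ne hne).1 hw)
  -- Nothing can conflict with the new reference: its identifier is fresh, and if it is `iso`, no
  -- existing object lies in its region.
  have noconf : ∀ v : Val, (Δ v.oid).isSome →
      ¬ (c'.world (Function.update loc ι l)).Conf v ⟨k, ι⟩ := by
    rintro v hd (⟨-, hc⟩ | ⟨-, hc, hr, -⟩)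
    · exact hne hd hc
    · have e := hloc hd
      simp only [RCfg.world, e, Function.update_self] at hr
      obtain ⟨-, o', ho'⟩ := h.wt.dom_loc hd
      exact hk hc _ _ ho' hr
  have vsDom : ∀ l' f v, c'.Edge l' f v → (Δ v.oid).isSome := by
    intro l' g w hw
    rcases eq_or_ne l' l with rfl | hne
    · rw [hp.edge_self hl] at hw
      rcases Vars.has_setAll hw with hw | hw
      · cases hw
      · exact flDom w (List.mem_append_left _ (List.of_mem_zip hw).2)
    · exact h.wt.edge_dom ((hp.edge_ne hne).1 hw)
  refine ⟨?_, ?_, ?_, ?_⟩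
  · refine h.wt.put hp hl (h.wt.frames.imp fun _ _ => hvars) ?_ ?_ ?_
      (fun ι' hι' => Function.update_of_ne hι' _ _) (Function.update_self _ _ _)
      (fun l' o' _ ho' => hnone l' o' ho')
    · intro l' o' ι' _ hl' ho'
      obtain ⟨CL', h₁, h₂, h₃⟩ := h.wt.objs l' o' ι' hl' ho'
      exact ⟨CL', (hΔ (by simp [h₁])).trans h₁, h₂, hvars h₃⟩
    · refine ⟨CL, Function.update_self _ _ _, htag, ?_⟩
      rw [CT.ctxOf_eq, htag.fieldNames]
      refine (VarsTy.empty _).setAll ?_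
      have := forall₂_of_zip hlen fun p hp => h.flTy p (List.mem_append_left _ hp)
      rw [List.forall₂_iff_get] at this hts ⊢
      refine ⟨this.1.trans hts.1, fun i h₁ h₂ => ?_⟩
      have h₃ : i < ts.length := hlen ▸ h₁
      exact hty ((this.2 i h₁ h₃).sub (hts.2 i h₃ h₂))
    · intro ι' hι'
      by_cases heq : ι' = ι
      · exact .inr heq
      · rw [Function.update_of_ne heq] at hι'
        exact .inl hι'
  · refine List.forall_mem_cons.2 ⟨⟨CL, Function.update_self _ _ _, .refl _⟩, fun p hp => ?_⟩
    exact hty (h.flTy p (List.mem_append_right _ hp))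
  · refine inv₂.add ok (fun l' f w hw => noconf w (vsDom l' f w hw)) fun w hw hc => ?_
    exact noconf w (flDom w (List.mem_append_right _ hw)) hc.symm
  · rw [hp.order]
    intro a b hab
    obtain ⟨k', ι₁, ι₂, e₁, e₂, hr⟩ := h.entry a b hab
    have hl₁ := h.wt.dom_loc (h.wt.edge_dom e₁)
    have e : loc ι₁ ≠ l := fun heq => hnone _ _ hl₁.2.choose_spec (heq ▸ hl)
    refine ⟨k', ι₁, ι₂, hp.edge_root.2 e₁, ?_, ?_⟩
    · rw [hloc (h.wt.edge_dom e₁), hp.edge_ne e]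
      exact e₂
    · rw [hloc (h.wt.edge_dom e₂)]
      exact hr

/-! Stores of particular places -/

/-- The frame may be anywhere in the stack, because an exit may write into the temporary store of an
older frame. -/
theorem put_temp {A B : List Frame} {fr : Frame}
    (hnd : ((A ++ fr :: B).map Frame.rid).Nodup) (ι : Oid) (o : Obj) :
    RCfg.Put ⟨A ++ fr :: B, hop, hcl, hfr⟩
      ⟨A ++ ⟨fr.rid, fr.tmp.set ι o, fr.vars⟩ :: B, hop, hcl, hfr⟩ (.temp fr.rid ι) o where
  objAt o' l' := by
    cases l' with
    | root => simp [RCfg.ObjAt]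
    | heap q ι' => simp [RCfg.ObjAt]
    | temp q ι' =>
      have hne : ∀ fr', fr' ∈ A ∨ fr' ∈ B → fr'.rid ≠ fr.rid := by
        intro fr' hm heq
        simp only [List.map_append, List.map_cons, List.nodup_append, List.nodup_cons,
          List.mem_map, List.mem_cons] at hnd
        rcases hm with hm | hm
        · exact hnd.2.2 _ ⟨fr', hm, rfl⟩ _ (.inl rfl) heq
        · exact hnd.2.1.1 ⟨fr', hm, heq⟩
      simp only [RCfg.ObjAt, List.mem_append, List.mem_cons, Loc.temp.injEq, ne_eq]
      constructor
      · rintro ⟨fr', hm | rfl | hm, rfl, ho⟩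
        · exact .inl ⟨fun h' => hne fr' (.inl hm) h'.1, fr', .inl hm, rfl, ho⟩
        · by_cases hι : ι' = ι
          · subst hι
            exact .inr ⟨⟨rfl, rfl⟩, by simpa [Store.set, eq_comm] using ho⟩
          · exact .inl ⟨fun h' => hι h'.2, fr, .inr (.inl rfl), rfl,
              by simpa [Store.set, hι] using ho⟩
        · exact .inl ⟨fun h' => hne fr' (.inr hm) h'.1, fr', .inr (.inr hm), rfl, ho⟩
      · rintro (⟨hn, fr', hm | rfl | hm, rfl, ho⟩ | ⟨⟨rfl, rfl⟩, rfl⟩)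
        · exact ⟨fr', .inl hm, rfl, ho⟩
        · exact ⟨_, .inr (.inl rfl), rfl, by simpa [Store.set, show ι' ≠ ι by simpa using hn]⟩
        · exact ⟨fr', .inr (.inr hm), rfl, ho⟩
        · exact ⟨_, .inr (.inl rfl), rfl, by simp [Store.set]⟩
  frames := by simp
  hop _ := rfl
  hcl _ := id
  hcl_inv _ := .inl
  hfr := rfl

theorem put_hop {RS : List Frame} (h : hop r = some S) (hcl_none : hcl r = none)
    (hfr_none : hfr r = none) (ι : Oid) (o : Obj) :
    RCfg.Put ⟨RS, hop, hcl, hfr⟩ ⟨RS, hop.set r (S.set ι o), hcl, hfr⟩ (.heap r ι) o where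
  objAt o' l' := by
    cases l' with
    | root => simp [RCfg.ObjAt]
    | temp q ι' => simp [RCfg.ObjAt]
    | heap q ι' =>
      rcases eq_or_ne q r with rfl | hq
      · rcases eq_or_ne ι' ι with rfl | hι
        · simp [RCfg.ObjAt, Heap.set, Store.set, hcl_none, hfr_none, eq_comm]
        · simp [RCfg.ObjAt, Heap.set, Store.set, hcl_none, hfr_none, hι, h]
      · simp [RCfg.ObjAt, Heap.set, hq]
  frames := rfl
  hop q := by
    rcases eq_or_ne q r with rfl | hq
    · simp [Heap.set, h]
    · simp [Heap.set, hq]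
  hcl _ := id
  hcl_inv _ := .inl
  hfr := rfl

theorem put_hcl {RS : List Frame} (hop_none : hop r = none) (hcl_none : hcl r = none)
    (hfr_none : hfr r = none) (ι : Oid) (o : Obj) :
    RCfg.Put ⟨RS, hop, hcl, hfr⟩ ⟨RS, hop, hcl.set r (Store.empty.set ι o), hfr⟩
      (.heap r ι) o where
  objAt o' l' := by
    cases l' with
    | root => simp [RCfg.ObjAt]
    | temp q ι' => simp [RCfg.ObjAt]
    | heap q ι' =>
      rcases eq_or_ne q r with rfl | hq
      · rcases eq_or_ne ι' ι with rfl | hι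
        · simp [RCfg.ObjAt, Heap.set, Store.set, hop_none, hfr_none, eq_comm]
        · simp [RCfg.ObjAt, Heap.set, Store.set, Store.empty, hop_none, hcl_none, hfr_none, hι]
      · simp [RCfg.ObjAt, Heap.set, hq]
  frames := rfl
  hop _ := rfl
  hcl q hq := by
    rcases eq_or_ne q r with rfl | hqr
    · simp [Heap.set]
    · simpa [Heap.set, hqr] using hq
  hcl_inv q hq := by
    rcases eq_or_ne q r with rfl | hqr
    · exact .inr ⟨hop_none, hfr_none⟩
    · exact .inl (by simpa [Heap.set, hqr] using hq)
  hfr := rfl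

theorem stackStore_eq {ι : Oid} {o₀ o : Obj} {RS : List Frame} (h : stackLoad RS ι = some o₀) :
    ∃ A fr B, RS = A ++ fr :: B ∧ fr.tmp ι = some o₀ ∧
      stackStore ι o RS = A ++ ⟨fr.rid, fr.tmp.set ι o, fr.vars⟩ :: B := by
  induction RS with
  | nil => cases h
  | cons fr RS ih =>
    rw [stackLoad, List.findSome?_cons] at h
    cases hfr : fr.tmp ι with
    | some o₁ =>
      simp only [hfr, Option.some.injEq] at h
      exact ⟨[], fr, RS, rfl, h ▸ hfr, by simp [stackStore, hfr]⟩
    | none =>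
      simp only [hfr] at h
      obtain ⟨A, fr', B, rfl, h₁, h₂⟩ := ih h
      exact ⟨fr :: A, fr', B, rfl, h₁, by simp [stackStore, hfr, h₂]⟩

theorem forall₂_imp_mem {α β : Type*} {R R' : α → β → Prop} {l₁ : List α} {l₂ : List β}
    (h : List.Forall₂ R l₁ l₂) (hR : ∀ a, ∀ b ∈ l₂, R a b → R' a b) : List.Forall₂ R' l₁ l₂ := by
  induction h with
  | nil => exact .nil
  | cons h _ ih =>
    exact .cons (hR _ _ (by simp) h) (ih fun a b hb => hR a b (List.mem_cons_of_mem _ hb))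

/-- Locations of objects in closed or frozen regions are on the heap. -/
theorem RCfg.Edge.isHeap {l : Loc} {f : Name} {v : Val}
    (he : c.Edge l f v) (hl : l.rid ∉ c.stack.map Frame.rid) : l.IsHeap := by
  cases l with
  | heap => simp
  | root q =>
    obtain ⟨fr, hm, hq, -⟩ := RCfg.edge_root.1 he
    exact (hl (hq ▸ List.mem_map_of_mem hm)).elim
  | temp q ι =>
    obtain ⟨o, ⟨fr, hm, hq, -⟩, -⟩ := (RCfg.edge_of_oid (l := .temp q ι) rfl).1 he
    exact (hl (hq ▸ List.mem_map_of_mem hm)).elim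

theorem WT.loc_closed (h : WT CT Γs Δ loc c) (hr : c.hcl r = some S) (hι : (S ι).isSome) :
    loc ι = .heap r ι := by
  obtain ⟨o, ho⟩ := Option.isSome_iff_exists.1 hι
  exact h.locs _ o ι rfl ⟨c.hcl, by simp, S, hr, ho⟩

/-! Freezing -/

theorem objAt_freeze {M : Set Reg} (hM : ∀ q ∈ M, hop q = none ∧ hfr q = none) {o : Obj}
    {l : Loc} : RCfg.ObjAt ⟨RS, hop, hcl.without M, hfr.withFrom hcl M⟩ o l ↔
      RCfg.ObjAt ⟨RS, hop, hcl, hfr⟩ o l := by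
  cases l with
  | root => simp [RCfg.ObjAt]
  | temp => simp [RCfg.ObjAt]
  | heap q ι =>
    by_cases hq : q ∈ M
    · simp [RCfg.ObjAt, Heap.without, Heap.withFrom, hq, hM q hq]
    · simp [RCfg.ObjAt, Heap.without, Heap.withFrom, hq]

/-- Steps within a region are skipped, so that a region other than the first has an incoming
reference from a different reachable region. -/
theorem reachable_cases {Hs : List Heap} {r q : Reg} (h : q ∈ reachable Hs r) :
    q = r ∨ ∃ p ∈ reachable Hs r, p ≠ q ∧ ReachStep Hs p q := by
  rcases h with h | h
  · exact .inl h
  · change Relation.TransGen _ r q at h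
    induction h with
    | @single q h =>
      rcases eq_or_ne r q with hq | hq
      · exact .inl hq.symm
      · exact .inr ⟨r, .inl rfl, hq, h⟩
    | @tail p q hp h ih =>
      rcases eq_or_ne p q with rfl | hq
      · exact ih
      · exact .inr ⟨p, .inr hp, hq, h⟩

theorem reachable_step {Hs : List Heap} {r p q : Reg} (hp : p ∈ reachable Hs r)
    (h : ReachStep Hs p q) : q ∈ reachable Hs r := by
  rcases hp with hp | hp
  · cases hp; exact .inr (.single h)
  · exact .inr (hp.tail h)

/-- The set of regions to be frozen is closed, apart from references into already frozen regions, in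
both directions: references into it start in it, and references out of it end in it. So deep freeze
holds, and an `iso` reference to a newly frozen region comes from a newly frozen one. The frozen set
only grows, which cannot create conflicts. -/
theorem OK.freeze {t : Ty} {r₁ : Reg} {S₁ : Store}
    (h : OK CT Γs Δ loc ⟨RS, hop, hcl, hfr⟩ [(⟨.iso, ι⟩, t)]) (hr : hcl r₁ = some S₁)
    (hι : (S₁ ι).isSome) (hM : reachable [hop, hcl] r₁ ⊆ hcl.dom) :
    OK CT Γs Δ loc ⟨RS, hop, hcl.without (reachable [hop, hcl] r₁),
      hfr.withFrom hcl (reachable [hop, hcl] r₁)⟩ [(⟨.imm, ι⟩, t.makeImm)] := by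
  have hlι : loc ι = .heap r₁ ι := h.wt.loc_closed hr hι
  have hr₁ : r₁ ∈ reachable [hop, hcl] r₁ := .inl rfl
  have hcases := @reachable_cases [hop, hcl] r₁
  have hstep := @reachable_step [hop, hcl] r₁
  -- From here on `M` is known only through four facts: it contains `r₁`, it consists of closed
  -- regions, it is stable under steps, and each other member is entered from a different member.
  generalize reachable [hop, hcl] r₁ = M at *
  have wf := h.wt.world_wf
  have hM₁ : ∀ q ∈ M, q ∉ (RCfg.world ⟨RS, hop, hcl, hfr⟩ loc).rids := fun q hq hm =>
    wf.not_cl q hm (hM hq)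
  have hM₂ : ∀ q ∈ M, q ∉ hfr.dom := fun q hq hm => wf.cl_fr q (hM hq) hm
  have hM₃ : ∀ q ∈ M, hop q = none ∧ hfr q = none := fun q hq =>
    ⟨by
      have := mt (h.wt.opened q).2 (hM₁ q hq)
      simpa using this, by simpa [Heap.dom] using hM₂ q hq⟩
  have hobj := @objAt_freeze RS hop hcl hfr M hM₃
  have hedge : ∀ {l f v}, RCfg.Edge ⟨RS, hop, hcl.without M, hfr.withFrom hcl M⟩ l f v ↔
      RCfg.Edge ⟨RS, hop, hcl, hfr⟩ l f v := by
    intro l f v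
    by_cases hl : l.IsRoot
    · obtain ⟨q, rfl⟩ := hl
      rw [RCfg.edge_root, RCfg.edge_root]
    · exact RCfg.edge_congr (fun o l => hobj) hl
  have hcl' : ∀ q, q ∈ (hcl.without M).dom ↔ q ∈ hcl.dom ∧ q ∉ M := fun q => by
    by_cases hq : q ∈ M <;> simp [Heap.dom, Heap.without, hq]
  have hfr' : ∀ q, q ∈ (hfr.withFrom hcl M).dom ↔ q ∈ hfr.dom ∨ q ∈ M := fun q => by
    by_cases hq : q ∈ M
    · simpa [Heap.dom, Heap.withFrom, hq] using hM hq
    · simp [Heap.dom, Heap.withFrom, hq]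
  have into : ∀ l f v, RCfg.Edge ⟨RS, hop, hcl, hfr⟩ l f v → (loc v.oid).rid ∈ M →
      l.rid ∈ M := by
    rintro l f v he hv
    obtain ⟨-, ok⟩ := h.inv.ok _ _ _ he
    -- A reference into `r₁` would conflict with the held one. Another region of `M` is entered by a
    -- reference from a different region of `M`; between different heap regions, with the target not
    -- frozen, it can only be `iso`. Uniqueness identifies it with the given reference, which
    -- therefore starts in `M`.
    have isoCase : v.cap = .iso → l.rid ∈ M := by
      intro hc
      rcases hcases hv with hq | ⟨p, hp, hpq, H, hH, H', hH', Sp, Sq, hSp, hSq, ι', o, g, w, ho,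
        hw, hwq⟩
      · refine (h.inv.sepFl _ _ _ he ⟨.iso, ι⟩ (by simp) (.inr ⟨hc, rfl, ?_, ?_⟩)).elim
        · simp [RCfg.world, hq, hlι]
        · exact hM₂ _ hv
      · have hH₁ : ∀ H ∈ [hop, hcl], H ∈ [hop, hcl, hfr] := by simp
        have ew : RCfg.Edge ⟨RS, hop, hcl, hfr⟩ (.heap p ι') g w :=
          (RCfg.edge_of_oid (l := .heap p ι') rfl).2 ⟨o, ⟨H, hH₁ H hH, Sp, hSp, ho⟩, hw⟩
        obtain ⟨ow, how⟩ := Option.isSome_iff_exists.1 hwq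
        have lw : loc w.oid = .heap (loc v.oid).rid w.oid :=
          h.wt.locs _ ow w.oid rfl ⟨H', hH₁ H' hH', Sq, hSq, how⟩
        have okw := (h.inv.ok _ _ _ ew).2
        have hwiso : w.cap = .iso := by
          obtain ⟨k, ιw⟩ := w
          simp only [RCfg.world, lw] at okw
          cases k <;> simp only [World.CapOk, Loc.rid_heap, Loc.isHeap_heap, not_true_eq_false,
            false_and, and_false] at okw
          · rfl
          · exact (Loc.not_isRoot_heap _ _ okw.2.1).elim
          · exact (hpq okw.1).elim
          · exact (hM₂ _ hv okw.1).elim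
        obtain ⟨rfl, -⟩ := h.inv.sep _ _ _ _ _ _ he ew
          (.inr ⟨hc, hwiso, by simp [RCfg.world, lw], hM₂ _ hv⟩)
        exact hp
    obtain ⟨k, ιv⟩ := v
    cases k
    · exact isoCase rfl
    · exact ok.1 ▸ hv
    · exact ok.1 ▸ hv
    · exact ok.1 ▸ hv
    · exact (hM₁ _ hv ok.1.left).elim
    · exact (hM₂ _ hv ok.1).elim
  -- An `iso` reference to a closed region is a reachability step; an `imm` reference leads to a
  -- frozen region. The other capabilities either stay in their region or need an open source.
  have out : ∀ l f v, RCfg.Edge ⟨RS, hop, hcl, hfr⟩ l f v → l.rid ∈ M →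
      (loc v.oid).rid ∈ hfr.dom ∨ (loc v.oid).rid ∈ M := by
    rintro l f ⟨k, ιv⟩ he hl
    obtain ⟨-, ok⟩ := h.inv.ok _ _ _ he
    cases k
    · rcases ok.2.1 with ok' | ok' | ok'
      · refine .inr (hstep hl ?_)
        obtain ⟨p, ι', rfl⟩ := RCfg.Edge.isHeap he (hM₁ _ hl)
        obtain ⟨o, ⟨H, hH, Sp, hSp, ho⟩, hw⟩ := (RCfg.edge_of_oid (l := .heap p ι') rfl).1 he
        obtain ⟨hlo, o', ho'⟩ := h.wt.dom_loc (h.wt.edge_dom he)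
        obtain ⟨q, ι'', hq⟩ := ok.2.2
        simp only [RCfg.world] at hq
        simp only [hq] at ho' hlo
        obtain rfl : ι'' = ιv := by simpa using hlo
        obtain ⟨H', hH', Sq, hSq, ho'⟩ := ho'
        have ok' : (hcl q).isSome := by
          have : (loc ι'').rid ∈ hcl.dom := ok'
          rwa [hq] at this
        have hpn := hM₃ _ hl
        refine ⟨H, ?_, H', ?_, Sp, Sq, hSp, by simpa [hq] using hSq, ι', o, f, _, ho, hw,
          by simp [ho']⟩
        · simp only [List.mem_cons, List.not_mem_nil, or_false] at hH ⊢
          rcases hH with hH | hH | hH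
          · exact .inl hH
          · exact .inr hH
          · rw [hH] at hSp
            rw [Loc.rid_heap] at hpn
            simp [hpn.2] at hSp
        · simp only [List.mem_cons, List.not_mem_nil, or_false] at hH' ⊢
          rcases hH' with hH' | hH' | hH'
          · exact .inl hH'
          · exact .inr hH'
          · have := h.wt.disjoint₃ q ok'
            simp only at this
            rw [hH', this] at hSq
            cases hSq
      · exact (hM₁ _ hl ok'.left).elim
      · exact .inl ok'.1
    · exact .inr (ok.1 ▸ hl)
    · exact .inr (ok.1 ▸ hl)
    · exact .inr (ok.1 ▸ hl)
    · exact (hM₁ _ hl ok.1.right).elim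
    · exact .inl ok.1
  have hvar : ∀ {l v}, (RCfg.world ⟨RS, hop, hcl, hfr⟩ loc).Ok l v → v.cap = .var →
      v.oid ≠ ι := by
    rintro l v ok hv rfl
    have := ok.isTemp_of_var hv
    simp [RCfg.world, hlι] at this
  refine ⟨⟨h.wt.frames, ?_, ?_, ?_, h.wt.rids, h.wt.opened, ?_, ?_, ?_⟩, ?_, ?_, ?_⟩
  · exact fun l o ι hl ho => h.wt.objs l o ι hl (hobj.1 ho)
  · exact fun ι hι => by simpa only [hobj] using h.wt.dom ι hι
  · exact fun l o ι hl ho => h.wt.locs l o ι hl (hobj.1 ho)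
  · intro q hq
    by_cases hqM : q ∈ M
    · simp [Heap.without, hqM]
    · simpa [Heap.without, hqM] using h.wt.disjoint₁ q hq
  · intro q hq
    by_cases hqM : q ∈ M
    · have hq : (hop q).isSome := hq
      simp [hM₃ q hqM] at hq
    · simpa [Heap.withFrom, hqM] using h.wt.disjoint₂ q hq
  · intro q hq
    by_cases hqM : q ∈ M
    · simp [Heap.without, hqM] at hq
    · simp only [Heap.without, Heap.withFrom, hqM, if_false] at hq ⊢
      exact h.wt.disjoint₃ q hq
  · have ht := (h.flTy (⟨.iso, ι⟩, t) (by simp)).mapCap fun k => if k = .iso then .imm else k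
    simpa [Ty.makeImm] using ht
  · refine h.inv.map id (fun v v' => (v' = v ∧ (v.cap = .var → v.oid ≠ ι)) ∨
      (v = ⟨.iso, ι⟩ ∧ v' = ⟨.imm, ι⟩)) ?_ ?_ ?_
    · rintro v₁ v₁' v₂ v₂' (⟨rfl, h₁⟩ | ⟨rfl, rfl⟩) (⟨rfl, h₂⟩ | ⟨rfl, rfl⟩) <;>
        simp only [World.Conf, RCfg.world, hfr'] <;> grind
    · intro l f v he
      rw [hedge] at he
      obtain ⟨hd, ok⟩ := h.inv.ok _ _ _ he
      refine ⟨⟨?_, ?_⟩, l, v, rfl, he, .inl ⟨rfl, hvar (h.inv.ok _ _ _ he)⟩⟩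
      · simp only [RCfg.world, hfr'] at hd ⊢
        rintro (hl | hl)
        · exact .inl (hd hl)
        · exact out l f v he hl
      · have hin := into l f v he
        obtain ⟨k, ιv⟩ := v
        cases k
        · refine ⟨ok.1, ?_, ok.2.2⟩
          simp only [RCfg.world, hcl', hfr'] at ok hin ⊢
          by_cases hm : (loc ιv).rid ∈ M
          · exact .inr (.inr ⟨.inr hm, .inr (hin hm)⟩)
          · rcases ok.2.1 with ok' | ok' | ok'
            · exact .inl ⟨ok', hm⟩
            · exact .inr (.inl ok')
            · exact .inr (.inr ⟨.inl ok'.1, .inl ok'.2⟩)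
        · exact ok
        · exact ok
        · exact ok
        · exact ok
        · exact ⟨(hfr' _).2 (.inl ok.1), ok.2⟩
    · refine .cons ⟨.inr ⟨rfl, rfl⟩, fun _ => ?_, ?_, ?_⟩ .nil
      · simpa only [RCfg.world, hfr', hlι] using .inr hr₁
      · simpa only [RCfg.world, hfr', hlι] using .inr hr₁
      · simp [RCfg.world, hlι]
  · intro a b hab
    obtain ⟨k, ι₁, ι₂, e₁, e₂, hr'⟩ := h.entry a b hab
    exact ⟨k, ι₁, ι₂, hedge.2 e₁, hedge.2 e₂, hr'⟩

/-! Merging -/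

/-- Move heap locations from region `r₁` to region `r`. -/
def Loc.move (r₁ r : Reg) : Loc → Loc
  | .heap q ι => if q = r₁ then .heap r ι else .heap q ι
  | l => l

theorem Loc.move_of_ne {r₁ r : Reg} {l : Loc} (h : l.rid ≠ r₁) : l.move r₁ r = l := by
  cases l with
  | heap q ι => exact if_neg h
  | _ => rfl

theorem Loc.move_oid {r₁ r : Reg} {l : Loc} : (l.move r₁ r).oid = l.oid := by
  cases l with
  | heap q ι => simp only [Loc.move]; split <;> rfl
  | _ => rfl

/-- The held `iso` reference is the only one into `r₁`, so no reference from outside leads into it.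
Its internal references are `mut` and move along with their objects. Its outgoing references are
`iso` or `imm`, and remain valid when they start in `r`. -/
theorem OK.merge {t : Ty} {r₁ : Reg} {S₁ S₂ : Store}
    (h : OK CT Γs Δ loc ⟨⟨r, S, F⟩ :: RS, hop, hcl, hfr⟩ [(⟨.iso, ι⟩, t)])
    (hr : hcl r₁ = some S₁) (hι : (S₁ ι).isSome) (hop_r : hop r = some S₂)
    (hdis : ∀ ι', S₁ ι' = none ∨ S₂ ι' = none) :
    OK CT Γs Δ (fun ι => (loc ι).move r₁ r)
      ⟨⟨r, S, F⟩ :: RS, hop.set r (S₂.append S₁), hcl.remove r₁, hfr⟩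
      [(⟨.mutable, ι⟩, t.makeMut)] := by
  have hlι : loc ι = .heap r₁ ι := h.wt.loc_closed hr hι
  have wf := h.wt.world_wf
  have hr₁ : r₁ ∈ hcl.dom := by simp [Heap.dom, hr]
  have hr₁_open : r₁ ∉ (RCfg.world ⟨⟨r, S, F⟩ :: RS, hop, hcl, hfr⟩ loc).rids := fun h' =>
    wf.not_cl _ h' hr₁
  have hr₁_fr : r₁ ∉ hfr.dom := wf.cl_fr r₁ hr₁
  have hr_open : r ∈ (RCfg.world ⟨⟨r, S, F⟩ :: RS, hop, hcl, hfr⟩ loc).rids := by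
    simp [RCfg.world]
  have hne : r ≠ r₁ := fun h' => hr₁_open (h' ▸ hr_open)
  have hcl_r : hcl r = none := h.wt.disjoint₁ r (by simp [hop_r])
  have hfr_r : hfr r = none := h.wt.disjoint₂ r (by simp [hop_r])
  have hop_r₁ : hop r₁ = none := by
    have := mt (h.wt.opened r₁).2 hr₁_open
    simpa using this
  have hfr_r₁ : hfr r₁ = none := by simpa [Heap.dom] using hr₁_fr
  have objAt_move : ∀ {o l}, RCfg.ObjAt ⟨⟨r, S, F⟩ :: RS, hop, hcl, hfr⟩ o l →
      RCfg.ObjAt ⟨⟨r, S, F⟩ :: RS, hop.set r (S₂.append S₁), hcl.remove r₁, hfr⟩ o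
        (l.move r₁ r) := by
    intro o l ho
    cases l with
    | root => exact ho
    | temp => exact ho
    | heap q ι' =>
      by_cases hq : q = r₁
      · subst hq
        simp only [RCfg.ObjAt, List.mem_cons, List.not_mem_nil, or_false, exists_eq_or_imp,
          exists_eq_left, hop_r₁, hr, hfr_r₁, reduceCtorEq, false_and, exists_false, false_or,
          or_false, Option.some.injEq, exists_eq_left'] at ho
        simp only [Loc.move, if_true]
        refine ⟨_, List.mem_cons_self, S₂.append S₁, by simp [Heap.set], ?_⟩
        have := (hdis ι').resolve_left (by simp [ho])
        simp [Store.append, ho, this]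
      · simp only [Loc.move, hq, if_false]
        by_cases hq' : q = r
        · subst hq'
          simp only [RCfg.ObjAt, List.mem_cons, List.not_mem_nil, or_false, exists_eq_or_imp,
            exists_eq_left, hop_r, hcl_r, hfr_r, reduceCtorEq, false_and, exists_false,
            or_false, Option.some.injEq, exists_eq_left'] at ho
          exact ⟨_, List.mem_cons_self, S₂.append S₁, by simp [Heap.set], by simp [Store.append, ho]⟩
        · simpa [RCfg.ObjAt, Heap.set, Heap.remove, hq, hq'] using ho
  have objAt_inv : ∀ {o l}, RCfg.ObjAt ⟨⟨r, S, F⟩ :: RS, hop.set r (S₂.append S₁),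
      hcl.remove r₁, hfr⟩ o l → ∃ l₀, l₀.move r₁ r = l ∧
        RCfg.ObjAt ⟨⟨r, S, F⟩ :: RS, hop, hcl, hfr⟩ o l₀ := by
    intro o l ho
    cases l with
    | root q => exact ⟨.root q, rfl, ho⟩
    | temp q ι' => exact ⟨.temp q ι', rfl, ho⟩
    | heap q ι' =>
      by_cases hq : q = r₁
      · subst hq
        simp [RCfg.ObjAt, Heap.set, Heap.remove, hne.symm, hop_r₁, hfr_r₁] at ho
      · by_cases hq' : q = r
        · subst hq'
          simp only [RCfg.ObjAt, List.mem_cons, List.not_mem_nil, or_false, exists_eq_or_imp,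
            exists_eq_left, Heap.set, Function.update_self, Heap.remove,
            Function.update_of_ne hq, hcl_r, hfr_r, reduceCtorEq, false_and, exists_false,
            or_false, Option.some.injEq, exists_eq_left', Store.append] at ho
          cases hS : S₂ ι' with
          | some o' =>
            simp only [hS, Option.some_or, Option.some.injEq] at ho
            exact ⟨.heap q ι', Loc.move_of_ne hq, hop, by simp, S₂, hop_r, ho ▸ hS⟩
          | none =>
            simp only [hS, Option.none_or] at ho
            exact ⟨.heap r₁ ι', by simp [Loc.move], hcl, by simp, S₁, hr, ho⟩
        · exact ⟨.heap q ι', Loc.move_of_ne hq,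
            by simpa [RCfg.ObjAt, Heap.set, Heap.remove, hq, hq'] using ho⟩
  have edge_move : ∀ {l f v}, RCfg.Edge ⟨⟨r, S, F⟩ :: RS, hop, hcl, hfr⟩ l f v →
      RCfg.Edge ⟨⟨r, S, F⟩ :: RS, hop.set r (S₂.append S₁), hcl.remove r₁, hfr⟩
        (l.move r₁ r) f v := by
    intro l f v he
    cases hl : l.oid with
    | none =>
      cases l with
      | root q => exact RCfg.edge_root.2 (RCfg.edge_root.1 he)
      | _ => cases hl
    | some ι' =>
      obtain ⟨o, ho, hv⟩ := (RCfg.edge_of_oid hl).1 he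
      exact (RCfg.edge_of_oid (Loc.move_oid.trans hl)).2 ⟨o, objAt_move ho, hv⟩
  have edge_inv : ∀ {l f v}, RCfg.Edge ⟨⟨r, S, F⟩ :: RS, hop.set r (S₂.append S₁),
      hcl.remove r₁, hfr⟩ l f v → ∃ l₀, l₀.move r₁ r = l ∧
        RCfg.Edge ⟨⟨r, S, F⟩ :: RS, hop, hcl, hfr⟩ l₀ f v := by
    intro l f v he
    cases hl : l.oid with
    | none =>
      cases l with
      | root q => exact ⟨.root q, rfl, RCfg.edge_root.2 (RCfg.edge_root.1 he)⟩
      | _ => cases hl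
    | some ι' =>
      obtain ⟨o, ho, hv⟩ := (RCfg.edge_of_oid hl).1 he
      obtain ⟨l₀, rfl, ho₀⟩ := objAt_inv ho
      exact ⟨l₀, rfl, (RCfg.edge_of_oid (Loc.move_oid.symm.trans hl)).2 ⟨o, ho₀, hv⟩⟩
  have hcl' : ∀ q, q ∈ (hcl.remove r₁).dom ↔ q ∈ hcl.dom ∧ q ≠ r₁ := fun q => by
    rcases eq_or_ne q r₁ with rfl | hq <;> simp [Heap.dom, Heap.remove, *]
  have iso_ne : ∀ {l f v}, RCfg.Edge ⟨⟨r, S, F⟩ :: RS, hop, hcl, hfr⟩ l f v → v.cap = .iso →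
      (loc v.oid).rid ≠ r₁ := by
    intro l f v he hv hq
    refine h.inv.sepFl _ _ _ he ⟨.iso, ι⟩ (by simp) (.inr ⟨hv, rfl, ?_, ?_⟩)
    · simp [RCfg.world, hq, hlι]
    · simpa only [RCfg.world, hq] using hr₁_fr
  -- Only `iso` can cross into a closed region, and any such reference into `r₁` would conflict with
  -- the held one.
  have into : ∀ {l f v}, RCfg.Edge ⟨⟨r, S, F⟩ :: RS, hop, hcl, hfr⟩ l f v →
      (loc v.oid).rid = r₁ → l.rid = r₁ := by
    rintro l f v he hv
    obtain ⟨-, ok⟩ := h.inv.ok _ _ _ he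
    have hi := iso_ne he
    obtain ⟨k, ιv⟩ := v
    cases k
    · exact (hi rfl hv).elim
    · exact ok.1.trans hv
    · exact ok.1.trans hv
    · exact ok.1.trans hv
    · exact (hr₁_open (hv ▸ ok.1.left)).elim
    · exact (hr₁_fr (hv ▸ ok.1)).elim
  have hvar : ∀ {l v}, (RCfg.world ⟨⟨r, S, F⟩ :: RS, hop, hcl, hfr⟩ loc).Ok l v →
      v.cap = .var → v.oid ≠ ι := by
    rintro l v ok hv rfl
    have := ok.isTemp_of_var hv
    simp [RCfg.world, hlι] at this
  refine ⟨⟨h.wt.frames, ?_, ?_, ?_, h.wt.rids, ?_, ?_, ?_, ?_⟩, ?_, ?_, ?_⟩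
  · intro l o ι' hl ho
    obtain ⟨l₀, rfl, ho₀⟩ := objAt_inv ho
    exact h.wt.objs l₀ o ι' (Loc.move_oid.symm.trans hl) ho₀
  · intro ι' hι'
    obtain ⟨l, o, hl, ho⟩ := h.wt.dom ι' hι'
    exact ⟨_, o, Loc.move_oid.trans hl, objAt_move ho⟩
  · intro l o ι' hl ho
    obtain ⟨l₀, rfl, ho₀⟩ := objAt_inv ho
    rw [h.wt.locs l₀ o ι' (Loc.move_oid.symm.trans hl) ho₀]
  · intro q
    rw [h.wt.opened q]
    rcases eq_or_ne q r with rfl | hq <;> simp [Heap.set, *]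
  · intro q hq
    rcases eq_or_ne q r₁ with rfl | hq₁
    · simp [Heap.remove]
    · simp only [Heap.remove, Function.update_of_ne hq₁]
      rcases eq_or_ne q r with rfl | hq₂
      · exact hcl_r
      · exact h.wt.disjoint₁ q (by simpa [Heap.set, hq₂] using hq)
  · intro q hq
    rcases eq_or_ne q r with rfl | hq₂
    · exact hfr_r
    · exact h.wt.disjoint₂ q (by simpa [Heap.set, hq₂] using hq)
  · intro q hq
    rcases eq_or_ne q r₁ with rfl | hq₁
    · exact hfr_r₁
    · exact h.wt.disjoint₃ q (by simpa [Heap.remove, hq₁] using hq)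
  · have ht := (h.flTy (⟨.iso, ι⟩, t) (by simp)).mapCap fun k => if k = .iso then .mutable else k
    simpa [Ty.makeMut] using ht
  · refine h.inv.map (Loc.move r₁ r) (fun v v' => (v' = v ∧ (v.cap = .var → v.oid ≠ ι) ∧
      (v.cap = .iso → (loc v.oid).rid ≠ r₁)) ∨ (v = ⟨.iso, ι⟩ ∧ v' = ⟨.mutable, ι⟩)) ?_ ?_ ?_
    · have hm : ∀ v : Val, (loc v.oid).rid ≠ r₁ → (loc v.oid).move r₁ r = loc v.oid :=
        fun v => Loc.move_of_ne
      rintro v₁ v₁' v₂ v₂' (⟨rfl, h₁, h₁'⟩ | ⟨rfl, rfl⟩) (⟨rfl, h₂, h₂'⟩ | ⟨rfl, rfl⟩) <;>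
        simp only [World.Conf, RCfg.world] <;> grind
    · intro l' f v he'
      obtain ⟨l, rfl, he⟩ := edge_inv he'
      have ok₀ := h.inv.ok _ _ _ he
      refine ⟨?_, l, v, rfl, he, .inl ⟨rfl, hvar ok₀, iso_ne he⟩⟩
      obtain ⟨hd, ok⟩ := ok₀
      -- A reference into `r₁` has both ends moved, one out of `r₁` only its source; all others are
      -- unchanged except that `r₁` is no longer closed.
      by_cases hv : (loc v.oid).rid = r₁
      · have hl := into he hv
        have hh := RCfg.Edge.isHeap he (hl ▸ hr₁_open)
        have hi := iso_ne he
        obtain ⟨k, ιv⟩ := v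
        obtain ⟨q, ιl, rfl⟩ := hh
        obtain rfl : q = r₁ := hl
        cases k
        · exact (hi rfl hv).elim
        · exact (Loc.not_isRoot_heap _ _ ok.2.1).elim
        · obtain ⟨q', ιv', hq'⟩ := ok.2
          simp only [RCfg.world] at hq'
          simp only at hv
          rw [hq'] at hv
          obtain rfl : q' = q := hv
          simp only [World.Ok, World.CapOk, RCfg.world, hq', Loc.move, if_true, Loc.rid_heap,
            Loc.isHeap_heap, and_self, and_true]
          exact id
        · exact (ok.2.1 (Loc.isHeap_heap _ _)).elim
        · exact (ok.2.1 (Loc.isHeap_heap _ _)).elim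
        · exact (hr₁_fr (hv ▸ ok.1)).elim
      · by_cases hl : l.rid = r₁
        · have hh := RCfg.Edge.isHeap he (hl ▸ hr₁_open)
          obtain ⟨k, ιv⟩ := v
          simp only [World.Ok, RCfg.world, Loc.move_of_ne hv]
          obtain ⟨q, ιl, rfl⟩ := hh
          obtain rfl : q = r₁ := hl
          refine ⟨?_, ?_⟩
          · simp only [Loc.move, if_true, Loc.rid_heap]
            exact fun h' => (wf.not_fr r hr_open h').elim
          cases k
          · refine ⟨?_, .inl ((hcl' _).2 ⟨?_, hv⟩), ok.2.2⟩
            · simp only [Loc.move, if_true, Loc.rid_heap]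
              rintro rfl
              rcases ok.2.1 with ok' | ok' | ok'
              · exact wf.not_cl _ hr_open ok'
              · exact hr₁_open ok'.left
              · exact hr₁_fr ok'.2
            · rcases ok.2.1 with ok' | ok' | ok'
              · exact ok'
              · exact (hr₁_open ok'.left).elim
              · exact (hr₁_fr ok'.2).elim
          · exact (Loc.not_isRoot_heap _ _ ok.2.1).elim
          · exact (hv ok.1.symm).elim
          · exact (ok.2.1 (Loc.isHeap_heap _ _)).elim
          · exact (ok.2.1 (Loc.isHeap_heap _ _)).elim
          · exact ok
        · obtain ⟨k, ιv⟩ := v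
          simp only [World.Ok, RCfg.world, Loc.move_of_ne hv, Loc.move_of_ne hl]
          refine ⟨hd, ?_⟩
          cases k
          · exact ⟨ok.1, ok.2.1.imp_left fun h' => (hcl' _).2 ⟨h', hv⟩, ok.2.2⟩
          all_goals exact ok
    · refine .cons ⟨.inr ⟨rfl, rfl⟩, fun h' => (wf.not_fr r hr_open h').elim, ?_⟩ .nil
      simp [World.CapOk, World.top, RCfg.world, hlι, Loc.move]
  · intro a b hab
    obtain ⟨k, ι₁, ι₂, e₁, e₂, hr'⟩ := h.entry a b hab
    refine ⟨k, ι₁, ι₂, edge_move e₁, edge_move e₂, ?_⟩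
    -- The region of an entry is open and therefore different from `r₁`, so the end of the path is
    -- not moved.
    have ha : a.rid ∈ (RCfg.world ⟨⟨r, S, F⟩ :: RS, hop, hcl, hfr⟩ loc).rids := by
      have := hab.lt.subset (a := a.rid) (by simp)
      rwa [← h.wt.order_rids]
    change ((loc ι₂).move r₁ r).rid = a.rid
    rw [Loc.move_of_ne, hr']
    rw [hr']
    rintro rfl
    exact hr₁_open ha

/-! Entering a region -/

/-- The static choice looks at the type, the dynamic one at the value. They agree because `paused ⊙
iso` is undefined: a union with an `iso` member can be captured only if all its members are `iso`.
-/
theorem CapturedTy.hasTy {v v' : Val} {t t' : Ty} (h : CapturedTy t t') (hv : HasTy Δ v t)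
    (hc : captureVal v = some v') : HasTy Δ v' t' := by
  rcases h with ⟨h₁, rfl⟩ | ⟨-, h₂⟩
  · have : v.cap = .iso := by simpa using hv.cap_mem h₁
    simp only [captureVal, this, if_true, Option.some.injEq] at hc
    exact hc ▸ hv
  · obtain ⟨CL, hCL, hs⟩ := hv
    obtain ⟨k, hk, hs'⟩ := hs.vpa h₂
    have : v.cap ≠ .iso := by
      intro h'
      rw [h'] at hk
      cases hk
    simp only [captureVal, this, if_false, hk, Option.map_some, Option.some.injEq] at hc
    exact hc ▸ ⟨CL, hCL, hs'⟩

theorem captureVal_cases {v v' : Val} (h : captureVal v = some v') :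
    (v.cap = .iso ∧ v' = v) ∨ (v.cap = .imm ∧ v' = v) ∨
      ((v.cap = .mutable ∨ v.cap = .tmp ∨ v.cap = .var ∨ v.cap = .paused) ∧
        v' = ⟨.paused, v.oid⟩) := by
  obtain ⟨k, ι⟩ := v
  cases k <;> simp [captureVal, Cap.vpa] at h <;> simp [h]

/-- Enters with a frame that is still empty, while the captured values are held. The entered region
becomes the newest one; the field used as the path is the only `iso` reference into it and now goes
from an older to a newer open region. Captured values are `iso` into other closed regions, `imm`, or
`paused` into regions that have just become older. -/
theorem OK.push {vs vs' : List Val} {ts ts' : List Ty} {r' : Reg} {S' : Store} {y f : Name}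
    {ky : Cap} {ιy ι' : Oid}
    (h : OK CT (⟨Γ, a, b⟩ :: Γs) Δ loc ⟨⟨r, S, F⟩ :: RS, hop, hcl, hfr⟩ (vs.zip ts))
    (hlen : vs.length = ts.length) (hvs : vs.map captureVal = vs'.map some)
    (hts : List.Forall₂ CapturedTy ts ts') (hy : F.Has y ⟨ky, ιy⟩) (hky : ky.isOpen)
    (hl : l.oid = some ιy) (ho : RCfg.ObjAt ⟨⟨r, S, F⟩ :: RS, hop, hcl, hfr⟩ o l)
    (hf : o.fields.Has f ⟨.iso, ι'⟩) (hr' : hcl r' = some S') (hι' : (S' ι').isSome) :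
    OK CT (⟨Ctx.empty, y, f⟩ :: ⟨Γ, a, b⟩ :: Γs) Δ loc
      ⟨⟨r', Store.empty, Vars.empty⟩ :: ⟨r, S, F⟩ :: RS, hop.set r' S', hcl.remove r', hfr⟩
      (vs'.zip ts') := by
  have wf := h.wt.world_wf
  have hlι : loc ι' = .heap r' ι' := h.wt.loc_closed hr' hι'
  have hr'_cl : r' ∈ hcl.dom := by simp [Heap.dom, hr']
  have hr'_open : r' ∉ (RCfg.world ⟨⟨r, S, F⟩ :: RS, hop, hcl, hfr⟩ loc).rids := fun h' =>
    wf.not_cl _ h' hr'_cl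
  have hr'_fr : r' ∉ hfr.dom := wf.cl_fr r' hr'_cl
  have hr_open : r ∈ (RCfg.world ⟨⟨r, S, F⟩ :: RS, hop, hcl, hfr⟩ loc).rids := by
    simp [RCfg.world]
  have hop_r' : hop r' = none := by
    have := mt (h.wt.opened r').2 hr'_open
    simpa using this
  have hfr_r' : hfr r' = none := by simpa [Heap.dom] using hr'_fr
  have hobj : ∀ {o l}, RCfg.ObjAt ⟨⟨r', Store.empty, Vars.empty⟩ :: ⟨r, S, F⟩ :: RS,
      hop.set r' S', hcl.remove r', hfr⟩ o l ↔
      RCfg.ObjAt ⟨⟨r, S, F⟩ :: RS, hop, hcl, hfr⟩ o l := by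
    intro o l
    cases l with
    | root => simp [RCfg.ObjAt]
    | temp q ι => simp [RCfg.ObjAt, Store.empty]
    | heap q ι =>
      rcases eq_or_ne q r' with rfl | hq
      · simp [RCfg.ObjAt, Heap.set, Heap.remove, hop_r', hr', hfr_r']
      · simp [RCfg.ObjAt, Heap.set, Heap.remove, hq]
  have hedge : ∀ {l g w}, RCfg.Edge ⟨⟨r', Store.empty, Vars.empty⟩ :: ⟨r, S, F⟩ :: RS,
      hop.set r' S', hcl.remove r', hfr⟩ l g w ↔
      RCfg.Edge ⟨⟨r, S, F⟩ :: RS, hop, hcl, hfr⟩ l g w := by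
    intro l g w
    by_cases hl : l.IsRoot
    · obtain ⟨q, rfl⟩ := hl
      simp [RCfg.edge_root, Vars.Has, Vars.empty]
    · exact RCfg.edge_congr (fun o l => hobj) hl
  have hcl' : ∀ q, q ∈ (hcl.remove r').dom ↔ q ∈ hcl.dom ∧ q ≠ r' := fun q => by
    rcases eq_or_ne q r' with rfl | hq <;> simp [Heap.dom, Heap.remove, *]
  have hrids : (RCfg.world ⟨⟨r', Store.empty, Vars.empty⟩ :: ⟨r, S, F⟩ :: RS,
      hop.set r' S', hcl.remove r', hfr⟩ loc).rids =
      r' :: (RCfg.world ⟨⟨r, S, F⟩ :: RS, hop, hcl, hfr⟩ loc).rids := rfl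
  have lt_new : ∀ {q}, q ∈ (RCfg.world ⟨⟨r, S, F⟩ :: RS, hop, hcl, hfr⟩ loc).rids →
      World.Lt (RCfg.world ⟨⟨r', Store.empty, Vars.empty⟩ :: ⟨r, S, F⟩ :: RS,
        hop.set r' S', hcl.remove r', hfr⟩ loc) q r' := fun hq =>
    (World.lt_iff hrids).2 (.inl ⟨rfl, hq⟩)
  have lt_old : ∀ {q q'}, (RCfg.world ⟨⟨r, S, F⟩ :: RS, hop, hcl, hfr⟩ loc).Lt q q' →
      World.Lt (RCfg.world ⟨⟨r', Store.empty, Vars.empty⟩ :: ⟨r, S, F⟩ :: RS,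
        hop.set r' S', hcl.remove r', hfr⟩ loc) q q' := fun hq =>
    (World.lt_iff hrids).2 (.inr hq)
  have ey := h.wt.edge_top.2 hy
  have hly : loc ιy = l := h.wt.locs l o ιy hl ho
  have ef : RCfg.Edge ⟨⟨r, S, F⟩ :: RS, hop, hcl, hfr⟩ l f ⟨.iso, ι'⟩ :=
    (RCfg.edge_of_oid hl).2 ⟨o, ho, hf⟩
  -- The variable `y` is read through a capability that only points into open regions, so the object
  -- owning the path lies in one.
  have hl_open : l.rid ∈ (RCfg.world ⟨⟨r, S, F⟩ :: RS, hop, hcl, hfr⟩ loc).rids := by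
    have ok := (h.inv.ok _ _ _ ey).2
    simp only [RCfg.world, hly] at ok
    rcases hky with rfl | rfl | rfl | rfl
    · exact ok.1 ▸ hr_open
    · exact ok.1 ▸ hr_open
    · exact ok.1 ▸ hr_open
    · exact ok.1.left
  have hlen' : vs.length = vs'.length := by simpa using congrArg List.length hvs
  have hlen'' : vs'.length = ts'.length := by rw [← hlen', hlen, hts.length_eq]
  have hcap : ∀ i (h₁ : i < vs.length) (h₂ : i < vs'.length),
      captureVal vs[i] = some vs'[i] := by
    intro i h₁ h₂
    have := List.getElem_of_eq hvs (i := i) (by simpa using h₁)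
    simpa using this
  have hmap : (vs.zip ts).map Prod.fst = vs := List.map_fst_zip hlen.le
  have hmap' : (vs'.zip ts').map Prod.fst = vs' := List.map_fst_zip hlen''.le
  have hinv := h.inv
  rw [hmap] at hinv
  refine ⟨⟨.cons (VarsTy.empty Δ) h.wt.frames, ?_, ?_, ?_, ?_, ?_, ?_, ?_, ?_⟩, ?_, ?_, ?_⟩
  · exact fun l o ι hl ho => h.wt.objs l o ι hl (hobj.1 ho)
  · exact fun ι hι => by simpa only [hobj] using h.wt.dom ι hι
  · exact fun l o ι hl ho => h.wt.locs l o ι hl (hobj.1 ho)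
  · exact List.nodup_cons.2 ⟨hr'_open, h.wt.rids⟩
  · intro q
    have := h.wt.opened q
    rcases eq_or_ne q r' with rfl | hq
    · simp [Heap.set]
    · simpa [Heap.set, hq] using this
  · intro q hq
    rcases eq_or_ne q r' with rfl | hqr
    · simp [Heap.remove]
    · simp only [Heap.set, Function.update_of_ne hqr] at hq
      simpa [Heap.remove, hqr] using h.wt.disjoint₁ q hq
  · intro q hq
    rcases eq_or_ne q r' with rfl | hqr
    · exact hfr_r'
    · simp only [Heap.set, Function.update_of_ne hqr] at hq
      exact h.wt.disjoint₂ q hq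
  · intro q hq
    rcases eq_or_ne q r' with rfl | hqr
    · exact hfr_r'
    · simp only [Heap.remove, Function.update_of_ne hqr] at hq
      exact h.wt.disjoint₃ q hq
  · intro p hp
    obtain ⟨i, hi, rfl⟩ := List.getElem_of_mem hp
    simp only [List.length_zip, lt_inf_iff] at hi
    simp only [List.getElem_zip]
    have h₁ : i < vs.length := hlen' ▸ hi.1
    have h₂ : i < ts.length := hlen ▸ h₁
    have hv := (List.forall₂_iff_get.1 (forall₂_of_zip hlen h.flTy)).2 i h₁ h₂
    exact ((List.forall₂_iff_get.1 hts).2 i h₂ hi.2).hasTy hv (hcap i h₁ hi.1)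
  · rw [hmap']
    refine hinv.map id (fun v v' => v.oid = v'.oid ∧ (v'.cap = .iso → v.cap = .iso) ∧
      (v'.cap = .var → v.cap = .var)) ?_ ?_ ?_
    · rintro v₁ v₁' v₂ v₂' ⟨e₁, i₁, j₁⟩ ⟨e₂, i₂, j₂⟩ hc
      simp only [World.Conf, RCfg.world, ← e₁, ← e₂] at hc ⊢
      rcases hc with ⟨hc, he⟩ | ⟨hc₁, hc₂, hc₃⟩
      · exact .inl ⟨hc.imp j₁ j₂, he⟩
      · exact .inr ⟨i₁ hc₁, i₂ hc₂, hc₃⟩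
    · intro l₀ g w he
      rw [hedge] at he
      obtain ⟨hd, ok⟩ := h.inv.ok _ _ _ he
      refine ⟨⟨hd, ?_⟩, l₀, w, rfl, he, rfl, id, id⟩
      -- Any `iso` reference into `r'` is the path field itself.
      have hc := fun hc hr => h.inv.sep _ _ _ _ _ _ he ef (.inr ⟨hc, rfl, hr⟩)
      obtain ⟨k, ιw⟩ := w
      cases k
      · refine ⟨ok.1, ?_, ok.2.2⟩
        rcases ok.2.1 with ok' | ok' | ok'
        · by_cases hq : (loc ιw).rid = r'
          · obtain ⟨rfl, -⟩ := hc rfl ⟨by simp [RCfg.world, hq, hlι],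
              by simpa only [RCfg.world, hq] using hr'_fr⟩
            refine .inr (.inl ?_)
            simp only [RCfg.world, hq]
            exact lt_new hl_open
          · exact .inl ((hcl' _).2 ⟨ok', hq⟩)
        · exact .inr (.inl (lt_old ok'))
        · exact .inr (.inr ok')
      · exact ok
      · exact ok
      · exact ok
      · exact ⟨lt_old ok.1, ok.2⟩
      · exact ok
    · rw [List.forall₂_iff_get]
      refine ⟨hlen', fun i h₁ h₂ => ?_⟩
      have hcv := hcap i h₁ h₂
      have hm : vs[i] ∈ vs := List.getElem_mem h₁
      simp only [List.get_eq_getElem]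
      generalize vs[i] = v at hcv hm
      generalize vs'[i] = v' at hcv
      obtain ⟨hd, ok⟩ := hinv.okFl v hm
      have hns := hinv.sepFl _ _ _ ef v hm
      have htop : (RCfg.world ⟨⟨r, S, F⟩ :: RS, hop, hcl, hfr⟩ loc).top = .root r := rfl
      rw [htop] at ok
      have htop' : (RCfg.world ⟨⟨r', Store.empty, Vars.empty⟩ :: ⟨r, S, F⟩ :: RS,
        hop.set r' S', hcl.remove r', hfr⟩ loc).top = .root r' := rfl
      rw [htop']
      obtain ⟨k, ιv⟩ := v
      have hdr : ∀ {P : Prop}, (Loc.root r').rid ∈ (RCfg.world ⟨⟨r', Store.empty, Vars.empty⟩ ::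
        ⟨r, S, F⟩ :: RS, hop.set r' S', hcl.remove r', hfr⟩ loc).fr → P := fun h' =>
        (hr'_fr h').elim
      rcases captureVal_cases hcv with ⟨rfl, rfl⟩ | ⟨rfl, rfl⟩ | ⟨hk, rfl⟩
      · refine ⟨⟨rfl, id, id⟩, hdr, ?_⟩
        -- A captured `iso` value into the entered region would conflict with the path field.
        have hq : (loc ιv).rid ≠ r' := fun hq => hns (.inr ⟨rfl, rfl,
          by simp [RCfg.world, hlι, hq], by simpa [RCfg.world, hlι] using hr'_fr⟩)
        refine ⟨hq.symm, .inl ((hcl' _).2 ⟨?_, hq⟩), ok.2.2⟩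
        rcases ok.2.1 with ok' | ok' | ok'
        · exact ok'
        · exact (World.not_top_lt (q := r) (L := RS.map Frame.rid) rfl wf.nodup _ ok').elim
        · exact (wf.not_fr r hr_open ok'.2).elim
      · exact ⟨⟨rfl, id, id⟩, hdr, ok⟩
      · refine ⟨⟨rfl, by simp, by simp⟩, hdr, ?_⟩
        simp only at hk
        refine ⟨?_, by simp, ?_⟩
        · rcases hk with rfl | rfl | rfl | rfl
          · exact lt_new (ok.1 ▸ hr_open)
          · exact lt_new (ok.1 ▸ hr_open)
          · exact lt_new (ok.1 ▸ hr_open)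
          · exact lt_new ok.1.left
        · rcases hk with rfl | rfl | rfl | rfl
          · exact ok.2.not_isRoot
          · exact ok.2.2.not_isRoot
          · exact ok.2.2.not_isRoot
          · exact ok.2.2
  · intro a' b' hab
    -- The only new adjacent pair consists of the new frame and its predecessor, and its path is the
    -- one just used.
    rcases Order.adj_cons.1 (show Order.Adj (⟨r', y, f⟩ :: order (⟨Γ, a, b⟩ :: Γs)
      ⟨⟨r, S, F⟩ :: RS, hop, hcl, hfr⟩) a' b' from hab) with ⟨rfl, ρ, hρ⟩ | hab
    · cases hρ
      exact ⟨ky, ιy, ι', hedge.2 ey, hedge.2 (hly ▸ ef), by rw [hlι]; rfl⟩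
    · obtain ⟨k, ι₁, ι₂, e₁, e₂, hr⟩ := h.entry a' b' hab
      exact ⟨k, ι₁, ι₂, hedge.2 e₁, hedge.2 e₂, hr⟩

/-! Leaving a region -/

/-- Nothing that remains refers to the temporaries of the discarded frame, so they can be forgotten.
The region becomes closed, which is admissible for `iso` references into it, and no `paused`
reference into it remains since no newer frame exists. -/
theorem OK.pop {L : Layer} {fr' fr : Frame} {Sop : Store} {v : Val} {t : Ty}
    (h : OK CT (L :: Γs) Δ loc ⟨fr' :: fr :: RS, hop, hcl, hfr⟩ [(v, t)])
    (hop_r : hop fr'.rid = some Sop) (hv : v.cap = .iso ∨ v.cap = .imm) :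
    ∃ Δ', OK CT Γs Δ' loc
      ⟨fr :: RS, hop.remove fr'.rid, hcl.set fr'.rid Sop, hfr⟩ [(v, t)] := by
  classical
  have wf := h.wt.world_wf
  set c₀ : RCfg := ⟨fr' :: fr :: RS, hop, hcl, hfr⟩ with hc₀
  set c₁ : RCfg := ⟨fr :: RS, hop.remove fr'.rid, hcl.set fr'.rid Sop, hfr⟩ with hc₁
  have hcl_r : hcl fr'.rid = none := h.wt.disjoint₁ fr'.rid (by simp [hc₀, hop_r])
  have hfr_r : hfr fr'.rid = none := h.wt.disjoint₂ fr'.rid (by simp [hc₀, hop_r])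
  have hr_open : fr'.rid ∈ (c₀.world loc).rids := by simp [RCfg.world, hc₀]
  have hr_cl : fr'.rid ∉ hcl.dom := by simp [Heap.dom, hcl_r]
  have hr_fr : fr'.rid ∉ hfr.dom := by simp [Heap.dom, hfr_r]
  have hne : ∀ q ∈ (fr :: RS).map Frame.rid, q ≠ fr'.rid := by
    rintro q hq rfl
    exact (List.nodup_cons.1 h.wt.rids).1 hq
  have hrids : (c₀.world loc).rids = fr'.rid :: (fr :: RS).map Frame.rid := rfl
  have hobj : ∀ {o l}, c₁.ObjAt o l ↔
      c₀.ObjAt o l ∧ ∀ ι, l ≠ .temp fr'.rid ι := by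
    intro o l
    cases l with
    | root => simp [RCfg.ObjAt]
    | temp q ι =>
      simp only [RCfg.ObjAt, hc₀, hc₁, Loc.temp.injEq, ne_eq, not_and]
      constructor
      · rintro ⟨f, hf, rfl, hfo⟩
        exact ⟨⟨f, List.mem_cons_of_mem _ hf, rfl, hfo⟩, fun _ h' =>
          (hne f.rid (List.mem_map_of_mem hf) h').elim⟩
      · rintro ⟨⟨f, hf, rfl, hfo⟩, hn⟩
        rcases List.mem_cons.1 hf with rfl | hf
        · exact (hn ι rfl rfl).elim
        · exact ⟨f, hf, rfl, hfo⟩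
    | heap q ι =>
      rcases eq_or_ne q fr'.rid with rfl | hq
      · simp [RCfg.ObjAt, hc₀, hc₁, Heap.set, Heap.remove, hop_r, hcl_r, hfr_r]
      · simp [RCfg.ObjAt, hc₀, hc₁, Heap.set, Heap.remove, hq]
  have hedge : ∀ {l g w}, c₁.Edge l g w ↔ c₀.Edge l g w ∧ (∀ ι, l ≠ .temp fr'.rid ι) ∧
      l ≠ .root fr'.rid := by
    intro l g w
    cases l with
    | root q =>
      simp only [RCfg.edge_root, hc₀, hc₁, ne_eq, reduceCtorEq, not_false_eq_true, implies_true,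
        true_and, Loc.root.injEq]
      constructor
      · rintro ⟨f, hf, rfl, hfo⟩
        exact ⟨⟨f, List.mem_cons_of_mem _ hf, rfl, hfo⟩, hne f.rid (List.mem_map_of_mem hf)⟩
      · rintro ⟨⟨f, hf, rfl, hfo⟩, hn⟩
        rcases List.mem_cons.1 hf with rfl | hf
        · exact (hn rfl).elim
        · exact ⟨f, hf, rfl, hfo⟩
    | temp q ι =>
      simp only [RCfg.edge_of_oid (l := .temp q ι) rfl, hobj, ne_eq, Loc.temp.injEq, not_and,
        reduceCtorEq, not_false_eq_true, and_true]
      exact ⟨fun ⟨o, ⟨h₁, h₂⟩, h₃⟩ => ⟨⟨o, h₁, h₃⟩, h₂⟩,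
        fun ⟨⟨o, h₁, h₃⟩, h₂⟩ => ⟨o, ⟨h₁, h₂⟩, h₃⟩⟩
    | heap q ι => simp [RCfg.edge_of_oid (l := .heap q ι) rfl, hobj]
  -- A temporary is only the target of `tmp` and `var` references from its own frame or temporary
  -- store, and of `paused` ones from newer regions. The former disappear with the frame, and there
  -- are no newer regions.
  have hdst : ∀ {l g w}, c₁.Edge l g w → ∀ ι, loc w.oid ≠ .temp fr'.rid ι := by
    intro l g w he ι hl
    obtain ⟨he, hn₁, hn₂⟩ := hedge.1 he
    have ok := (h.inv.ok _ _ _ he).2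
    obtain ⟨k, ιw⟩ := w
    simp only [RCfg.world] at hl ok
    rw [hl] at ok
    have hsrc : l.rid = fr'.rid → ¬ l.IsHeap → False := by
      intro h₁ h₂
      cases l with
      | root => exact hn₂ (congrArg _ h₁)
      | temp _ ι' => exact hn₁ ι' (congrArg (Loc.temp · ι') h₁)
      | heap => simp at h₂
    cases k
    · exact Loc.not_isHeap_temp _ _ ok.2.2
    · exact hsrc ok.1 fun h' => h'.not_isRoot ok.2.1
    · exact Loc.not_isHeap_temp _ _ ok.2
    · exact hsrc ok.1 ok.2.1
    · exact World.not_top_lt hrids wf.nodup _ ok.1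
    · exact Loc.not_isHeap_temp _ _ ok.2
  have hcl' : ∀ q, q ∈ (hcl.set fr'.rid Sop).dom ↔ q ∈ hcl.dom ∨ q = fr'.rid := fun q => by
    rcases eq_or_ne q fr'.rid with rfl | hq <;> simp [Heap.dom, Heap.set, *]
  have lt_old : ∀ {q q'}, (c₀.world loc).Lt q q' → q' ≠ fr'.rid → (c₁.world loc).Lt q q' :=
    fun hq hq' => ((World.lt_iff hrids).1 hq).resolve_left fun h' => hq' h'.1
  -- The typing has to be defined exactly on the stored objects, so it is restricted to those that
  -- remain.
  let Δ' : OidCtx := fun ι => if ∃ ι', loc ι = .temp fr'.rid ι' then none else Δ ι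
  have hΔ : ∀ ι, (∀ ι', loc ι ≠ .temp fr'.rid ι') → Δ' ι = Δ ι := fun ι hι =>
    if_neg (by simpa using hι)
  obtain ⟨hfd, hok⟩ := h.inv.okFl v (by simp)
  have hvh : (loc v.oid).IsHeap := by
    rcases hv with hv | hv <;> rw [hv] at hok
    · exact hok.2.2
    · exact hok.2
  refine ⟨Δ', ⟨?_, ?_, ?_, ?_, ?_, ?_, ?_, ?_, ?_⟩, ?_, ?_, ?_⟩
  · refine forall₂_imp_mem (List.forall₂_cons.1 h.wt.frames).2 fun L f hf hF => ?_
    exact hF.congr fun x w hw => hΔ _ (hdst (RCfg.edge_root.2 ⟨f, hf, rfl, hw⟩))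
  · intro l o ι hl ho
    obtain ⟨ho', hn⟩ := hobj.1 ho
    obtain ⟨CL, h₁, h₂, h₃⟩ := h.wt.objs l o ι hl ho'
    refine ⟨CL, ?_, h₂, h₃.congr fun x w hw =>
      hΔ _ (hdst ((RCfg.edge_of_oid hl).2 ⟨o, ho, hw⟩))⟩
    rw [hΔ, h₁]
    rw [h.wt.locs l o ι hl ho']
    exact hn
  · intro ι hι
    by_cases hn : ∃ ι', loc ι = .temp fr'.rid ι'
    · simp [Δ', hn] at hι
    · simp only [Δ', hn, if_false] at hι
      obtain ⟨l, o, hl, ho⟩ := h.wt.dom ι hι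
      rw [h.wt.locs l o ι hl ho] at hn
      exact ⟨l, o, hl, hobj.2 ⟨ho, by simpa using hn⟩⟩
  · exact fun l o ι hl ho => h.wt.locs l o ι hl (hobj.1 ho).1
  · exact (List.nodup_cons.1 h.wt.rids).2
  · intro q
    rcases eq_or_ne q fr'.rid with rfl | hq
    · simpa [hc₁, Heap.remove] using fun h' => hne _ h' rfl
    · have := h.wt.opened q
      simpa [hc₀, hc₁, Heap.remove, hq] using this
  · intro q hq
    rcases eq_or_ne q fr'.rid with rfl | hqr
    · simp [hc₁, Heap.remove] at hq
    · simp only [hc₁, Heap.remove, Heap.set, Function.update_of_ne hqr] at hq ⊢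
      exact h.wt.disjoint₁ q hq
  · intro q hq
    rcases eq_or_ne q fr'.rid with rfl | hqr
    · exact hfr_r
    · simp only [hc₁, Heap.remove, Function.update_of_ne hqr] at hq
      exact h.wt.disjoint₂ q hq
  · intro q hq
    rcases eq_or_ne q fr'.rid with rfl | hqr
    · exact hfr_r
    · simp only [hc₁, Heap.set, Function.update_of_ne hqr] at hq
      exact h.wt.disjoint₃ q hq
  · simp only [List.mem_singleton, forall_eq]
    refine (h.flTy (v, t) (by simp)).congr (hΔ _ fun ι' hl => ?_)
    rw [hl] at hvh
    exact Loc.not_isHeap_temp _ _ hvh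
  · refine h.inv.map id (fun v v' => v' = v) ?_ ?_ ?_
    · rintro v₁ _ v₂ _ rfl rfl hc
      exact hc
    · intro l g w he
      obtain ⟨he', hn₁, hn₂⟩ := hedge.1 he
      obtain ⟨hd, ok⟩ := h.inv.ok _ _ _ he'
      refine ⟨⟨hd, ?_⟩, l, w, rfl, he', rfl⟩
      obtain ⟨k, ιw⟩ := w
      cases k
      · refine ⟨ok.1, ?_, ok.2.2⟩
        by_cases hq : (loc ιw).rid = fr'.rid
        · exact .inl ((hcl' _).2 (.inr hq))
        · rcases ok.2.1 with ok' | ok' | ok'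
          · exact .inl ((hcl' _).2 (.inl ok'))
          · exact .inr (.inl (lt_old ok' hq))
          · exact .inr (.inr ok')
      · exact ok
      · exact ok
      · exact ok
      · refine ⟨lt_old ok.1 fun hq => ?_, ok.2⟩
        cases l with
        | root => exact hn₂ (congrArg _ hq)
        | temp _ ι' => exact hn₁ ι' (congrArg (Loc.temp · ι') hq)
        | heap => exact ok.2.1 (Loc.isHeap_heap _ _)
      · exact ok
    · refine .cons ⟨rfl, ?_, ?_⟩ .nil
      · have : fr.rid ∉ hfr.dom := wf.not_fr fr.rid (by simp [RCfg.world, hc₀])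
        exact fun h' => (this h').elim
      · obtain ⟨k, ιv⟩ := v
        rcases hv with hv | hv <;> simp only at hv <;> subst hv
        -- The value was held by the newest frame, so it leads into a region that was already
        -- closed; it remains valid in the older frame.
        · have hcl : (loc ιv).rid ∈ hcl.dom := by
            rcases hok.2.1 with ok' | ok' | ok'
            · exact ok'
            · exact (World.not_top_lt hrids wf.nodup _ ok').elim
            · exact (hr_fr ok'.2).elim
          refine ⟨?_, .inl ((hcl' _).2 (.inl hcl)), hok.2.2⟩
          intro h'
          exact wf.not_cl fr.rid (by simp [RCfg.world, hc₀]) (by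
            rw [show fr.rid = (loc ιv).rid from h']; exact hcl)
        · exact hok
  · intro a b hab
    refine h.entry_mono (E := c₁.Edge) (fun l g w he hl => hedge.2 ⟨he, ?_, ?_⟩) a b
      (Order.adj_cons.2 (.inr hab))
    · rintro ι rfl
      exact hl rfl
    · rintro rfl
      exact hl rfl

/-! Well-typed writes -/

/-- Writing a field without changing its type. -/
theorem WT.put_set {f : Name} {v : Val} {CL : STy} {t : Ty} (h : WT CT Γs Δ loc c)
    (hp : c.Put c' l (o.set f v)) (hl : l.oid = some ι) (ho : c.ObjAt o l)
    (hCL : Δ ι = some CL) (ht : CT.ftype CL f = some t) (hv : HasTy Δ v t) :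
    WT CT Γs Δ loc c' := by
  refine h.put hp hl h.frames (fun l' o' ι' _ => h.objs l' o' ι') ?_ (fun _ => .inl)
    (fun _ _ => rfl) (h.locs l o ι hl ho) fun l' o' hne ho' hl' => hne ?_
  · obtain ⟨CL', h₁, h₂, h₃⟩ := h.objs l o ι hl ho
    obtain rfl : CL = CL' := by simpa using hCL.symm.trans h₁
    exact ⟨CL, hCL, h₂, h₃.vars_set (show CT.ctxOf CL f = _ by
      simp [ClassTable.ctxOf, ht]) hv⟩
  · rw [← h.locs l o ι hl ho, ← h.locs l' o' ι hl' ho']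

/-- Writing a cell that is referred to by a single reference, with a change of its type. -/
theorem WT.put_cell {v : Val} {t₀ t : Ty} (h : WT CT Γs Δ loc c)
    (hp : c.Put c' l (o.set .val v)) (hl : l.oid = some ι) (ho : c.ObjAt o l)
    (hCL : Δ ι = some (.cell t₀)) (hv : HasTy Δ v t) (hvι : v.oid ≠ ι)
    (hun : ∀ l' g w, c.Edge l' g w → w.oid = ι → l'.IsRoot)
    (hframes : List.Forall₂ (fun (L : Layer) (fr : Frame) =>
      VarsTy (Function.update Δ ι (some (.cell t))) L.ctx fr.vars) Γs' c.stack) :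
    WT CT Γs' (Function.update Δ ι (some (.cell t))) loc c' := by
  have hloc := h.locs l o ι hl ho
  refine h.put hp hl hframes ?_ ?_ ?_ (fun _ _ => rfl) hloc fun l' o' hne ho' hl' => hne ?_
  · intro l' o' ι' hne hl' ho'
    obtain ⟨CL', h₁, h₂, h₃⟩ := h.objs l' o' ι' hl' ho'
    refine ⟨CL', ?_, h₂, h₃.congr fun x w hw => Function.update_of_ne (fun hι => ?_) _ _⟩
    · rw [Function.update_of_ne, h₁]
      rintro rfl
      exact hne (by rw [← hloc, h.locs l' o' _ hl' ho'])
    -- Fields never refer to the cell, so retyping it does not disturb the typing of other objects.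
    · obtain ⟨q, rfl⟩ := hun l' x w ((RCfg.edge_of_oid hl').2 ⟨o', ho', hw⟩) hι
      cases hl'
  · obtain ⟨CL', h₁, h₂, h₃⟩ := h.objs l o ι hl ho
    obtain rfl : STy.cell t₀ = CL' := by simpa using hCL.symm.trans h₁
    refine ⟨_, Function.update_self _ _ _, ?_, ?_⟩
    · simp only [Obj.set]
      cases htag : o.tag <;> rw [htag] at h₂ <;> cases h₂
      exact .cell t
    · rw [varsTy_iff] at h₃ ⊢
      intro x
      have hx := h₃ x
      rcases eq_or_ne x .val with rfl | hne
      · simpa [ClassTable.ctxOf, ClassTable.ftype, ClassTable.ftypes, Obj.set, Vars.set, EntryTy]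
          using hv.congr (Function.update_of_ne hvι _ _)
      · have hb : (x == Name.val) = false := by simpa using hne
        simp only [ClassTable.ctxOf, ClassTable.ftype, ClassTable.ftypes, List.lookup, hb,
          Option.map_none, Obj.set, Vars.set, Function.update_of_ne hne] at hx ⊢
        rcases hox : o.fields x with _ | _ | w <;> rw [hox] at hx <;> exact hx
  · intro ι' hι'
    by_cases heq : ι' = ι
    · exact .inr heq
    · rw [Function.update_of_ne heq] at hι'
      exact .inl hι'
  · rw [← hloc, h.locs l' o' ι hl' ho']

/-- Change of the type of a cell, seen from the frame that has the only reference to it. -/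
theorem VarsTy.update_cell {y : Name} {t : Ty} (h : VarsTy Δ Γ F) (hy : F.Has y ⟨.var, ι⟩)
    (hun : ∀ x v, F.Has x v → v.oid = ι → x = y) :
    VarsTy (Function.update Δ ι (some (.cell t))) (Γ.set y (.cell .var t)) F := by
  rw [varsTy_iff] at h ⊢
  intro x
  rcases eq_or_ne x y with rfl | hne
  · rw [hy]
    simp only [Ctx.set, Function.update_self, EntryTy]
    exact ⟨_, Function.update_self _ _ _, .refl _⟩
  · have hx := h x
    simp only [Ctx.set, Function.update_of_ne hne]
    rcases hf : F x with _ | _ | v <;> rcases hΓ : Γ x with _ | _ | t' <;> rw [hf, hΓ] at hx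
    all_goals first | exact hx | skip
    exact HasTy.congr hx (Function.update_of_ne (fun hv => hne (hun x v hf hv)) _ _)

/-! Moving references -/

/-- A reference may be moved from the root of a region to an object of the region. -/
theorem World.Ok.of_root {W : World} {v : Val} (h : W.Ok (.root r) v) (hl : l.rid = r)
    (hv : v.cap ≠ .var) (hh : l.IsHeap → v.cap ∈ ({.mutable, .iso, .imm} : Set Cap)) :
    W.Ok l v := by
  subst hl
  obtain ⟨hd, ok⟩ := h
  refine ⟨hd, ?_⟩
  obtain ⟨k, ι⟩ := v
  simp only [Set.mem_insert_iff, Set.mem_singleton_iff] at hh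
  cases k
  · exact ok
  · exact (hv rfl).elim
  · exact ok
  · exact ⟨ok.1, fun h => by simpa using hh h, ok.2.2⟩
  · exact ⟨ok.1, fun h => by simpa using hh h, ok.2.2⟩
  · exact ok

/-- A reference may be moved from an object to the root of its region. -/
theorem World.Ok.to_root {W : World} {v : Val} (h : W.Ok l v) (hl : l.rid = r)
    (hr : ¬ l.IsRoot) : W.Ok (.root r) v := by
  subst hl
  obtain ⟨hd, ok⟩ := h
  refine ⟨hd, ?_⟩
  obtain ⟨k, ι⟩ := v
  cases k
  · exact ok
  · exact (hr ok.2.1).elim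
  · exact ok
  · exact ⟨ok.1, by simp, ok.2.2⟩
  · exact ⟨ok.1, by simp, ok.2.2⟩
  · exact ok

/-! Swapping -/

/-- The type of a field of an object that is referred to by a typed variable. -/
theorem WT.field_ty (h : WT CT Γs Δ loc c) {CL : STy} {k k' : Cap} {f : Name} {t : Ty} {v : Val}
    (hy : HasTy Δ ⟨k, ι⟩ (CL.ty k')) (hl : l.oid = some ι) (ho : c.ObjAt o l)
    (ht : CT.ftype CL f = some t) (hf : o.fields.Has f v) :
    k = k' ∧ HasTy Δ v t ∧ ∃ CL₀ t₀, CL₀.Eqv CL ∧ Δ ι = some CL₀ ∧ CT.ftype CL₀ f = some t₀ ∧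
      Sub t t₀ := by
  obtain ⟨CL₀, hCL₀, hs⟩ := hy
  obtain ⟨rfl, heq⟩ := hs.sty_sty
  obtain ⟨CL₁, hCL₁, -, hof⟩ := h.objs l o ι hl ho
  obtain rfl : CL₀ = CL₁ := by simpa using hCL₀.symm.trans hCL₁
  obtain ⟨t₀, ht₀, hs₁, hs₂⟩ := heq.ftype ht
  exact ⟨rfl, (hof.hasTy (show CT.ctxOf CL₀ f = _ by simp [ClassTable.ctxOf, ht₀]) hf).sub hs₂,
    CL₀, t₀, heq, hCL₀, ht₀, hs₁⟩

theorem Loc.not_isRoot_of_oid (hl : l.oid = some ι) : ¬ l.IsRoot := by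
  rintro ⟨q, rfl⟩; cases hl

/-- A `mut` or `tmp` reference keeps to the newest region, so both values stay in the region while
they change places. If the object is on the heap, the well-formed type of `y` ensures that the
field, and hence the new value, has a capability allowed there. -/
theorem OK.swapClass {k ky : Cap} {CL : STy} {y f : Name} {t : Ty} {v v' : Val}
    (h : OK CT (⟨Γ, a, b⟩ :: Γs) Δ loc ⟨⟨r, S, F⟩ :: RS, hop, hcl, hfr⟩ [(v, t)])
    (hΓ : CtxWF CT Γ) (hcap : t.capIn {Cap.var}ᶜ) (hy : Γ.Has y (CL.ty k))
    (hk : k = .mutable ∨ k = .tmp) (ht : CT.ftype CL f = some t) (hFy : F.Has y ⟨ky, ι⟩)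
    (hl : l.oid = some ι) (ho : RCfg.ObjAt ⟨⟨r, S, F⟩ :: RS, hop, hcl, hfr⟩ o l)
    (hf : o.fields.Has f v')
    (hp : RCfg.Put ⟨⟨r, S, F⟩ :: RS, hop, hcl, hfr⟩ c' l (o.set f v)) (hc' : c'.hcl = hcl) :
    OK CT (⟨Γ, a, b⟩ :: Γs) Δ loc c' [(v', t)] := by
  obtain ⟨rfl, hv', CL₀, t₀, -, hCL₀, ht₀, hs⟩ :=
    h.wt.field_ty (h.hasTy_top.hasTy hy hFy) hl ho ht hf
  have ey := (h.inv.ok _ _ _ (h.wt.edge_top.2 hFy)).2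
  have ef := h.inv.ok _ _ _ ((RCfg.edge_of_oid hl).2 ⟨o, ho, hf⟩)
  have hv : HasTy Δ v t := h.flTy (v, t) (by simp)
  have hloc := h.wt.locs l o ι hl ho
  simp only [RCfg.world, hloc] at ey
  have hrid : l.rid = r := by rcases hk with rfl | rfl <;> exact ey.1.symm
  have hvar : v.cap ≠ .var := by simpa using hv.cap_mem hcap
  refine h.write hp hc' hl ho hf hrid ?_ (ef.to_root hrid (Loc.not_isRoot_of_oid hl))
    (h.wt.put_set hp hl ho hCL₀ ht₀ (hv.sub hs)) hp.order hv' (by simp)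
  refine World.Ok.of_root (h.inv.okFl v (by simp)) hrid hvar fun hh => ?_
  rcases hk with rfl | rfl
  · have := ((hΓ y _ hy).ftypes _ (CT.ftype_mem ht)).1 (.inl rfl)
    exact hv.cap_mem this
  · exact (ey.2.2.not_isHeap hh).elim

/-- A cell referred to by a `var` reference. -/
theorem HasTy.var_cell {t : Ty} {k : Cap}
    (hy : HasTy Δ ⟨k, ι⟩ (.cell .var t)) :
    k = .var ∧ ∃ t₀, Δ ι = some (.cell t₀) := by
  obtain ⟨CL₀, hCL₀, hs⟩ := hy
  obtain ⟨hk, heq⟩ := hs.sty_cell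
  cases heq
  exact ⟨hk, _, hCL₀⟩

/-- The type of the cell may change because `y` holds the only reference to it: retyping the cell in
`Δ` and `y` in the context leaves all other typings intact. -/
theorem OK.swapVar {ky : Cap} {y : Name} {t t' : Ty} {v v' : Val}
    (h : OK CT (⟨Γ, a, b⟩ :: Γs) Δ loc ⟨⟨r, S, F⟩ :: RS, hop, hcl, hfr⟩ [(v, t)])
    (hcap : t.capIn {Cap.var}ᶜ) (hy : Γ.Has y (.cell .var t')) (hFy : F.Has y ⟨ky, ι⟩)
    (hl : l.oid = some ι) (ho : RCfg.ObjAt ⟨⟨r, S, F⟩ :: RS, hop, hcl, hfr⟩ o l)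
    (hf : o.fields.Has .val v')
    (hp : RCfg.Put ⟨⟨r, S, F⟩ :: RS, hop, hcl, hfr⟩ c' l (o.set .val v)) (hc' : c'.hcl = hcl) :
    ∃ Δ', OK CT (⟨Γ.set y (.cell .var t), a, b⟩ :: Γs) Δ' loc c' [(v', t')] := by
  have hty := h.hasTy_top.hasTy hy hFy
  obtain ⟨rfl, t₀, hΔ⟩ := hty.var_cell
  obtain ⟨-, hv', -⟩ := h.wt.field_ty (CL := .cell t') (t := t') hty hl ho rfl hf
  have e₁ := h.wt.edge_top.2 hFy
  have e₂ := (RCfg.edge_of_oid hl).2 ⟨o, ho, hf⟩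
  have ey := (h.inv.ok _ _ _ e₁).2
  have hv : HasTy Δ v t := h.flTy (v, t) (by simp)
  have hloc := h.wt.locs l o ι hl ho
  simp only [RCfg.world, hloc] at ey
  have hrid : l.rid = r := ey.1.symm
  have hvar : v.cap ≠ .var := by simpa using hv.cap_mem hcap
  -- By `var` uniqueness, every reference to the cell sits in the slot of `y`. In particular neither
  -- of the exchanged values refers to the cell.
  have hun : ∀ l' g w, RCfg.Edge ⟨⟨r, S, F⟩ :: RS, hop, hcl, hfr⟩ l' g w → w.oid = ι →
      l' = .root r ∧ g = y := fun l' g w he hw =>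
    h.inv.sep _ _ _ _ _ _ he e₁ (.inl ⟨.inr rfl, hw⟩)
  have hvι : v.oid ≠ ι := fun hι =>
    h.inv.sepFl _ _ _ e₁ v (by simp) (.inl ⟨.inl rfl, hι.symm⟩)
  have hv'ι : v'.oid ≠ ι := fun hι =>
    Loc.not_isRoot_of_oid hl ((hun _ _ _ e₂ hι).1 ▸ Loc.isRoot_root r)
  refine ⟨Function.update Δ ι (some (.cell t)), h.write hp hc' hl ho hf hrid ?_
    ((h.inv.ok _ _ _ e₂).to_root hrid (Loc.not_isRoot_of_oid hl)) ?_ hp.order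
    (hv'.congr (Function.update_of_ne hv'ι _ _)) (by simp)⟩
  · exact World.Ok.of_root (h.inv.okFl v (by simp)) hrid hvar
      fun hh => (ey.2.2.not_isHeap hh).elim
  · refine h.wt.put_cell hp hl ho hΔ hv hvι
      (fun l' g w he hw => (hun l' g w he hw).1 ▸ Loc.isRoot_root r) (.cons ?_ ?_)
    · exact h.hasTy_top.update_cell hFy fun x w hw hι =>
        (hun _ _ _ (h.wt.edge_top.2 hw) hι).2
    · refine forall₂_imp_mem (List.forall₂_cons.1 h.wt.frames).2 fun L fr hfr hF =>
        hF.congr fun x w hw => Function.update_of_ne (fun hι => ?_) _ _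
      have := (hun _ _ _ (RCfg.edge_root.2 ⟨fr, List.mem_cons_of_mem _ hfr, rfl, hw⟩) hι).1
      exact h.wt.top_unique hfr (by simpa using this)

/-! Allocation -/

theorem OK.vals_cap {vs : List Val} {ts : List Ty} (h : OK CT Γs Δ loc c (vs.zip ts ++ fl))
    (hlen : vs.length = ts.length) {P : Cap → Prop} (hP : ∀ t ∈ ts, t.capIn {k | P k}) :
    ∀ v ∈ vs, P v.cap := by
  intro v hv
  obtain ⟨i, hi, rfl⟩ := List.getElem_of_mem hv
  have := (List.forall₂_iff_get.1 (forall₂_of_zip hlen fun p hp =>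
    h.flTy p (List.mem_append_left _ hp))).2 i hi (hlen ▸ hi)
  exact this.cap_mem (hP _ (List.getElem_mem _))

theorem OK.vals_ok {vs : List Val} {ts : List Ty} (h : OK CT Γs Δ loc c (vs.zip ts ++ fl))
    (hlen : vs.length = ts.length) : ∀ v ∈ vs, (c.world loc).Ok (c.world loc).top v := by
  intro v hv
  have := h.inv.okFl v
  rw [map_fst_zip_append hlen] at this
  exact this (List.mem_append_left _ hv)

theorem forall₂_sub_refl (ts : List Ty) : List.Forall₂ Sub ts ts :=
  List.forall₂_same.2 fun _ _ => .refl _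

/-- Well-formedness of the class restricts its fields to capabilities allowed on the heap, so the
arguments may move from the frame to an object of the same region. -/
theorem OK.allocMut {vs : List Val} {C : ClsId} {S₁ : Store}
    (h : OK CT Γs Δ loc ⟨⟨r, S, F⟩ :: RS, hop, hcl, hfr⟩
      (vs.zip ((CT.fields C).map Prod.snd) ++ fl))
    (hlen : vs.length = ((CT.fields C).map Prod.snd).length) (hC : TyWF CT (.cls .mutable C))
    (hι : ¬ RCfg.Stored ⟨⟨r, S, F⟩ :: RS, hop, hcl, hfr⟩ ι) (hr : hop r = some S₁) :
    ∃ Δ' loc', OK CT Γs Δ' loc' ⟨⟨r, S, F⟩ :: RS, hop.set r (S₁.set ι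
      ⟨.cls C, Vars.empty.setAll (CT.fieldNames (.cls C)) vs⟩), hcl, hfr⟩
      ((⟨.mutable, ι⟩, .cls .mutable C) :: fl) := by
  have hfs := TyWF.ftypes (CL := .cls C) hC
  have hp := put_hop (RS := ⟨r, S, F⟩ :: RS) hr (h.wt.disjoint₁ r (by simp [hr]))
    (h.wt.disjoint₂ r (by simp [hr])) ι ⟨.cls C, Vars.empty.setAll (CT.fieldNames (.cls C)) vs⟩
  refine ⟨_, _, h.alloc hlen hp rfl hι (.cls C) (forall₂_sub_refl _) (fun v hv => ?_) ?_
    (by simp)⟩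
  · have hcap := h.vals_cap hlen (P := (· ∈ ({.mutable, .iso, .imm} : Set Cap))) (fun t ht => by
      obtain ⟨p, hp, rfl⟩ := List.mem_map.1 ht
      exact (hfs p hp).1 (.inl rfl)) v hv
    refine World.Ok.of_root (h.vals_ok hlen v hv) rfl ?_ fun _ => hcap
    intro hv
    simp [hv] at hcap
  · have hr_fr := h.wt.world_wf.not_fr r (by simp [RCfg.world])
    refine ⟨fun h' => (hr_fr h').elim, ?_⟩
    simp [World.CapOk, World.top, RCfg.world]

theorem OK.allocTemp {vs : List Val} {CL : STy} {tag : Tag} {k : Cap}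
    (h : OK CT Γs Δ loc ⟨⟨r, S, F⟩ :: RS, hop, hcl, hfr⟩
      (vs.zip ((CT.ftypes CL).map Prod.snd) ++ fl))
    (hlen : vs.length = ((CT.ftypes CL).map Prod.snd).length) (hk : k = .tmp ∨ k = .var)
    (htag : SubTag tag CL) (hvar : ∀ p ∈ CT.ftypes CL, p.2.capIn {Cap.var}ᶜ)
    (hι : ¬ RCfg.Stored ⟨⟨r, S, F⟩ :: RS, hop, hcl, hfr⟩ ι) :
    ∃ Δ' loc', OK CT Γs Δ' loc' ⟨⟨r, S.set ι
      ⟨tag, Vars.empty.setAll (CT.fieldNames tag) vs⟩, F⟩ :: RS, hop, hcl, hfr⟩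
      ((⟨k, ι⟩, CL.ty k) :: fl) := by
  have hp := put_temp (hop := hop) (hcl := hcl) (hfr := hfr) (A := []) h.wt.rids ι
    ⟨tag, Vars.empty.setAll (CT.fieldNames tag) vs⟩
  refine ⟨_, _, h.alloc hlen hp rfl hι htag (forall₂_sub_refl _) (fun v hv => ?_) ?_ ?_⟩
  · have hcap := h.vals_cap hlen (P := (· ∈ ({Cap.var}ᶜ : Set Cap))) (fun t ht => by
      obtain ⟨p, hp, rfl⟩ := List.mem_map.1 ht
      exact hvar p hp) v hv
    exact World.Ok.of_root (h.vals_ok hlen v hv) rfl (by simpa using hcap) (by simp)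
  · have hr_fr := h.wt.world_wf.not_fr r (by simp [RCfg.world])
    refine ⟨fun h' => (hr_fr h').elim, ?_⟩
    rcases hk with rfl | rfl <;> simp [World.CapOk, World.top, RCfg.world]
  · rintro rfl
    simp at hk

theorem RCfg.ObjAt.hasRegion (h : c.ObjAt o l) : c.HasRegion l.rid := by
  cases l with
  | root => exact h.elim
  | temp q ι =>
    obtain ⟨fr, hfr, hq, -⟩ := h
    exact .inl ⟨fr, hfr, hq⟩
  | heap q ι =>
    obtain ⟨H, hH, S, hS, -⟩ := h
    simp only [List.mem_cons, List.not_mem_nil, or_false] at hH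
    rcases hH with rfl | rfl | rfl
    · exact .inr (.inl (by simp [Heap.dom, hS]))
    · exact .inr (.inr (.inl (by simp [Heap.dom, hS])))
    · exact .inr (.inr (.inr (by simp [Heap.dom, hS])))

/-- The arguments are `iso` or `imm`. Held by the newest frame, they lead into closed or frozen
regions, so they may equally start in the new closed region. -/
theorem OK.allocIso {vs : List Val} {ts : List Ty} {C : ClsId} {r' : Reg}
    (h : OK CT Γs Δ loc ⟨⟨r, S, F⟩ :: RS, hop, hcl, hfr⟩ (vs.zip ts ++ fl))
    (hlen : vs.length = ts.length)
    (hts : List.Forall₂ (fun t t' => t.capIn {Cap.iso, Cap.imm} ∧ Sub t t') ts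
      ((CT.fields C).map Prod.snd))
    (hι : ¬ RCfg.Stored ⟨⟨r, S, F⟩ :: RS, hop, hcl, hfr⟩ ι)
    (hr' : ¬ RCfg.HasRegion ⟨⟨r, S, F⟩ :: RS, hop, hcl, hfr⟩ r') :
    ∃ Δ' loc', OK CT Γs Δ' loc' ⟨⟨r, S, F⟩ :: RS, hop, hcl.set r' (Store.empty.set ι
      ⟨.cls C, Vars.empty.setAll (CT.fieldNames (.cls C)) vs⟩), hfr⟩
      ((⟨.iso, ι⟩, .cls .iso C) :: fl) := by
  have wf := h.wt.world_wf
  have hn : hop r' = none ∧ hcl r' = none ∧ hfr r' = none := by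
    simp only [RCfg.HasRegion, Heap.dom, not_or] at hr'
    simpa using hr'.2
  have hp := put_hcl (RS := ⟨r, S, F⟩ :: RS) hn.1 hn.2.1 hn.2.2 ι
    ⟨.cls C, Vars.empty.setAll (CT.fieldNames (.cls C)) vs⟩
  have hrr' : r ≠ r' := by
    rintro rfl
    exact hr' (.inl ⟨_, List.mem_cons_self, rfl⟩)
  have hr_fr := wf.not_fr r (by simp [RCfg.world])
  have hr'_fr : r' ∉ hfr.dom := by simp [Heap.dom, hn.2.2]
  refine ⟨_, _, h.alloc hlen hp rfl hι (.cls C) (hts.imp fun _ _ => And.right)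
    (fun v hv => ?_) ?_ ?_⟩
  · have hcap := h.vals_cap hlen (P := (· ∈ ({.iso, .imm} : Set Cap))) (fun t ht => by
      obtain ⟨i, hi, rfl⟩ := List.getElem_of_mem ht
      exact ((List.forall₂_iff_get.1 hts).2 i hi (hts.length_eq ▸ hi)).1) v hv
    obtain ⟨-, ok⟩ := h.vals_ok hlen v hv
    refine ⟨fun h' => (hr'_fr h').elim, ?_⟩
    obtain ⟨k, ιv⟩ := v
    simp only [Set.mem_insert_iff, Set.mem_singleton_iff] at hcap
    rcases hcap with rfl | rfl
    · have hd : (loc ιv).rid ∈ hcl.dom := by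
        rcases ok.2.1 with ok' | ok' | ok'
        · exact ok'
        · exact (World.not_top_lt (q := r) (L := RS.map Frame.rid) rfl wf.nodup _ ok').elim
        · exact (hr_fr ok'.2).elim
      refine ⟨?_, .inl (hp.hcl _ hd), ok.2.2⟩
      intro h'
      change r' = (loc ιv).rid at h'
      rw [← h'] at hd
      simp [Heap.dom, hn.2.1] at hd
    · exact ok
  · refine ⟨fun h' => (hr_fr h').elim, ?_⟩
    simp [World.CapOk, World.top, RCfg.world, hrr', Heap.dom, Heap.set]
  · intro _ l' o' ho' h'
    exact hr' ((show l'.rid = r' from h') ▸ ho'.hasRegion)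

/-! Entering -/

theorem Vars.setAll_of_notMem {xs : List Name} {vs : List Val} {w : Name} (hw : w ∉ xs) :
    (F.setAll xs vs) w = F w := by
  induction xs generalizing F vs with
  | nil => rfl
  | cons x xs ih =>
    cases vs with
    | nil => rfl
    | cons v vs =>
      simp only [List.mem_cons, not_or] at hw
      rw [Vars.setAll, ih hw.2, Vars.set, Function.update_of_ne hw.1]

/-- After `OK.push`, a `mut` copy of the entry reference is put into a new temporary cell, and the
cell and the captured values are bound. The typing of the uses determines which values were captured
how, and the type of the path field forces the reference found there to be `iso`. -/
theorem OK.enter {xs : List Name} {vs vs' : List Val} {ts ts' : List Ty} {r' : Reg} {S' : Store}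
    {w y f : Name} {k k' ky kf : Cap} {ιy ι' ι'' : Oid} {CL : STy} {t : Ty}
    (h : OK CT (⟨Γ, a, b⟩ :: Γs) Δ loc ⟨⟨r, S, F⟩ :: RS, hop, hcl, hfr⟩ (vs.zip ts))
    (hlen : vs.length = ts.length) (hvs : vs.map captureVal = vs'.map some)
    (hts : List.Forall₂ CapturedTy ts ts') (hΓ : Γ.Has y (CL.ty k')) (hk' : k'.isOpen)
    (ht : CT.ftype CL f = some t) (htc : t.capIn {Cap.iso}) (hk : k = .tmp ∨ k = .var)
    (hy : F.Has y ⟨ky, ιy⟩) (ho : CfgLoad (⟨r, S, F⟩ :: RS) [hop] ιy o)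
    (hf : o.fields.Has f ⟨kf, ι'⟩) (hr' : hcl r' = some S') (hι' : (S' ι').isSome)
    (hι'' : ¬ RCfg.Stored ⟨⟨r, S, F⟩ :: RS, hop, hcl, hfr⟩ ι'') (hxs : (w :: xs).Nodup) :
    ∃ Δ' loc', OK CT (⟨(Ctx.empty.setAll xs ts').set w (.cell k t.makeMut), y, f⟩ ::
        ⟨Γ, a, b⟩ :: Γs) Δ' loc'
      ⟨⟨r', Store.empty.set ι'' ⟨.cell, Vars.empty.set .val ⟨.mutable, ι'⟩⟩,
          (Vars.empty.setAll xs vs').set w ⟨k, ι''⟩⟩ :: ⟨r, S, F⟩ :: RS,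
        hop.set r' S', hcl.remove r', hfr⟩ [] := by
  obtain ⟨l, hl, hol⟩ := CfgLoad.objAt (c := ⟨⟨r, S, F⟩ :: RS, hop, hcl, hfr⟩) ho (by simp)
  obtain ⟨rfl, hft, -⟩ := h.wt.field_ty (h.hasTy_top.hasTy hΓ hy) hl hol ht hf
  obtain rfl : kf = .iso := by simpa using hft.cap_mem htc
  have hlι : loc ι' = .heap r' ι' := h.wt.loc_closed hr' hι'
  have hlen' : vs'.length = ts'.length := by
    rw [← hts.length_eq, ← hlen]
    simpa using (congrArg List.length hvs).symm
  have hr'_fr : r' ∉ hfr.dom := h.wt.world_wf.cl_fr r' (by simp [RCfg.world, Heap.dom, hr'])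
  have h₁ := h.push hlen hvs hts hy hk' hl hol hf hr' hι'
  have hmt := hft.mapCap fun k => if k = .iso then .mutable else k
  have hnv : ∀ {l w} {W : World}, W.loc = loc → W.Ok l w → w.oid = ι' → w.cap ≠ .var := by
    rintro l w W rfl ok rfl hw
    have := ok.isTemp_of_var hw
    rw [hlι] at this
    exact Loc.not_isTemp_heap _ _ this
  -- The target now lies in the newest region, so `mut` is admissible beside the `iso` reference of
  -- the path. No `var` reference competes, as the target is on the heap.
  have h₂ := h₁.add (v := ⟨.mutable, ι'⟩) (t := t.makeMut) (by simpa [Ty.makeMut] using hmt)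
    ⟨fun h' => (hr'_fr h').elim, by simp [World.CapOk, World.top, RCfg.world, hlι]⟩
    (by simp) (by simp)
    (fun l g w he => hnv rfl (h₁.inv.ok _ _ _ he))
    (fun w hw => hnv rfl (h₁.inv.okFl w hw))
  have hst : ¬ RCfg.Stored ⟨⟨r', Store.empty, Vars.empty⟩ :: ⟨r, S, F⟩ :: RS, hop.set r' S',
      hcl.remove r', hfr⟩ ι'' := by
    rw [← h₁.wt.dom_iff, h.wt.dom_iff]
    exact hι''
  obtain ⟨Δ', loc', h₃⟩ := OK.allocTemp (vs := [⟨.mutable, ι'⟩]) (CL := .cell t.makeMut)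
    (tag := .cell) (k := k) h₂ rfl hk (.cell _) (by
      simp only [ClassTable.ftypes, List.mem_singleton, forall_eq]
      clear * - htc
      induction t with
      | cls k C =>
        obtain rfl : k = .iso := htc
        simp [Ty.makeMut, Ty.mapCap, Ty.capIn]
      | cell k t =>
        obtain rfl : k = .iso := htc
        simp [Ty.makeMut, Ty.mapCap, Ty.capIn]
      | union t₁ t₂ ih₁ ih₂ => exact ⟨ih₁ htc.1, ih₂ htc.2⟩) hst
  have h₄ := h₃.perm (fl' := vs'.zip ts' ++ [(⟨k, ι''⟩, .cell k t.makeMut)])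
    (List.perm_append_singleton _ _).subperm
  rw [List.nodup_cons] at hxs
  have h₅ := h₄.bindAll hlen' hxs.2 (fun x _ => rfl)
  exact ⟨Δ', loc', h₅.bind (Vars.setAll_of_notMem hxs.1)⟩

/-! Exiting -/

/-- The reference that is stored on exit leads to the same region as the one it replaces. -/
theorem OK.exit_target {r' : Reg} {S' : Store} {y f w g : Name} {kw kg ky kf k' : Cap}
    {ι' ι'' ιf : Oid} {o' : Obj} {CL' : STy} {t' : Ty}
    (h : OK CT (⟨Γ', y, f⟩ :: ⟨Γ, a, b⟩ :: Γs) Δ loc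
      ⟨⟨r', S', F'⟩ :: ⟨r, S, F⟩ :: RS, hop, hcl, hfr⟩ fl)
    (hw : F'.Has w ⟨kw, ι'⟩) (ho' : S' ι' = some o') (hg : o'.fields.Has g ⟨kg, ι''⟩)
    (hΓw : Γ'.Has w (CL'.ty k')) (ht' : CT.ftype CL' g = some t') (hcap : t'.capIn {Cap.mutable})
    (hy : F.Has y ⟨ky, ι⟩) (hl : l.oid = some ι)
    (ho : RCfg.ObjAt ⟨⟨r', S', F'⟩ :: ⟨r, S, F⟩ :: RS, hop, hcl, hfr⟩ o l)
    (hf : o.fields.Has f ⟨kf, ιf⟩) :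
    kf = .iso ∧ HasTy Δ ⟨.iso, ι''⟩ t'.makeIso ∧ (loc ι'').IsHeap ∧
      (loc ι'').rid = (loc ιf).rid := by
  have hol : RCfg.ObjAt ⟨⟨r', S', F'⟩ :: ⟨r, S, F⟩ :: RS, hop, hcl, hfr⟩ o' (.temp r' ι') :=
    ⟨_, List.mem_cons_self, rfl, ho'⟩
  obtain ⟨-, hgt, -⟩ := h.wt.field_ty (h.hasTy_top.hasTy hΓw hw) rfl hol ht' hg
  obtain rfl : kg = .mutable := hgt.cap_mem hcap
  have eg := (h.inv.ok _ _ _ ((RCfg.edge_of_oid (l := .temp r' ι') rfl).2 ⟨o', hol, hg⟩)).2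
  -- The mark on the contexts yields the entry path. Since slots have one value, it passes through
  -- the very field that is overwritten, whose reference thus is `iso` into `r'`. The `mut`
  -- reference found in the temporary store of `r'` stays in `r'`.
  obtain ⟨k, ι₁, ι₂, e₁, e₂, hr⟩ := h.entry ⟨r', y, f⟩ ⟨r, a, b⟩
    (Order.adj_cons.2 (.inl ⟨rfl, _, rfl⟩))
  have ey := h.wt.edge_inj e₁ (RCfg.edge_root.2
    ⟨⟨r, S, F⟩, List.mem_cons_of_mem _ List.mem_cons_self, rfl, hy⟩)
  obtain ⟨-, rfl⟩ := Val.mk.injEq .. ▸ ey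
  have ef : RCfg.Edge _ l f ⟨kf, ιf⟩ := (RCfg.edge_of_oid hl).2 ⟨o, ho, hf⟩
  rw [h.wt.locs l o _ hl ho] at e₂
  obtain ⟨rfl, rfl⟩ := Val.mk.injEq .. ▸ h.wt.edge_inj e₂ ef
  refine ⟨rfl, ?_, eg.2, eg.1.symm.trans hr.symm⟩
  simpa [Ty.makeIso] using hgt.mapCap fun k => if k = .mutable then .iso else k

/-- How the exit changes the context of the older region: either the field keeps its type, or the
type of a variable cell is updated. -/
def ExitCtx (CT : ClassTable) (Γ : Ctx) (y f : Name) (t : Ty) (Γ' : Ctx) : Prop :=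
  (∃ k CL tf, Γ.Has y (CL.ty k) ∧ CT.ftype CL f = some tf ∧ Sub t tf ∧ Γ' = Γ) ∨
    (∃ t₀, Γ.Has y (.cell .var t₀) ∧ f = .val ∧ Γ' = Γ.set y (.cell .var t))

/-- The write comes before the frame is popped, while the world is still that of the entry. It
replaces an `iso` reference by one into the same region, so only typing needs attention: either the
field keeps its type, or a `var` cell with its single reference is retyped. -/
theorem OK.exit_put {r' : Reg} {S' : Store} {y f : Name} {ky : Cap} {ιf ι'' : Oid}
    {t t' : Ty} {v : Val} {Γ₁ : Ctx}
    (h : OK CT (⟨Γ', y, f⟩ :: ⟨Γ, a, b⟩ :: Γs) Δ loc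
      ⟨⟨r', S', F'⟩ :: ⟨r, S, F⟩ :: RS, hop, hcl, hfr⟩ [(v, t)])
    (hv : v.cap = .iso ∨ v.cap = .imm) (hΓ : ExitCtx CT Γ y f t' Γ₁)
    (ht' : HasTy Δ ⟨.iso, ι''⟩ t') (hheap : (loc ι'').IsHeap)
    (hrid : (loc ι'').rid = (loc ιf).rid)
    (hy : F.Has y ⟨ky, ι⟩) (hl : l.oid = some ι)
    (ho : RCfg.ObjAt ⟨⟨r', S', F'⟩ :: ⟨r, S, F⟩ :: RS, hop, hcl, hfr⟩ o l)
    (hf : o.fields.Has f ⟨.iso, ιf⟩)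
    (hp : RCfg.Put ⟨⟨r', S', F'⟩ :: ⟨r, S, F⟩ :: RS, hop, hcl, hfr⟩ c' l
      (o.set f ⟨.iso, ι''⟩)) (hc' : c'.hcl = hcl) :
    ∃ Δ', OK CT (⟨Γ', y, f⟩ :: ⟨Γ₁, a, b⟩ :: Γs) Δ' loc c' [(v, t)] := by
  have hF := (List.forall₂_cons.1 (List.forall₂_cons.1 h.wt.frames).2).1
  have hvt : HasTy Δ v t := h.flTy (v, t) (by simp)
  rcases hΓ with ⟨k, CL, tf, hΓy, htf, hsub, rfl⟩ | ⟨t₀, hΓy, rfl, rfl⟩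
  · obtain ⟨-, -, CL₀, t₀, -, hCL₀, ht₀, hs⟩ := h.wt.field_ty (hF.hasTy hΓy hy) hl ho htf hf
    exact ⟨Δ, h.retarget hp hc' hl ho hf rfl rfl hrid hheap
      (h.wt.put_set hp hl ho hCL₀ ht₀ ((ht'.sub hsub).sub hs)) hp.order h.flTy⟩
  · have hmem : (⟨r, S, F⟩ : Frame) ∈ (⟨r', S', F'⟩ :: ⟨r, S, F⟩ :: RS : List Frame) :=
      List.mem_cons_of_mem _ List.mem_cons_self
    obtain ⟨rfl, t₁, hΔ⟩ := (hF.hasTy hΓy hy).var_cell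
    have e₁ : RCfg.Edge ⟨⟨r', S', F'⟩ :: ⟨r, S, F⟩ :: RS, hop, hcl, hfr⟩ (.root r) y ⟨.var, ι⟩ :=
      RCfg.edge_root.2 ⟨_, hmem, rfl, hy⟩
    have hT : (loc ι).IsTemp := (h.inv.ok _ _ _ e₁).isTemp_of_var rfl
    have hne : ∀ {ι₀}, (loc ι₀).IsHeap → ι₀ ≠ ι := by
      rintro _ h' rfl
      exact h'.not_isTemp hT
    have hvh : (loc v.oid).IsHeap := by
      have hok := (h.inv.okFl v (by simp)).2
      rcases hv with hv | hv <;> rw [hv] at hok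
      · exact hok.2.2
      · exact hok.2
    have hun : ∀ l' g w, RCfg.Edge ⟨⟨r', S', F'⟩ :: ⟨r, S, F⟩ :: RS, hop, hcl, hfr⟩ l' g w →
        w.oid = ι → l' = .root r ∧ g = y := fun l' g w he hw =>
      h.inv.sep _ _ _ _ _ _ he e₁ (.inl ⟨.inr rfl, hw⟩)
    have hother : ∀ (L : Layer) (fr : Frame), fr ∈ (⟨r', S', F'⟩ :: ⟨r, S, F⟩ :: RS : List Frame) →
        fr.rid ≠ r → VarsTy Δ L.ctx fr.vars →
        VarsTy (Function.update Δ ι (some (.cell t'))) L.ctx fr.vars := by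
      refine fun L fr hfr hr hF => hF.congr fun x w hw => Function.update_of_ne (fun hι => ?_) _ _
      exact hr (by simpa using (hun _ _ _ (RCfg.edge_root.2 ⟨fr, hfr, rfl, hw⟩) hι).1)
    have hnd := h.wt.rids
    simp only [List.map_cons, List.nodup_cons, List.mem_cons, not_or] at hnd
    refine ⟨Function.update Δ ι (some (.cell t')), h.retarget hp hc' hl ho hf rfl rfl hrid hheap
      (h.wt.put_cell hp hl ho hΔ ht' (hne hheap)
        (fun l' g w he hw => (hun l' g w he hw).1 ▸ Loc.isRoot_root r)
        (.cons ?_ (.cons ?_ ?_))) hp.order ?_⟩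
    · exact hother ⟨Γ', y, .val⟩ _ List.mem_cons_self hnd.1.1 h.hasTy_top
    · exact hF.update_cell hy fun x w hw hι =>
        (hun _ _ _ (RCfg.edge_root.2 ⟨_, hmem, rfl, hw⟩) hι).2
    · refine forall₂_imp_mem (List.forall₂_cons.1 (List.forall₂_cons.1 h.wt.frames).2).2
        fun L fr hfr hF => hother L fr ?_ ?_ hF
      · exact List.mem_cons_of_mem _ (List.mem_cons_of_mem _ hfr)
      · rintro rfl
        exact hnd.2.1 (List.mem_map_of_mem hfr)
    · simp only [List.mem_singleton, forall_eq]
      exact hvt.congr (Function.update_of_ne (hne hvh) _ _)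

/-- Storing into the stack does not depend on the variables. -/
theorem stackStore_vars (ι : Oid) (o : Obj) (r : Reg) (S : Store) (RS : List Frame) :
    ∃ S₂ RS₂, ∀ F, stackStore ι o (⟨r, S, F⟩ :: RS) = ⟨r, S₂, F⟩ :: RS₂ := by
  cases hS : S ι with
  | some o₁ => exact ⟨S.set ι o, RS, fun F => by simp [stackStore, hS]⟩
  | none => exact ⟨S, stackStore ι o RS, fun F => by simp [stackStore, hS]⟩

/-- The effect of an exit is to write a field, to remove the newest frame, and to bind
a variable. -/
theorem RStep.exit_cases {r' : Reg} {S' : Store} {x : Name} {u : Use} {y f w g : Name}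
    (h : WT CT Γs Δ loc ⟨⟨r', S', F'⟩ :: ⟨r, S, F⟩ :: RS, hop, hcl, hfr⟩)
    (hs : RStep CT ⟨⟨r', S', F'⟩ :: ⟨r, S, F⟩ :: RS, hop, hcl, hfr⟩ (.exit x u y f w g) c') :
    ∃ (Sop S₂ : Store) (RS₂ : List Frame) (hop₂ : Heap) (l : Loc) (vz : Val) (F'' : Vars)
      (kw kg ky kf : Cap) (ι' ι'' ι ιf : Oid) (o' o : Obj),
      hop₂ r' = some Sop ∧ F x = none ∧ u.get F' = some (vz, F'') ∧ F''.Has w ⟨kw, ι'⟩ ∧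
      S' ι' = some o' ∧ o'.fields.Has g ⟨kg, ι''⟩ ∧ F.Has y ⟨ky, ι⟩ ∧ l.oid = some ι ∧
      RCfg.ObjAt ⟨⟨r', S', F''⟩ :: ⟨r, S, F⟩ :: RS, hop, hcl, hfr⟩ o l ∧
      o.fields.Has f ⟨kf, ιf⟩ ∧
      RCfg.Put ⟨⟨r', S', F''⟩ :: ⟨r, S, F⟩ :: RS, hop, hcl, hfr⟩
        ⟨⟨r', S', F''⟩ :: ⟨r, S₂, F⟩ :: RS₂, hop₂, hcl, hfr⟩ l (o.set f ⟨kf, ι''⟩) ∧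
      c' = ⟨⟨r, S₂, F.set x vz⟩ :: RS₂, hop₂.remove r', hcl.set r' Sop, hfr⟩ := by
  cases hs with
  | @exitTemp _ _ _ _ _ _ _ _ _ _ _ _ _ _ _ _ vz F'' kw kg ky kf ι' ι'' ι ιf o' o Sop
      h₁ h₂ h₃ h₄ h₅ h₆ h₇ h₈ h₉ =>
    obtain ⟨A, fr, B, hA, ho, hst⟩ := stackStore_eq (o := o.set f ⟨kf, ι''⟩) h₈
    -- The step stores into a stack in which `x` is already bound. As storing ignores variables, it
    -- can be done first.
    obtain ⟨S₂, RS₂, hSt⟩ := stackStore_vars ι (o.set f ⟨kf, ι''⟩) r S RS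
    have hnd := h.rids
    have hrids : ((⟨r', S', F''⟩ :: A ++ fr :: B).map Frame.rid).Nodup := by
      rw [List.cons_append, ← hA]
      exact hnd
    have hp := put_temp (hop := hop) (hcl := hcl) (hfr := hfr) hrids ι (o.set f ⟨kf, ι''⟩)
    rw [List.cons_append, List.cons_append, ← hst, ← hA, hSt] at hp
    refine ⟨Sop, S₂, RS₂, hop, .temp fr.rid ι, vz, F'', kw, kg, ky, kf, ι', ι'', ι, ιf, o', o,
      h₁, h₂, h₃, h₄, h₅, h₆, h₇, rfl, ⟨fr, ?_, rfl, ho⟩, h₉, hp, by rw [hSt]⟩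
    rw [hA]
    simp
  | @exitHeap _ _ _ _ _ _ _ _ _ _ _ _ _ _ _ _ vz F'' kw kg ky kf ι' ι'' ι ιf o' o Sop r₁ S₁
      h₁ h₂ h₃ h₄ h₅ h₆ h₇ h₈ h₉ h₁₀ =>
    have hr : r₁ ≠ r' := by
      rintro rfl
      simp [Heap.remove] at h₈
    rw [Heap.remove, Function.update_of_ne hr] at h₈
    refine ⟨Sop, S, RS, hop.set r₁ (S₁.set ι (o.set f ⟨kf, ι''⟩)), .heap r₁ ι, vz, F'', kw, kg,
      ky, kf, ι', ι'', ι, ιf, o', o, ?_, h₂, h₃, h₄, h₅, h₆, h₇, rfl,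
      ⟨hop, by simp, S₁, h₈, h₉⟩, h₁₀,
      put_hop h₈ (h.disjoint₁ r₁ (by simp [h₈])) (h.disjoint₂ r₁ (by simp [h₈])) _ _, ?_⟩
    · simpa [Heap.set, hr.symm] using h₁
    · simp only [Heap.remove, Heap.set]
      -- The written region differs from the closed one, so writing commutes with removing.
      rw [Function.update_comm hr]

/-- The returned value is held while the field is written and the frame popped. Its type allows only
`iso` and `imm`, which is what lets it outlive the region's frame. -/
theorem OK.exit {Γ'' Γ₁ : Ctx} {x : Name} {u : Use} {y f w g : Name} {t t' : Ty} {k' : Cap}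
    {CL' : STy} (h : OK CT (⟨Γ', y, f⟩ :: ⟨Γ, a, b⟩ :: Γs) Δ loc c [])
    (hu : UseTy CT Γ' u t Γ'') (ht : t.capIn {Cap.iso, Cap.imm}) (hw : Γ''.Has w (CL'.ty k'))
    (hg : CT.ftype CL' g = some t') (ht' : t'.capIn {Cap.mutable})
    (hΓ : ExitCtx CT Γ y f t'.makeIso Γ₁) (hs : RStep CT c (.exit x u y f w g) c') :
    ∃ Δ', OK CT (⟨Γ₁.set x t, a, b⟩ :: Γs) Δ' loc c' [] := by
  obtain ⟨stack, hop, hcl, hfr⟩ := c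
  obtain ⟨r', S', F', r, S, F, RS, rfl⟩ : ∃ r' S' F' r S F RS,
      stack = ⟨r', S', F'⟩ :: ⟨r, S, F⟩ :: RS := by
    cases hs <;> exact ⟨_, _, _, _, _, _, _, rfl⟩
  obtain ⟨Sop, S₂, RS₂, hop₂, l, vz, F'', kw, kg, ky, kf, ι', ι'', ι, ιf, o', o, h₁, h₂, h₃, h₄,
    h₅, h₆, h₇, hl, ho, h₈, hp, rfl⟩ := hs.exit_cases h.wt
  have h' := h.get hu h₃
  have hv : vz.cap = .iso ∨ vz.cap = .imm := (h'.flTy (vz, t) (by simp)).cap_mem ht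
  obtain ⟨rfl, e₁, e₂, e₃⟩ := h'.exit_target h₄ h₅ h₆ hw hg ht' h₇ hl ho h₈
  obtain ⟨Δ₁, h''⟩ := h'.exit_put hv hΓ e₁ e₂ e₃ h₇ hl ho h₈ hp rfl
  obtain ⟨Δ₂, h'''⟩ := h''.pop h₁ hv
  exact ⟨Δ₂, h'''.bind h₂⟩

variable {Γs₁ Γs₂ : DynCtx}

/-! Shapes of stacks of contexts -/

/-- The shapes of the contexts of a stack, with their marks. -/
def DynCtx.shape (Γs : DynCtx) : List ((Name → Option Bool) × Name × Name) :=
  Γs.map fun L => (L.ctx.shape, L.var, L.field)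

/-- The effect of binding a name on shapes. -/
def bindShape (s : Name → Option Bool) (x : Name) : Name → Option Bool :=
  Function.update s x (some true)

/-- The shapes of the contexts after an effect, which do not depend on the types. -/
def Eff.shape : Eff → List ((Name → Option Bool) × Name × Name) →
    List ((Name → Option Bool) × Name × Name)
  | .load x _ _, (s, m) :: ss => (bindShape s x, m) :: ss
  | .swap x _ _ u, (s, m) :: ss => (bindShape (u.shape s) x, m) :: ss
  | .bind bs, (s, m) :: ss => ((bs.map Prod.fst).foldl bindShape
      ((bs.map Prod.snd).foldl (fun s u => u.shape s) s), m) :: ss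
  | .halloc x _ _ us, (s, m) :: ss => (bindShape (us.foldl (fun s u => u.shape s) s) x, m) :: ss
  | .salloc x _ _ us, (s, m) :: ss => (bindShape (us.foldl (fun s u => u.shape s) s) x, m) :: ss
  | .enter w _ y f bs, (s, m) :: ss =>
    (bindShape ((bs.map Prod.fst).foldl bindShape Ctx.empty.shape) w, y, f) ::
      ((bs.map Prod.snd).foldl (fun s u => u.shape s) s, m) :: ss
  | .exit x _ _ _ _ _, _ :: (s, m) :: ss => (bindShape s x, m) :: ss
  | .freeze x u, (s, m) :: ss => (bindShape (u.shape s) x, m) :: ss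
  | .merge x u, (s, m) :: ss => (bindShape (u.shape s) x, m) :: ss
  | .cast x u _ _, (s, m) :: ss => (bindShape (u.shape s) x, m) :: ss
  | .nocast x u _ _, (s, m) :: ss => (bindShape (u.shape s) x, m) :: ss
  | _, ss => ss

theorem UsesTy.shape {us : List Use} {ts : List Ty} (h : UsesTy CT Γ us ts Γ') :
    Γ'.shape = us.foldl (fun s u => u.shape s) Γ.shape := by
  induction h with
  | nil => rfl
  | cons h _ ih => rw [ih, h.shape]; rfl

theorem Ctx.shape_setAll {xs : List Name} {ts : List Ty} (h : xs.length = ts.length) :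
    (Γ.setAll xs ts).shape = xs.foldl bindShape Γ.shape := by
  induction xs generalizing Γ ts with
  | nil => rfl
  | cons x xs ih =>
    cases ts with
    | nil => cases h
    | cons t ts => rw [Ctx.setAll, ih (by simpa using h), Ctx.shape_set]; rfl

theorem DynCtx.Join.shape (h : DynCtx.Join Γs₁ Γs₂ Γs) (hs : Γs₁.shape = Γs₂.shape) :
    Γs.shape = Γs₁.shape := by
  induction h with
  | nil => rfl
  | cons y f hd hj ih =>
    simp only [DynCtx.shape, List.map_cons, List.cons.injEq, Prod.mk.injEq] at hs ih ⊢
    exact ⟨⟨Ctx.shape_join hs.1.1, trivial⟩, ih hs.2⟩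

/-- Needed in order to join the results of a case distinction: both branches are derivations for the
same effect, from contexts of the same shape. -/
theorem EffTy.shape {e : Eff} (h : EffTy CT Γs e Γs') : Γs'.shape = e.shape Γs.shape := by
  induction h with
  | load => simp [DynCtx.shape, Eff.shape, Ctx.shape_set, bindShape]
  | swapClass _ hu => simp [DynCtx.shape, Eff.shape, Ctx.shape_set, bindShape, hu.shape]
  | swapVar _ hu _ hy =>
    -- The type is arbitrary, since shapes do not record types; the point is that assigning a type
    -- to a defined variable does not change the shape.
    have := hy.shape_set (.cls .iso 0)
    rw [Ctx.shape_set] at this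
    simp [DynCtx.shape, Eff.shape, Ctx.shape_set, bindShape, ← hu.shape, this]
  | hallocMut _ _ hu => simp [DynCtx.shape, Eff.shape, Ctx.shape_set, bindShape, hu.shape]
  | hallocIso _ _ hu => simp [DynCtx.shape, Eff.shape, Ctx.shape_set, bindShape, hu.shape]
  | salloc _ _ _ _ hu => simp [DynCtx.shape, Eff.shape, Ctx.shape_set, bindShape, hu.shape]
  | freeze _ hu => simp [DynCtx.shape, Eff.shape, Ctx.shape_set, bindShape, hu.shape]
  | merge _ hu => simp [DynCtx.shape, Eff.shape, Ctx.shape_set, bindShape, hu.shape]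
  | cast _ hu => simp [DynCtx.shape, Eff.shape, Ctx.shape_set, bindShape, hu.shape]
  | nocast _ hu => simp [DynCtx.shape, Eff.shape, Ctx.shape_set, bindShape, hu.shape]
  | bind _ _ hu =>
    have := hu.length
    rw [List.length_map] at this
    simp only [DynCtx.shape, Eff.shape, List.map_cons, ← hu.shape]
    rw [Ctx.shape_setAll (by simpa using this)]
  | enter _ hu _ _ _ _ _ _ hts =>
    have := hu.length.trans hts.length_eq
    rw [List.length_map] at this
    simp only [DynCtx.shape, Eff.shape, List.map_cons, ← hu.shape]
    rw [Ctx.shape_set, Ctx.shape_setAll (by simpa using this), bindShape]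
  | badenter => rfl
  | exitVar _ hy =>
    have := hy.shape_set (.cls .iso 0)
    rw [Ctx.shape_set] at this
    simp [DynCtx.shape, Eff.shape, Ctx.shape_set, bindShape, this]
  | exitField => simp [DynCtx.shape, Eff.shape, Ctx.shape_set, bindShape]
  | split hx _ _ hj ih₁ ih₂ =>
    simp only [DynCtx.shape, List.map_append, List.map_cons, hx.shape_set] at ih₁ ih₂ ⊢
    exact (hj.shape (ih₁.trans ih₂.symm)).trans ih₁
  | eps Γs => cases Γs <;> rfl

/-! Case distinctions -/

theorem order_append (pre post : DynCtx) (Γ Γ' : Ctx) :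
    order (pre ++ ⟨Γ, a, b⟩ :: post) c = order (pre ++ ⟨Γ', a, b⟩ :: post) c := by
  rw [order, order]
  generalize c.stack = RS
  induction pre generalizing RS with
  | nil => cases RS <;> rfl
  | cons L pre ih =>
    cases RS with
    | nil => rfl
    | cons fr RS => simp only [List.cons_append, List.zipWith_cons_cons, ih]

theorem OK.of_contexts (h : OK CT Γs Δ loc c fl)
    (hΓ : List.Forall₂ (fun (L : Layer) (fr : Frame) => VarsTy Δ L.ctx fr.vars) Γs' c.stack)
    (hord : order Γs' c = order Γs c) : OK CT Γs' Δ loc c fl where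
  wt := { h.wt with frames := hΓ }
  flTy := h.flTy
  inv := h.inv
  entry := hord ▸ h.entry

theorem OK.split {pre post : DynCtx} {x : Name} {t₁ t₂ : Ty}
    (h : OK CT (pre ++ ⟨Γ, a, b⟩ :: post) Δ loc c fl) (hx : Γ.Has x (.union t₁ t₂)) :
    OK CT (pre ++ ⟨Γ.set x t₁, a, b⟩ :: post) Δ loc c fl ∨
      OK CT (pre ++ ⟨Γ.set x t₂, a, b⟩ :: post) Δ loc c fl := by
  have key : ∀ RS : List Frame, List.Forall₂ (fun (L : Layer) (fr : Frame) =>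
      VarsTy Δ L.ctx fr.vars) (pre ++ ⟨Γ, a, b⟩ :: post) RS →
      List.Forall₂ (fun (L : Layer) (fr : Frame) => VarsTy Δ L.ctx fr.vars)
        (pre ++ ⟨Γ.set x t₁, a, b⟩ :: post) RS ∨
      List.Forall₂ (fun (L : Layer) (fr : Frame) => VarsTy Δ L.ctx fr.vars)
        (pre ++ ⟨Γ.set x t₂, a, b⟩ :: post) RS := by
    clear h
    induction pre with
    | nil =>
      rintro _ (_ | ⟨h, hs⟩)
      exact (h.split hx).imp (.cons · hs) (.cons · hs)
    | cons L pre ih =>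
      rintro _ (_ | ⟨h, hs⟩)
      exact (ih _ hs).imp (.cons h) (.cons h)
  exact (key _ h.wt.frames).imp (fun h' => h.of_contexts h' (order_append _ _ _ _))
    (fun h' => h.of_contexts h' (order_append _ _ _ _))

theorem DynCtx.Join.order_eq (h : DynCtx.Join Γs₁ Γs₂ Γs) :
    order Γs c = order Γs₁ c ∧ order Γs c = order Γs₂ c := by
  simp only [order]
  generalize c.stack = RS
  induction h generalizing RS with
  | nil => exact ⟨rfl, rfl⟩
  | cons y f _ _ ih =>
    cases RS with
    | nil => exact ⟨rfl, rfl⟩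
    | cons fr RS => simpa using ih RS

/-- The alternative is between whole stacks, so every frame is weakened to the join from the same
side. -/
theorem DynCtx.Join.frames (h : DynCtx.Join Γs₁ Γs₂ Γs) (hs : Γs₁.shape = Γs₂.shape)
    (hΓ : List.Forall₂ (fun (L : Layer) (fr : Frame) => VarsTy Δ L.ctx fr.vars) Γs₁ RS ∨
      List.Forall₂ (fun (L : Layer) (fr : Frame) => VarsTy Δ L.ctx fr.vars) Γs₂ RS) :
    List.Forall₂ (fun (L : Layer) (fr : Frame) => VarsTy Δ L.ctx fr.vars) Γs RS := by
  induction h generalizing RS with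
  | nil => exact hΓ.elim id id
  | cons y f _ _ ih =>
    simp only [DynCtx.shape, List.map_cons, List.cons.injEq, Prod.mk.injEq] at hs ih
    rcases hΓ with ⟨_ | ⟨h, h'⟩⟩ | ⟨_ | ⟨h, h'⟩⟩
    · exact .cons (h.join_left hs.1.1) (ih hs.2 (.inl h'))
    · exact .cons (h.join_right hs.1.1) (ih hs.2 (.inr h'))

theorem OK.join (hj : DynCtx.Join Γs₁ Γs₂ Γs) (hs : Γs₁.shape = Γs₂.shape)
    (h : OK CT Γs₁ Δ loc c fl ∨ OK CT Γs₂ Δ loc c fl) : OK CT Γs Δ loc c fl := by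
  rcases h with h | h
  · exact h.of_contexts (hj.frames hs (.inl h.wt.frames)) hj.order_eq.1
  · exact h.of_contexts (hj.frames hs (.inr h.wt.frames)) hj.order_eq.2

/-! Preservation -/

theorem objAt_top (h : S ι = some o) :
    RCfg.ObjAt ⟨⟨r, S, F⟩ :: RS, hop, hcl, hfr⟩ o (.temp r ι) :=
  ⟨_, List.mem_cons_self, rfl, h⟩

theorem objAt_open (h : hop r = some S) (hι : S ι = some o) :
    RCfg.ObjAt ⟨RS, hop, hcl, hfr⟩ o (.heap r ι) :=
  ⟨hop, List.mem_cons_self, S, h, hι⟩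

/-- Induction on the typing of the effect, in which only the case distinction is recursive. The
induction hypotheses must therefore not fix the branch: each applies to the same step once the
configuration is known to be typed by its narrowed stack. In the other cases the typing rule and the
effect leave only the matching steps. -/
theorem OK.step {e : Eff} (he : EffTy CT Γs e Γs') (hs : RStep CT c e c')
    (h : OK CT Γs Δ loc c []) : ∃ Δ' loc', OK CT Γs' Δ' loc' c' [] := by
  induction he with
  | load _ hy hf _ hv _ =>
    cases hs with
    | load g₁ g₂ g₃ g₄ g₅ => exact ⟨Δ, loc, (h.load g₂ g₃ g₄ g₅ hy hf hv).bind g₁⟩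
  | swapClass _ hu hcap hy hk hf =>
    cases hs with
    | swapTemp g₁ g₂ g₃ g₄ g₅ =>
      have h' := h.get hu g₂
      exact ⟨Δ, loc, (h'.swapClass hu.ctxWF hcap hy hk hf g₃ rfl
        (objAt_top g₄) g₅ (put_temp (A := []) h'.wt.rids _ _) rfl).bind
          ((Use.get_none g₂).2 g₁)⟩
    | swapHeap g₁ g₂ g₃ g₄ g₅ g₆ =>
      have h' := h.get hu g₂
      exact ⟨Δ, loc, (h'.swapClass hu.ctxWF hcap hy hk hf g₃ rfl
        (objAt_open g₄ g₅) g₆ (put_hop g₄ (h'.wt.disjoint₁ _ (by simp [g₄]))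
          (h'.wt.disjoint₂ _ (by simp [g₄])) _ _) rfl).bind ((Use.get_none g₂).2 g₁)⟩
  | swapVar _ hu hcap hy =>
    cases hs with
    | swapTemp g₁ g₂ g₃ g₄ g₅ =>
      have h' := h.get hu g₂
      obtain ⟨Δ', h''⟩ := h'.swapVar hcap hy g₃ rfl
        (objAt_top g₄) g₅ (put_temp (A := []) h'.wt.rids _ _) rfl
      exact ⟨Δ', loc, OK.bind h'' ((Use.get_none g₂).2 g₁)⟩
    | swapHeap g₁ g₂ g₃ g₄ g₅ g₆ =>
      have h' := h.get hu g₂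
      obtain ⟨Δ', h''⟩ := h'.swapVar hcap hy g₃ rfl
        (objAt_open g₄ g₅) g₆ (put_hop g₄ (h'.wt.disjoint₁ _ (by simp [g₄]))
          (h'.wt.disjoint₂ _ (by simp [g₄])) _ _) rfl
      exact ⟨Δ', loc, OK.bind h'' ((Use.get_none g₂).2 g₁)⟩
  | hallocMut _ hC hu =>
    cases hs with
    | allocMut g₁ g₂ g₃ g₄ g₅ =>
      have h' := h.getAll hu g₂
      -- Freshness was stated before the uses were evaluated. It carries over because the stored
      -- objects are the domain of `Δ`, which uses do not change.
      obtain ⟨Δ', loc', h''⟩ := h'.allocMut ((getAll_length g₂).trans hu.length) hC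
        (by rwa [← h'.wt.dom_iff, h.wt.dom_iff]) g₅
      exact ⟨Δ', loc', h''.bind ((getAll_none g₂).2 g₁)⟩
  | hallocIso _ _ hu hts =>
    cases hs with
    | allocIso g₁ g₂ g₃ g₄ g₅ =>
      have h' := h.getAll hu g₂
      obtain ⟨Δ', loc', h''⟩ := h'.allocIso ((getAll_length g₂).trans hu.length) hts
        (by rwa [← h'.wt.dom_iff, h.wt.dom_iff]) (by simpa [RCfg.HasRegion] using g₅)
      exact ⟨Δ', loc', h''.bind ((getAll_none g₂).2 g₁)⟩
  | @salloc _ _ _ _ _ _ _ _ CL _ _ hk htag hwf hu =>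
    cases hs with
    | allocTemp _ g₁ g₂ g₃ g₄ =>
      have h' := h.getAll hu g₂
      have hvar : ∀ p ∈ CT.ftypes CL, p.2.capIn {Cap.var}ᶜ := by
        cases CL with
        | cls C => exact CT.no_var C
        | cell t => simpa [ClassTable.ftypes] using hwf.2.1
      obtain ⟨Δ', loc', h''⟩ := h'.allocTemp ((getAll_length g₂).trans hu.length) hk htag hvar
        (by rwa [← h'.wt.dom_iff, h.wt.dom_iff])
      exact ⟨Δ', loc', h''.bind ((getAll_none g₂).2 g₁)⟩
  | freeze _ hu ht =>
    cases hs with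
    | freeze g₁ g₂ g₃ g₄ g₅ =>
      have h' := h.get hu g₂
      -- The step leaves the capability of the value open; its static type forces it to be `iso`.
      obtain rfl := (h'.flTy _ List.mem_cons_self).cap_mem ht
      exact ⟨Δ, loc, (h'.freeze g₃ g₄ g₅).bind ((Use.get_none g₂).2 g₁)⟩
  | merge _ hu ht =>
    cases hs with
    | merge g₁ g₂ g₃ g₄ g₅ g₆ =>
      have h' := h.get hu g₂
      obtain rfl := (h'.flTy _ List.mem_cons_self).cap_mem ht
      exact ⟨Δ, _, (h'.merge g₃ g₄ g₅ g₆).bind ((Use.get_none g₂).2 g₁)⟩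
  | cast _ hu ht =>
    cases hs with
    | cast g₁ g₂ g₃ g₄ =>
      obtain ⟨l, hl, ho⟩ := CfgLoad.objAt (c := ⟨_ :: _, _, _, _⟩) g₃ fun _ => id
      obtain ⟨CL, hCL, htag, -⟩ := h.wt.objs l _ _ hl ho
      rw [g₄] at htag
      cases htag
      exact ⟨Δ, loc, ((h.get hu g₂).retype ⟨_, hCL, ht⟩).bind ((Use.get_none g₂).2 g₁)⟩
  | nocast _ hu =>
    cases hs with
    | nocast g₁ g₂ _ => exact ⟨Δ, loc, (h.get hu g₂).bind ((Use.get_none g₂).2 g₁)⟩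
  | bind hxs _ hu =>
    cases hs with
    | bind _ g₁ g₂ =>
      exact ⟨Δ, loc, (h.getAll hu g₂).bindAll ((getAll_length g₂).trans hu.length) hxs
        fun x hx => (getAll_none g₂).2 (g₁ x hx)⟩
  | enter hxs hu hy hk' hf ht hk _ hts =>
    cases hs with
    | enterOk _ g₁ g₂ g₃ g₄ g₅ g₆ g₇ g₈ =>
      have h' := h.getAll hu g₁
      rw [List.append_nil] at h'
      exact h'.enter ((getAll_length g₁).trans hu.length) g₂ hts hy hk' hf ht hk g₃ g₄ g₅ g₆ g₇
        (by rwa [← h'.wt.dom_iff, h.wt.dom_iff]) hxs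
  | badenter =>
    cases hs
    exact ⟨Δ, loc, h⟩
  | @exitVar _ _ _ _ _ _ _ _ _ f _ _ _ _ _ _ _ _ _ hy hf _ hu ht hw hg ht' =>
    -- A cell has no other field to which the rule could assign a type.
    obtain rfl : f = .val := by
      by_contra hne
      have hb : (f == Name.val) = false := by simpa using hne
      simp [ClassTable.ftype, ClassTable.ftypes, List.lookup, hb] at hf
    obtain ⟨Δ', h'⟩ := h.exit hu ht hw hg ht' (.inr ⟨_, hy, rfl, rfl⟩) hs
    exact ⟨Δ', loc, h'⟩
  | exitField _ hy _ _ hf _ hu ht hw hg ht' hsub =>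
    obtain ⟨Δ', h'⟩ := h.exit hu ht hw hg ht' (.inl ⟨_, _, _, hy, hf, hsub, rfl⟩) hs
    exact ⟨Δ', loc, h'⟩
  | split hx he₁ he₂ hj ih₁ ih₂ =>
    have hshape := he₁.shape
    have hshape' := he₂.shape
    simp only [DynCtx.shape, List.map_append, List.map_cons, hx.shape_set] at hshape hshape'
    rcases h.split hx with h | h
    · obtain ⟨Δ', loc', h'⟩ := ih₁ hs h
      exact ⟨Δ', loc', OK.join hj (hshape.trans hshape'.symm) (.inl h')⟩
    · obtain ⟨Δ', loc', h'⟩ := ih₂ hs h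
      exact ⟨Δ', loc', OK.join hj (hshape.trans hshape'.symm) (.inr h')⟩
  | eps =>
    cases hs
    exact ⟨Δ, loc, h⟩

end Reggio

theorem mainTheorem2 (CT : Reggio.ClassTable) (Γs Γs' : Reggio.DynCtx) (Δ : Reggio.OidCtx)
    (Ψ : Set Reggio.Reg) (c c' : Reggio.RCfg) (e : Reggio.Eff)
    (hty : Reggio.RCfgTy CT Γs Δ Ψ c)
    (hcap : Reggio.CapOK Γs c)
    (htop : Reggio.TopOK Γs c)
    (hstep : Reggio.RStep CT c e c')
    (heff : Reggio.EffTy CT Γs e Γs') :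
    ∃ (Δ' : Reggio.OidCtx) (Ψ' : Set Reggio.Reg),
      Reggio.RCfgTy CT Γs' Δ' Ψ' c' ∧ Reggio.CapOK Γs' c' ∧ Reggio.TopOK Γs' c' := by
  obtain ⟨loc, hwt⟩ := hty.wt
  obtain ⟨Δ', loc', h⟩ := (hwt.ok hcap htop).step heff hstep
  obtain ⟨Ψ', h'⟩ := h.wt.rcfgTy
  exact ⟨Δ', Ψ', h', h.invariants⟩
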